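/- A \emph{tile} is a unit rhombus with angles $60^\circ$ and $120^\circ$ made of two unit triangles of the regular triangular lattice that have a common side. Let $\mathcal T$ be a finite set of tiles with pairwise disjoint interiors. Two tiles are \emph{adjacent} if they share a side and \emph{neighbours} if they share at least a vertex. A \emph{run} of $\mathcal T$ is a maximal sequence of at least two tiles of $\mathcal T$ in which consecutive tiles share a side, all these sides being parallel (a sequence and its reversal are the same run). For $\kappa\ge 2$, $\mathcal T$ is a \emph{$\kappa$-doku tiling} if (a) the graph of adjacent tiles is connected; (b) after the removal of any one tile, the graph of neighbouring tiles is connected; (c) there are no holes, i.e. the complement in the plane of the closed region covered by $\mathcal T$ is connected; (d) every run consists of exactly $\kappa$ tiles. A triple $(\tau,\rho,\kappa)$ of natural numbers with $\kappa\ge 2$ and $\rho\ge 2$ is a \emph{Turán triple} if $$\tau=\kappa\rho-\left\lfloor\frac{\rho^2}{3}\right\rfloor\qquad\text{and}\qquad 2\left\lfloor\frac{\rho^2}{3}\right\rfloor\le\kappa\rho\le\rho+2\left\lfloor\frac{\rho^2}{3}\right\rfloor+3 .$$ \textbf{Proposition.} Let $(\tau,\rho,\kappa)$ be a Turán triple.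 Then a $\kappa$-doku tiling with exactly $\tau$ tiles and exactly $\rho$ runs exists if and only if $(\tau,\rho,\kappa)\ne(26,7,6)$. -/

import Mathlib

namespace Tredoku

/-- The unit triangles of the triangular lattice. The lattice point `(x, y)` stands for the point
`x + y * exp (i * π / 3)` of the plane. The triangle `⟨p, true⟩` has the horizontal side
`[p, p + 1]` at its bottom, and `⟨p, false⟩` is the triangle sharing with it the side opposite
to `p`. -/
structure UnitTriangle where
  pos : ℤ × ℤ
  up : Bool

/-- The three vertices of a unit triangle. -/
def UnitTriangle.vertices (t : UnitTriangle) : Finset (ℤ × ℤ) :=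
  if t.up then {t.pos, t.pos + (1, 0), t.pos + (0, 1)}
  else {t.pos + (1, 0), t.pos + (0, 1), t.pos + (1, 1)}

/-- Two unit triangles are joined when they have a side (that is, two vertices) in common. -/
def triangleGraph : SimpleGraph UnitTriangle where
  Adj s t := (s.vertices ∩ t.vertices).card = 2
  symm := ⟨fun s t h => by rw [Finset.inter_comm]; exact h⟩
  loopless := ⟨fun s h => by
    rw [Finset.inter_self, UnitTriangle.vertices] at h
    split at h <;> rw [Finset.card_eq_three.mpr ⟨_, _, _, by simp, by simp, by simp, rfl⟩] at h <;>
      omega⟩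

/-- The three directions of lattice sides: the unit vectors at angles 0, 60 and 120 degrees. -/
def dir : Fin 3 → ℤ × ℤ := ![(1, 0), (0, 1), (-1, 1)]

/-- A lozenge tile: the unit rhombus (angles 60 and 120 degrees) having `pos` as a vertex and
spanned by the two directions different from `type`. The three types are the three possible
orientations of a tile. -/
structure Lozenge where
  pos : ℤ × ℤ
  type : Fin 3

namespace Lozenge

/-- The four vertices of a tile. -/
def vertices (L : Lozenge) : Finset (ℤ × ℤ) :=
  {L.pos, L.pos + dir (L.type + 1), L.pos + dir (L.type + 2),
    L.pos + dir (L.type + 1) + dir (L.type + 2)}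

/-- The four sides of a tile; the pair `(q, d)` is the unit segment from `q` to `q + dir d`. Two
sides are parallel when they have the same second component. -/
def sides (L : Lozenge) : Finset ((ℤ × ℤ) × Fin 3) :=
  {(L.pos, L.type + 1), (L.pos + dir (L.type + 2), L.type + 1),
    (L.pos, L.type + 2), (L.pos + dir (L.type + 1), L.type + 2)}

/-- The two unit triangles of which a tile consists. -/
def triangles (L : Lozenge) : Set UnitTriangle :=
  {t | t.vertices ⊆ L.vertices}

end Lozenge

/-- The dual graph of a set of tiles: tiles are adjacent when they share a side. -/
def dualGraph (T : Finset Lozenge) : SimpleGraph T where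
  Adj X Y := X ≠ Y ∧ (X.1.sides ∩ Y.1.sides).Nonempty
  symm := ⟨fun X Y h => ⟨h.1.symm, by rw [Finset.inter_comm]; exact h.2⟩⟩
  loopless := ⟨fun X h => h.1 rfl⟩

/-- The neighbour dual graph of a set of tiles: tiles are joined when they touch, if only at a
vertex. -/
def neighbourGraph (T : Finset Lozenge) : SimpleGraph T where
  Adj X Y := X ≠ Y ∧ (X.1.vertices ∩ Y.1.vertices).Nonempty
  symm := ⟨fun X Y h => ⟨h.1.symm, by rw [Finset.inter_comm]; exact h.2⟩⟩
  loopless := ⟨fun X h => h.1 rfl⟩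

/-- Tiles of `T` that share a side of direction `d`. -/
def stripGraph (T : Finset Lozenge) (d : Fin 3) : SimpleGraph Lozenge where
  Adj X Y := X ∈ T ∧ Y ∈ T ∧ X ≠ Y ∧ ∃ q, (q, d) ∈ X.sides ∧ (q, d) ∈ Y.sides
  symm := ⟨fun _ _ h => ⟨h.2.1, h.1, h.2.2.1.symm, h.2.2.2.imp fun _ hq => ⟨hq.2, hq.1⟩⟩⟩
  loopless := ⟨fun _ h => h.2.2.1 rfl⟩

/-- The runs of `T`: the maximal sequences of at least two tiles in which consecutive tiles share a
side, all these sides being parallel. As a tile has at most two sides of a given direction and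
tiles do not overlap, they are the connected components, with at least two tiles, of the graphs
`stripGraph T d`. -/
def runs (T : Finset Lozenge) : Set (Set Lozenge) :=
  {R | R.Nontrivial ∧ ∃ (d : Fin 3) (c : (stripGraph T d).ConnectedComponent), R = c.supp}

/-- The unit triangles not covered by `T`. -/
def uncovered (T : Finset Lozenge) : Set UnitTriangle :=
  {t | ∀ X ∈ T, t ∉ X.triangles}

/-- `κ`-doku tilings (without holes). -/
structure IsDokuTiling (κ : ℕ) (T : Finset Lozenge) : Prop where
  /-- Distinct tiles do not overlap; so they are disjoint, or meet in a vertex or in a side. -/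
  nonoverlapping : ∀ X ∈ T, ∀ Y ∈ T, X ≠ Y → Disjoint X.triangles Y.triangles
  /-- The tiling is connected through sides. -/
  connected : (dualGraph T).Connected
  /-- Removing one tile does not disconnect it, connection through vertices being allowed. -/
  two_connected : ∀ X : T, ((neighbourGraph T).induce {X}ᶜ).Preconnected
  /-- The complement of the closed region covered by the tiles is connected. It is the union of the
  uncovered triangles, without the sides and vertices that also belong to a tile. -/
  no_holes : (triangleGraph.induce (uncovered T)).Preconnected
  /-- Every run consists of exactly `κ` tiles. -/
  run_length : ∀ R ∈ runs T, R.ncard = κ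

/-- Turán triples. Division is rounded down. -/
structure IsTuranTriple (τ ρ κ : ℕ) : Prop where
  two_le_runLength : 2 ≤ κ
  two_le_runs : 2 ≤ ρ
  tiles_eq : τ + ρ ^ 2 / 3 = κ * ρ
  lower : 2 * (ρ ^ 2 / 3) ≤ κ * ρ
  upper : κ * ρ ≤ ρ + 2 * (ρ ^ 2 / 3) + 3

end Tredoku

namespace Tredoku

-- A tile has sides in two directions, so it lies in at most two runs; as adjacency is connected, it
-- lies in at least one. Counting tiles run by run gives `κρ = τ + x`, where `x` is the number of
-- tiles in two runs, the crossings (`IsDokuTiling.card_crossings`). Two runs of different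
-- directions have at most one tile in common (`NonOverlapping.crossing_unique`). Hence with `n₀`,
-- `n₁`, `n₂` runs in the three directions `x ≤ n₀n₁ + n₁n₂ + n₂n₀ ≤ ⌊ρ²/3⌋`, and a Turán triple is
-- the case of equality.
--
-- Nonexistence for (26, 7, 6): equality forces 3, 2 and 2 runs in the three directions, and all
-- runs of different directions cross. Each of the three parallel runs has 6 tiles and 4 crossings,
-- hence two tiles in no other run. Such a tile is an end of its run (`IsDokuTiling.extremal`): in
-- the middle, a closed curve through its two free sides and the uncovered part of the plane would
-- separate its two neighbours, against two-connectedness. That separation is proved modulo 2, with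
-- a potential on the lattice points (`IsDokuTiling.not_free`). So all three runs end, at the same
-- side, with a tile in no other run. The three runs cross the others in compatible orders, and
-- adding up displacements shows that the last tiles stand on three consecutive segments of one line
-- (`IsDokuTiling.last_consecutive`). Of two such tiles at consecutive segments, the first must lean
-- backwards and the second forwards, since otherwise they overlap or share a side. The middle tile
-- would have to lean both ways.
--
-- Existence: three sectors of 120 degrees, each tiled by one type of tile, tile the plane. The
-- hexagon with side lengths `s 0`, `s 1`, `s 2` around the centre has `s d` runs of direction `d`,
-- each of length `s (d + 1) + s (d + 2)`, and all pairs of different directions cross. Choosing the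
-- `s d` almost equal makes these lengths `κ` or `κ - 1`; in the second case every run of the
-- direction gets one additional tile at an end (`region_isDokuTiling`). This covers all Turán
-- triples except (26, 7, 6) and (3, 2, 2), (5, 2, 3), (9, 3, 4), (11, 4, 4); the last four have
-- explicit tilings, checked by computation.

attribute [ext] UnitTriangle Lozenge

instance : DecidableEq UnitTriangle := fun s t =>
  decidable_of_iff (s.pos = t.pos ∧ s.up = t.up) UnitTriangle.ext_iff.symm

instance : DecidableEq Lozenge := fun X Y =>
  decidable_of_iff (X.pos = Y.pos ∧ X.type = Y.type) Lozenge.ext_iff.symm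

/-! ### Triangles and tiles in coordinates -/

theorem mem_triangles_zero (x y : ℤ) (t : UnitTriangle) :
    t ∈ (⟨(x, y), 0⟩ : Lozenge).triangles ↔ t = ⟨(x - 1, y), false⟩ ∨ t = ⟨(x - 1, y + 1), true⟩ := by
  obtain ⟨⟨a, b⟩, _ | _⟩ := t <;>
  simp [Lozenge.triangles, UnitTriangle.vertices, Lozenge.vertices, dir, Finset.insert_subset_iff] <;> omega

theorem mem_triangles_one (x y : ℤ) (t : UnitTriangle) :
    t ∈ (⟨(x, y), 1⟩ : Lozenge).triangles ↔ t = ⟨(x - 1, y), false⟩ ∨ t = ⟨(x, y), true⟩ := by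
  obtain ⟨⟨a, b⟩, _ | _⟩ := t <;>
  simp [Lozenge.triangles, UnitTriangle.vertices, Lozenge.vertices, dir, Finset.insert_subset_iff] <;> omega

theorem mem_triangles_two (x y : ℤ) (t : UnitTriangle) :
    t ∈ (⟨(x, y), 2⟩ : Lozenge).triangles ↔ t = ⟨(x, y), false⟩ ∨ t = ⟨(x, y), true⟩ := by
  obtain ⟨⟨a, b⟩, _ | _⟩ := t <;>
  simp [Lozenge.triangles, UnitTriangle.vertices, Lozenge.vertices, dir, Finset.insert_subset_iff] <;> omega

/-- The upward triangle having a given unit segment as a side. -/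
def upTriangle (e : (ℤ × ℤ) × Fin 3) : UnitTriangle :=
  ⟨(![e.1.1, e.1.1, e.1.1 - 1] e.2, e.1.2), true⟩

/-- The downward triangle having a given unit segment as a side. -/
def downTriangle (e : (ℤ × ℤ) × Fin 3) : UnitTriangle :=
  ⟨(![e.1.1, e.1.1 - 1, e.1.1 - 1] e.2, ![e.1.2 - 1, e.1.2, e.1.2] e.2), false⟩

theorem same_of_two_common_vertices {a b c d : ℤ} {i : Bool} {p q : ℤ × ℤ} (hpq : p ≠ q)
    (hp : p ∈ UnitTriangle.vertices ⟨(a, b), i⟩) (hp' : p ∈ UnitTriangle.vertices ⟨(c, d), i⟩)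
    (hq : q ∈ UnitTriangle.vertices ⟨(a, b), i⟩) (hq' : q ∈ UnitTriangle.vertices ⟨(c, d), i⟩) :
    a = c ∧ b = d := by
  obtain ⟨p1, p2⟩ := p
  obtain ⟨q1, q2⟩ := q
  cases i <;> simp [UnitTriangle.vertices] at hp hq hpq hp' hq' <;>
    rcases hp with h | h | h <;> rcases hp' with h' | h' | h' <;> rw [h.1, h.2] at h' hpq <;> omega

theorem adj_of_two_common_vertices {a b c d : ℤ} {p q : ℤ × ℤ} (hpq : p ≠ q)
    (hp : p ∈ UnitTriangle.vertices ⟨(a, b), true⟩) (hp' : p ∈ UnitTriangle.vertices ⟨(c, d), false⟩)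
    (hq : q ∈ UnitTriangle.vertices ⟨(a, b), true⟩) (hq' : q ∈ UnitTriangle.vertices ⟨(c, d), false⟩) :
    ∃ e, UnitTriangle.mk (a, b) true = upTriangle e ∧ UnitTriangle.mk (c, d) false = downTriangle e := by
  obtain ⟨p1, p2⟩ := p
  obtain ⟨q1, q2⟩ := q
  have : c = a ∧ d = b ∨ c = a - 1 ∧ d = b ∨ c = a ∧ d = b - 1 := by
    simp [UnitTriangle.vertices] at hp hq hpq hp' hq'
    rcases hp with h | h | h <;> rcases hp' with h' | h' | h' <;> rw [h.1, h.2] at h' hpq <;> omega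
  rcases this with ⟨rfl, rfl⟩ | ⟨rfl, rfl⟩ | ⟨rfl, rfl⟩
  · exact ⟨((c + 1, d), 2), by simp [upTriangle, downTriangle]⟩
  · exact ⟨((a, d), 1), by simp [upTriangle, downTriangle]⟩
  · exact ⟨((c, b), 0), by simp [upTriangle, downTriangle]⟩

/-- Adjacent triangles have opposite orientations and are determined by their common segment. Dual
paths thereby become sets of crossed segments. -/
theorem triangleGraph_adj_iff (s t : UnitTriangle) :
    triangleGraph.Adj s t ↔ ∃ e, s = upTriangle e ∧ t = downTriangle e ∨
      s = downTriangle e ∧ t = upTriangle e := by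
  constructor
  · intro h
    have hne : s ≠ t := triangleGraph.ne_of_adj h
    obtain ⟨p, q, hpq, he⟩ := Finset.card_eq_two.mp (show (s.vertices ∩ t.vertices).card = 2 from h)
    have hp : p ∈ s.vertices ∩ t.vertices := by rw [he]; simp
    have hq : q ∈ s.vertices ∩ t.vertices := by rw [he]; simp
    rw [Finset.mem_inter] at hp hq
    obtain ⟨⟨a, b⟩, i⟩ := s
    obtain ⟨⟨c, d⟩, j⟩ := t
    cases i <;> cases j
    · exact absurd (same_of_two_common_vertices hpq hp.1 hp.2 hq.1 hq.2) (by simpa using hne)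
    · obtain ⟨e, h⟩ := adj_of_two_common_vertices hpq hp.2 hp.1 hq.2 hq.1
      exact ⟨e, .inr h.symm⟩
    · obtain ⟨e, h⟩ := adj_of_two_common_vertices hpq hp.1 hp.2 hq.1 hq.2
      exact ⟨e, .inl h⟩
    · exact absurd (same_of_two_common_vertices hpq hp.1 hp.2 hq.1 hq.2) (by simpa using hne)
  · have key : ∀ e, triangleGraph.Adj (upTriangle e) (downTriangle e) := by
      rintro ⟨⟨x, y⟩, d⟩
      have : (upTriangle ((x, y), d)).vertices ∩ (downTriangle ((x, y), d)).vertices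
          = {(x, y), (x, y) + dir d} := by
        ext ⟨p, q⟩
        fin_cases d <;> simp [UnitTriangle.vertices, upTriangle, downTriangle, dir] <;> omega
      change Finset.card _ = 2
      rw [this, Finset.card_pair]
      fin_cases d <;> simp [dir]
    rintro ⟨e, ⟨rfl, rfl⟩ | ⟨rfl, rfl⟩⟩
    exacts [key e, (key e).symm]

/-- The diagonal of a tile along which its two triangles meet. -/
def Lozenge.diagonal (X : Lozenge) : (ℤ × ℤ) × Fin 3 :=
  ((![X.pos.1 - 1, X.pos.1, X.pos.1 + 1] X.type, ![X.pos.2 + 1, X.pos.2, X.pos.2] X.type), X.type)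

/-- A tile of type `d` corresponds to a segment of direction `d`, its short diagonal, and overlap of
tiles becomes an equality of triangles that `omega` can treat. -/
theorem mem_triangles_iff (X : Lozenge) (t : UnitTriangle) :
    t ∈ X.triangles ↔ t = upTriangle X.diagonal ∨ t = downTriangle X.diagonal := by
  obtain ⟨⟨x, y⟩, i⟩ := X
  fin_cases i
  · simp only [Fin.zero_eta, mem_triangles_zero]
    simp [upTriangle, downTriangle, Lozenge.diagonal]
    tauto
  · simp only [Fin.mk_one, mem_triangles_one]
    simp [upTriangle, downTriangle, Lozenge.diagonal]
    tauto
  · simp only [Fin.reduceFinMk, mem_triangles_two]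
    simp [upTriangle, downTriangle, Lozenge.diagonal]
    tauto

theorem triangle_of_mem_sides {X : Lozenge} {e : (ℤ × ℤ) × Fin 3} (h : e ∈ X.sides) :
    upTriangle e ∈ X.triangles ∧ downTriangle e ∉ X.triangles ∨
    upTriangle e ∉ X.triangles ∧ downTriangle e ∈ X.triangles := by
  obtain ⟨⟨x, y⟩, i⟩ := X
  obtain ⟨⟨p, q⟩, d⟩ := e
  simp only [mem_triangles_iff]
  fin_cases i <;> fin_cases d <;>
    simp [Lozenge.sides, dir, upTriangle, downTriangle, Lozenge.diagonal] at h ⊢ <;> omega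

/-- A tile containing a triangle has every side of the triangle as a side or as its diagonal. -/
theorem mem_sides_of_triangle {X : Lozenge} {e : (ℤ × ℤ) × Fin 3}
    (h : upTriangle e ∈ X.triangles ∨ downTriangle e ∈ X.triangles) :
    e ∈ X.sides ∨ e = X.diagonal := by
  obtain ⟨⟨x, y⟩, i⟩ := X
  obtain ⟨⟨p, q⟩, d⟩ := e
  simp only [mem_triangles_iff] at h
  fin_cases i <;> fin_cases d <;>
    simp [Lozenge.sides, dir, upTriangle, downTriangle, Lozenge.diagonal] at h ⊢ <;> omega

/-! ### Tiles in rotation-symmetric coordinates -/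

/-- Three lattice vectors with sum zero, at angles of 120 degrees, parallel to the sides. -/
def u : Fin 3 → ℤ × ℤ := ![(1, 0), (0, -1), (-1, 1)]

/-- The vertex `p` of a tile of type `t` that is spanned by `p + u (t + 1)` and `p + u (t + 2)`. -/
def Lozenge.corner (X : Lozenge) : ℤ × ℤ := X.pos + ![(0, 1), (0, 0), (0, 1)] X.type

/-- The tile of type `t` with vertices `p`, `p + u (t + 1)`, `p + u (t + 2)`. -/
def tileAt (t : Fin 3) (p : ℤ × ℤ) : Lozenge := ⟨p - ![(0, 1), (0, 0), (0, 1)] t, t⟩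

@[simp] theorem tileAt_type (t p) : (tileAt t p).type = t := rfl
@[simp] theorem tileAt_corner (t p) : (tileAt t p).corner = p := by simp [tileAt, Lozenge.corner]

/-- The unit segment from `p` to `p + u d`, in the normal form of `Lozenge.sides`. -/
def seg (d : Fin 3) (p : ℤ × ℤ) : (ℤ × ℤ) × Fin 3 := (p - ![(0, 0), (0, 1), (0, 0)] d, d)

theorem seg_injective (d : Fin 3) : Function.Injective (seg d) := by
  intro p q h
  simpa [seg] using h

theorem seg_surjective (e : (ℤ × ℤ) × Fin 3) : ∃ p, e = seg e.2 p :=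
  ⟨e.1 + ![(0, 0), (0, 1), (0, 0)] e.2, by simp [seg]⟩

/-- The first of the two sides of direction `d`. -/
def low (d : Fin 3) (X : Lozenge) : ℤ × ℤ :=
  if X.type = d + 2 then X.corner + u (d + 1) else X.corner

/-- The step from the first to the second side of direction `d`. -/
def step (d : Fin 3) (X : Lozenge) : ℤ × ℤ :=
  if X.type = d + 2 then - u (d + 1) else u (d + 2)

/-- Since `u d + u (d + 1) + u (d + 2) = 0`, the two possible steps `-u (d + 1)` and `u (d + 2)`
lead to the same side of a line of direction `d`. So `low` orients all tiles of a run in the same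
way, whatever their type. -/
theorem mem_sides_iff (X : Lozenge) (d : Fin 3) (p : ℤ × ℤ) :
    seg d p ∈ X.sides ↔ X.type ≠ d ∧ (p = low d X ∨ p = low d X + step d X) := by
  obtain ⟨⟨x, y⟩, i⟩ := X
  obtain ⟨p, q⟩ := p
  fin_cases i <;> fin_cases d <;>
    simp [Lozenge.sides, dir, seg, low, step, Lozenge.corner, u, Fin.ext_iff] <;> omega

/-- Tiles standing on one segment, at the same side of it, both contain the triangle there. -/
theorem low_eq_of_overlap {X Y : Lozenge} {d : Fin 3} (hX : X.type ≠ d) (hY : Y.type ≠ d)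
    (hd : Disjoint X.triangles Y.triangles) : low d X ≠ low d Y := by
  intro h
  have h1 : ∀ t, t ∈ X.triangles → t ∉ Y.triangles := fun _ ht => Set.disjoint_left.mp hd ht
  simp only [mem_triangles_iff] at h1
  have h2 := h1 (upTriangle X.diagonal)
  have h3 := h1 (downTriangle X.diagonal)
  obtain ⟨⟨x, y⟩, i⟩ := X
  obtain ⟨⟨p, q⟩, j⟩ := Y
  clear h1
  fin_cases i <;> fin_cases j <;> fin_cases d <;>
    simp [low, Lozenge.corner, u, upTriangle, downTriangle, Lozenge.diagonal, Fin.ext_iff] at h h2 h3 hX hY <;> omega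

theorem high_eq_of_overlap {X Y : Lozenge} {d : Fin 3} (hX : X.type ≠ d) (hY : Y.type ≠ d)
    (hd : Disjoint X.triangles Y.triangles) : low d X + step d X ≠ low d Y + step d Y := by
  intro h
  have h1 : ∀ t, t ∈ X.triangles → t ∉ Y.triangles := fun _ ht => Set.disjoint_left.mp hd ht
  simp only [mem_triangles_iff] at h1
  have h2 := h1 (upTriangle X.diagonal)
  have h3 := h1 (downTriangle X.diagonal)
  obtain ⟨⟨x, y⟩, i⟩ := X
  obtain ⟨⟨p, q⟩, j⟩ := Y
  clear h1
  fin_cases i <;> fin_cases j <;> fin_cases d <;>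
    simp [low, step, Lozenge.corner, u, upTriangle, downTriangle, Lozenge.diagonal, Fin.ext_iff] at h h2 h3 hX hY <;> omega

theorem mem_vertices_iff (X : Lozenge) (p : ℤ × ℤ) :
    p ∈ X.vertices ↔ p = X.corner ∨ p = X.corner + u (X.type + 1) ∨ p = X.corner + u (X.type + 2) ∨
      p = X.corner + u (X.type + 1) + u (X.type + 2) := by
  obtain ⟨⟨x, y⟩, i⟩ := X
  obtain ⟨p, q⟩ := p
  fin_cases i <;> simp [Lozenge.vertices, dir, Lozenge.corner, u] <;> omega

/-! ### A criterion for connectedness -/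

theorem preconnected_of_rank {V : Type*} {G : SimpleGraph V} (r : V → ℕ)
    (h : ∀ v, r v ≠ 0 → ∃ w, G.Adj v w ∧ r w < r v)
    (h0 : ∀ v w, r v = 0 → r w = 0 → G.Reachable v w) : G.Preconnected := by
  have key : ∀ n v, r v ≤ n → ∃ w, r w = 0 ∧ G.Reachable v w := by
    intro n
    induction n with
    | zero => exact fun v hv => ⟨v, by omega, .refl _⟩
    | succ n ih =>
      intro v hv
      by_cases hr : r v = 0
      · exact ⟨v, hr, .refl _⟩
      obtain ⟨w, hw, hlt⟩ := h v hr
      obtain ⟨x, hx, hwx⟩ := ih w (by omega)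
      exact ⟨x, hx, hw.reachable.trans hwx⟩
  intro v w
  obtain ⟨v', hv, hvv⟩ := key _ v le_rfl
  obtain ⟨w', hw, hww⟩ := key _ w le_rfl
  exact hvv.trans ((h0 _ _ hv hw).trans hww.symm)

/-! ### Closed dual paths separate the plane (mod 2) -/

/-- A function on unit segments that sums to zero around each triangle is a coboundary. -/
theorem exists_potential (c : (ℤ × ℤ) × Fin 3 → ZMod 2) (hfin : (Function.support c).Finite)
    (hup : ∀ x y, c ((x, y), 0) + c ((x, y), 1) + c ((x + 1, y), 2) = 0)
    (hdown : ∀ x y, c ((x, y + 1), 0) + c ((x + 1, y), 1) + c ((x + 1, y), 2) = 0) :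
    ∃ φ : ℤ × ℤ → ZMod 2, ∀ q d, φ (q + dir d) = φ q + c (q, d) := by
  -- Left of `M` nothing is crossed, so the potential can be normalized to vanish there and be
  -- obtained by summing along rows.
  obtain ⟨M, hM⟩ : ∃ M : ℤ, ∀ x y d, x ≤ M → c ((x, y), d) = 0 := by
    obtain ⟨M, hM⟩ := (hfin.image fun e => e.1.1).bddBelow
    refine ⟨M - 1, fun x y d hx => by_contra fun h => ?_⟩
    have := hM (Set.mem_image_of_mem (fun e : (ℤ × ℤ) × Fin 3 => e.1.1) (Function.mem_support.mpr h))
    simp only at this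
    omega
  have h2 : (2 : ZMod 2) = 0 := rfl
  -- The relations of all triangles between two neighbouring rows, added up: the sums along the rows
  -- differ by the segment that closes the strip at its right end.
  have h0 : ∀ (y : ℤ) (n : ℕ), ∑ k ∈ Finset.range n, c ((M + k, y + 1), 0)
      = ∑ k ∈ Finset.range n, c ((M + k, y), 0) + c ((M + n, y), 1) := by
    intro y n
    induction n with
    | zero => simp [hM M y 1 le_rfl]
    | succ n ih =>
      rw [Finset.sum_range_succ, Finset.sum_range_succ, ih]
      push_cast
      rw [← add_assoc M]
      linear_combination hdown (M + n) y - hup (M + n) y + (c ((M + n, y), 1) - c ((M + n + 1, y), 1)) * h2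
  set φ : ℤ × ℤ → ZMod 2 := fun p => ∑ k ∈ Finset.range (p.1 - M).toNat, c ((M + k, p.2), 0) with hφ
  have hd0 : ∀ x y, φ (x + 1, y) = φ (x, y) + c ((x, y), 0) := by
    intro x y
    by_cases hx : M ≤ x
    · obtain ⟨n, rfl⟩ := Int.le.dest hx
      have e1 : (M + n + 1 - M).toNat = n + 1 := by omega
      have e2 : (M + n - M).toNat = n := by omega
      simp only [hφ, e1, e2, Finset.sum_range_succ]
    · have e1 : (x + 1 - M).toNat = 0 := by omega
      have e2 : (x - M).toNat = 0 := by omega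
      simp [hφ, e1, e2, hM x y 0 (by omega)]
  have hd1 : ∀ x y, φ (x, y + 1) = φ (x, y) + c ((x, y), 1) := by
    intro x y
    by_cases hx : M ≤ x
    · obtain ⟨n, rfl⟩ := Int.le.dest hx
      have e2 : (M + n - M).toNat = n := by omega
      simp only [hφ, e2, h0]
    · have e2 : (x - M).toNat = 0 := by omega
      simp [hφ, e2, hM x y 1 (by omega)]
  refine ⟨φ, ?_⟩
  rintro ⟨x, y⟩ d
  fin_cases d
  · simpa [dir] using hd0 x y
  · simpa [dir] using hd1 x y
  · have a := hd0 (x - 1) y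
    have b := hd1 (x - 1) y
    have e := hup (x - 1) y
    simp only [sub_add_cancel] at a b e
    simp [dir, ← sub_eq_add_neg]
    linear_combination b - a - e + c ((x - 1, y), 1) * h2

/-- The sum of a function over the sides of a triangle. -/
def boundarySum (c : (ℤ × ℤ) × Fin 3 → ZMod 2) (t : UnitTriangle) : ZMod 2 :=
  if t.up then c (t.pos, 0) + c (t.pos, 1) + c (t.pos + (1, 0), 2)
  else c (t.pos + (0, 1), 0) + c (t.pos + (1, 0), 1) + c (t.pos + (1, 0), 2)

theorem boundarySum_add (c c' : (ℤ × ℤ) × Fin 3 → ZMod 2) (t : UnitTriangle) :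
    boundarySum (c + c') t = boundarySum c t + boundarySum c' t := by
  unfold boundarySum
  split <;> simp only [Pi.add_apply] <;> ring

theorem boundarySum_single (e : (ℤ × ℤ) × Fin 3) (t : UnitTriangle) :
    boundarySum (Pi.single e 1) t =
      (if t = upTriangle e then 1 else 0) + (if t = downTriangle e then 1 else 0) := by
  obtain ⟨⟨x, y⟩, d⟩ := e
  obtain ⟨⟨a, b⟩, i⟩ := t
  fin_cases d <;> cases i <;>
    simp [boundarySum, upTriangle, downTriangle, Pi.single_apply, eq_sub_iff_add_eq]

/-- A path of triangles has a set of crossed segments, whose boundary is the two ends. -/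
theorem exists_crossing_chain {U : Set UnitTriangle} {s t : U}
    (h : (triangleGraph.induce U).Reachable s t) :
    ∃ c : (ℤ × ℤ) × Fin 3 → ZMod 2, (Function.support c).Finite ∧
      (∀ e, c e ≠ 0 → upTriangle e ∈ U ∧ downTriangle e ∈ U) ∧
      ∀ r, boundarySum c r = (if r = s.1 then 1 else 0) + (if r = t.1 then 1 else 0) := by
  obtain ⟨p⟩ := h
  induction p with
  | nil =>
    refine ⟨0, by simp, by simp, fun r => ?_⟩
    rw [CharTwo.add_self_eq_zero]
    simp [boundarySum]
  | @cons s s' t hs p ih =>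
    obtain ⟨c, hfin, hU, hb⟩ := ih
    obtain ⟨e, he⟩ := (triangleGraph_adj_iff s.1 s'.1).mp hs
    have key : upTriangle e ∈ U ∧ downTriangle e ∈ U ∧ ∀ r : UnitTriangle, ((if r = upTriangle e then 1 else 0) +
        (if r = downTriangle e then 1 else 0) : ZMod 2) =
        (if r = s.1 then 1 else 0) + (if r = s'.1 then 1 else 0) := by
      rcases he with ⟨h1, h2⟩ | ⟨h1, h2⟩
      · exact ⟨h1 ▸ s.2, h2 ▸ s'.2, fun r => by rw [h1, h2]⟩
      · exact ⟨h2 ▸ s'.2, h1 ▸ s.2, fun r => by rw [h1, h2, add_comm]⟩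
    refine ⟨Pi.single e 1 + c, ?_, ?_, fun r => ?_⟩
    · exact ((Set.finite_singleton e).union hfin).subset
        ((Function.support_add _ _).trans (Set.union_subset_union_left _ Pi.support_single_subset))
    · intro e' he'
      by_cases hee : e' = e
      · exact hee ▸ ⟨key.1, key.2.1⟩
      · exact hU e' (by simpa [Pi.single_apply, hee] using he')
    · rw [boundarySum_add, boundarySum_single, key.2.2, hb]
      generalize (if r = s.1 then 1 else 0 : ZMod 2) = α
      generalize (if r = s'.1 then 1 else 0 : ZMod 2) = β
      generalize (if r = t.1 then 1 else 0 : ZMod 2) = γ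
      linear_combination β * CharTwo.two_eq_zero (R := ZMod 2)

theorem exists_potential_of_boundarySum {c : (ℤ × ℤ) × Fin 3 → ZMod 2}
    (hfin : (Function.support c).Finite) (h : ∀ t, boundarySum c t = 0) :
    ∃ φ : ℤ × ℤ → ZMod 2, ∀ q d, φ (q + dir d) = φ q + c (q, d) := by
  refine exists_potential c hfin (fun x y => ?_) fun x y => ?_
  · simpa [boundarySum] using h ⟨(x, y), true⟩
  · simpa [boundarySum] using h ⟨(x, y), false⟩

/-- The potential is constant on the vertices of a tile none of whose sides is crossed. -/
theorem potential_const {Y : Lozenge} {c : (ℤ × ℤ) × Fin 3 → ZMod 2} {φ : ℤ × ℤ → ZMod 2}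
    (hφ : ∀ q d, φ (q + dir d) = φ q + c (q, d)) (hc : ∀ e ∈ Y.sides, c e = 0)
    {v w : ℤ × ℤ} (hv : v ∈ Y.vertices) (hw : w ∈ Y.vertices) : φ v = φ w := by
  suffices h : ∀ v ∈ Y.vertices, φ v = φ Y.pos by rw [h v hv, h w hw]
  have h1 := hφ Y.pos (Y.type + 1)
  have h2 := hφ Y.pos (Y.type + 2)
  have h3 := hφ (Y.pos + dir (Y.type + 1)) (Y.type + 2)
  rw [hc _ (by simp [Lozenge.sides]), add_zero] at h1 h2 h3
  intro v hv
  simp only [Lozenge.vertices, Finset.mem_insert, Finset.mem_singleton] at hv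
  rcases hv with rfl | rfl | rfl | rfl
  exacts [rfl, h1, h2, h3.trans h1]

/-- The potential lives on lattice points, so it passes from tile to tile through a single common
vertex. This is why connection through vertices suffices in the separation argument. -/
theorem eq_of_neighbourGraph_reachable {T : Finset Lozenge} {X : T} {α : Type*} {φ : ℤ × ℤ → α}
    (h : ∀ Y : T, Y ≠ X → ∀ v ∈ Y.1.vertices, ∀ w ∈ Y.1.vertices, φ v = φ w)
    {P Q : ({X}ᶜ : Set T)} (hr : ((neighbourGraph T).induce {X}ᶜ).Reachable P Q) :
    ∀ v ∈ P.1.1.vertices, ∀ w ∈ Q.1.1.vertices, φ v = φ w := by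
  obtain ⟨p⟩ := hr
  induction p with
  | @nil P => exact h P.1 P.2
  | @cons P P' Q hadj p ih =>
    intro v hv w hw
    obtain ⟨z, hz⟩ := (SimpleGraph.comap_adj.mp hadj).2
    rw [Finset.mem_inter] at hz
    rw [← ih z hz.2 w hw]
    exact h _ P.2 v hv z hz.1

theorem sides_injective_of_direction {X : Lozenge} {d : Fin 3} :
    seg d (low d X) ≠ seg d (low d X + step d X) := by
  intro h
  have := seg_injective d h
  revert this
  simp only [left_eq_add, step]
  fin_cases d <;> split <;> simp [u]

theorem vertices_of_mem_sides {Y : Lozenge} {e : (ℤ × ℤ) × Fin 3} (he : e ∈ Y.sides) :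
    e.1 ∈ Y.vertices ∧ e.1 + dir e.2 ∈ Y.vertices := by
  simp only [Lozenge.sides, Finset.mem_insert, Finset.mem_singleton] at he
  rcases he with rfl | rfl | rfl | rfl <;> simp [Lozenge.vertices, add_right_comm]

/-- A side of a tile joins its two sides of the other direction. -/
theorem side_joins {X A B : Lozenge} {d d' : Fin 3} (hd : X.type ≠ d) (hd' : X.type ≠ d')
    (hdd : d ≠ d') (hA : seg d (low d X) ∈ A.sides) (hB : seg d (low d X + step d X) ∈ B.sides) :
    (seg d' (low d' X)).1 ∈ A.vertices ∧ (seg d' (low d' X)).1 + dir d' ∈ B.vertices ∨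
      (seg d' (low d' X)).1 ∈ B.vertices ∧ (seg d' (low d' X)).1 + dir d' ∈ A.vertices := by
  have hA' := vertices_of_mem_sides hA
  have hB' := vertices_of_mem_sides hB
  obtain ⟨⟨x, y⟩, i⟩ := X
  fin_cases i <;> fin_cases d <;> fin_cases d' <;>
    simp [low, step, seg, Lozenge.corner, u, dir, Fin.ext_iff] at hd hd' hdd hA' hB' ⊢ <;>
    simp [hA', hB']

theorem IsDokuTiling.diagonal_notMem {κ : ℕ} {T : Finset Lozenge} (hT : IsDokuTiling κ T)
    {X Y : Lozenge} (hX : X ∈ T) (hY : Y ∈ T) (hne : Y ≠ X) : X.diagonal ∉ Y.sides := by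
  intro h
  have := Set.disjoint_left.mp (hT.nonoverlapping Y hY X hX hne)
  rcases triangle_of_mem_sides h with h | h
  · exact this h.1 ((mem_triangles_iff _ _).mpr (.inl rfl))
  · exact this h.2 ((mem_triangles_iff _ _).mpr (.inr rfl))

/-- The triangle beyond a free side of a tile is uncovered. -/
theorem IsDokuTiling.exists_uncovered {κ : ℕ} {T : Finset Lozenge} (hT : IsDokuTiling κ T)
    {X : Lozenge} (hX : X ∈ T) {f : (ℤ × ℤ) × Fin 3} (hf : f ∈ X.sides)
    (hfY : ∀ Y ∈ T, Y ≠ X → f ∉ Y.sides) : ∃ τ t, t ∈ X.triangles ∧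
      τ ∈ uncovered T ∧ ∀ r, boundarySum (Pi.single f 1) r =
        (if r = τ then 1 else 0) + (if r = t then 1 else 0) := by
  have key : ∀ τ t : UnitTriangle, t ∈ X.triangles → τ ∉ X.triangles →
      (τ = upTriangle f ∧ t = downTriangle f ∨ τ = downTriangle f ∧ t = upTriangle f) →
      τ ∈ uncovered T := by
    intro τ t ht hτ h Y hY hτY
    have hne : Y ≠ X := by rintro rfl; exact hτ hτY
    rcases mem_sides_of_triangle (X := Y) (e := f)
      (by rcases h with h | h <;> rw [← h.1] <;> tauto) with h' | h'
    · exact hfY Y hY hne h'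
    · refine Set.disjoint_left.mp (hT.nonoverlapping Y hY X hX hne) ?_ ht
      rw [mem_triangles_iff, ← h']
      tauto
  rcases triangle_of_mem_sides hf with h | h
  · exact ⟨_, _, h.1, key _ _ h.1 h.2 (.inr ⟨rfl, rfl⟩), fun r => by
      rw [boundarySum_single, add_comm]⟩
  · exact ⟨_, _, h.2, key _ _ h.2 h.1 (.inl ⟨rfl, rfl⟩), fun r => by
      rw [boundarySum_single]⟩

/-- In a doku tiling, a tile with neighbours along both sides of one direction has a neighbour along
a side of the other direction. -/
theorem IsDokuTiling.not_free {κ : ℕ} {T : Finset Lozenge} (hT : IsDokuTiling κ T) {X A B : Lozenge}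
    (hX : X ∈ T) (hA : A ∈ T) (hB : B ∈ T) (hAX : A ≠ X) (hBX : B ≠ X) {d d' : Fin 3}
    (hd : X.type ≠ d) (hd' : X.type ≠ d') (hdd : d ≠ d')
    (hAs : seg d (low d X) ∈ A.sides) (hBs : seg d (low d X + step d X) ∈ B.sides) :
    ∃ Y ∈ T, Y ≠ X ∧ ∃ q, (q, d') ∈ X.sides ∧ (q, d') ∈ Y.sides := by
  -- If both sides of direction `d'` are free, the uncovered triangles beyond them are joined by an
  -- uncovered path, because there are no holes.
  by_contra hcon
  push Not at hcon
  set f₁ := seg d' (low d' X) with hf₁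
  set f₂ := seg d' (low d' X + step d' X) with hf₂
  have hf₁s : f₁ ∈ X.sides := (mem_sides_iff _ _ _).mpr ⟨hd', .inl rfl⟩
  have hf₂s : f₂ ∈ X.sides := (mem_sides_iff _ _ _).mpr ⟨hd', .inr rfl⟩
  have hf₁Y : ∀ Y ∈ T, Y ≠ X → f₁ ∉ Y.sides := fun Y hY hne => hcon Y hY hne _ hf₁s
  have hf₂Y : ∀ Y ∈ T, Y ≠ X → f₂ ∉ Y.sides := fun Y hY hne => hcon Y hY hne _ hf₂s
  obtain ⟨τ₁, t₁, ht₁, hτ₁, hb₁⟩ := hT.exists_uncovered hX hf₁s hf₁Y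
  obtain ⟨τ₂, t₂, ht₂, hτ₂, hb₂⟩ := hT.exists_uncovered hX hf₂s hf₂Y
  obtain ⟨c, hfin, hcU, hb⟩ := exists_crossing_chain (hT.no_holes ⟨τ₁, hτ₁⟩ ⟨τ₂, hτ₂⟩)
  -- the dual loop crosses the diagonal unless both free sides belong to one triangle
  obtain ⟨g, hgs, hg, hgb⟩ : ∃ g : (ℤ × ℤ) × Fin 3 → ZMod 2, (Function.support g).Finite ∧
      (∀ e, e ≠ X.diagonal → g e = 0) ∧ ∀ r, boundarySum g r =
        (if r = t₁ then 1 else 0) + (if r = t₂ then 1 else 0) := by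
    rw [mem_triangles_iff] at ht₁ ht₂
    by_cases h : t₁ = t₂
    · refine ⟨0, by simp, by simp, fun r => ?_⟩
      rw [h, CharTwo.add_self_eq_zero]
      simp [boundarySum]
    · refine ⟨Pi.single X.diagonal 1, (Set.finite_singleton _).subset Pi.support_single_subset,
        fun e he => by simp [he], fun r => ?_⟩
      rw [boundarySum_single]
      rcases ht₁ with h1 | h1 <;> rcases ht₂ with h2 | h2 <;> rw [h1, h2] at h ⊢ <;>
        first | exact absurd rfl h | rfl | rw [add_comm]
  -- The closed dual curve: the uncovered path, closed up through `X` by way of the free sides. Its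
  -- boundary vanishes modulo 2, and among the tiles it meets only `X`.
  set C := c + (Pi.single f₁ 1 + Pi.single f₂ 1) + g with hC
  have hsupp : (Function.support C).Finite := by
    have hs : ∀ f, (Function.support (Pi.single f 1 : (ℤ × ℤ) × Fin 3 → ZMod 2)).Finite := fun f =>
      (Set.finite_singleton f).subset Pi.support_single_subset
    have ha : ∀ a b : (ℤ × ℤ) × Fin 3 → ZMod 2, (Function.support a).Finite →
        (Function.support b).Finite → (Function.support (a + b)).Finite := fun a b h h' =>
      (h.union h').subset (Function.support_add a b)
    exact ha _ _ (ha _ _ hfin (ha _ _ (hs _) (hs _))) hgs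
  obtain ⟨φ, hφ⟩ := exists_potential_of_boundarySum hsupp fun r => by
    rw [hC, boundarySum_add, boundarySum_add, boundarySum_add, hb, hb₁, hb₂, hgb]
    generalize (if r = τ₁ then 1 else 0 : ZMod 2) = α
    generalize (if r = τ₂ then 1 else 0 : ZMod 2) = β
    generalize (if r = t₁ then 1 else 0 : ZMod 2) = γ
    generalize (if r = t₂ then 1 else 0 : ZMod 2) = δ
    linear_combination (α + β + γ + δ) * CharTwo.two_eq_zero (R := ZMod 2)
  have hcov : ∀ Y ∈ T, ∀ e ∈ Y.sides, c e = 0 := by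
    intro Y hY e he
    by_contra h
    obtain ⟨h1, h2⟩ := hcU e h
    rcases triangle_of_mem_sides he with h | h
    exacts [h1 Y hY h.1, h2 Y hY h.2]
  have hCY : ∀ Y ∈ T, Y ≠ X → ∀ e ∈ Y.sides, C e = 0 := by
    intro Y hY hne e he
    have e1 : e ≠ f₁ := by rintro rfl; exact hf₁Y Y hY hne he
    have e2 : e ≠ f₂ := by rintro rfl; exact hf₂Y Y hY hne he
    have e3 : e ≠ X.diagonal := by rintro rfl; exact hT.diagonal_notMem hX hY hne he
    simp [hC, hcov Y hY e he, hg e e3, e1, e2]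
  have hconst : ∀ v ∈ A.vertices, ∀ w ∈ B.vertices, φ v = φ w := by
    let P : ({⟨X, hX⟩}ᶜ : Set T) := ⟨⟨A, hA⟩, fun h => hAX (congrArg Subtype.val h)⟩
    let Q : ({⟨X, hX⟩}ᶜ : Set T) := ⟨⟨B, hB⟩, fun h => hBX (congrArg Subtype.val h)⟩
    have hc : ∀ Y : T, Y ≠ ⟨X, hX⟩ → ∀ v ∈ Y.1.vertices, ∀ w ∈ Y.1.vertices, φ v = φ w :=
      fun Y hne v hv w hw => potential_const hφ (hCY Y Y.2 fun h => hne (Subtype.ext h)) hv hw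
    have hr := hT.two_connected ⟨X, hX⟩ P Q
    have h3 := eq_of_neighbourGraph_reachable hc hr
    exact h3
  -- The side `f₁` joins a vertex of `A` to a vertex of `B` and is crossed once, so the potential
  -- differs at its ends; but `A` and `B` are connected without `X`, so it must be the same.
  have hCf : C f₁ = 1 := by
    have e2 : f₁ ≠ f₂ := sides_injective_of_direction
    have e3 : f₁ ≠ X.diagonal := by
      intro h
      exact hd' (congrArg Prod.snd h).symm
    simp [hC, hcov X hX _ hf₁s, hg _ e3, e2]
  have hends := side_joins hd hd' hdd hAs hBs
  have h01 := hφ f₁.1 d'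
  rw [show (f₁.1, d') = f₁ from rfl, hCf] at h01
  rcases hends with ⟨h1, h2⟩ | ⟨h1, h2⟩
  · rw [hconst _ h1 _ h2] at h01
    exact one_ne_zero (left_eq_add.mp h01)
  · rw [hconst _ h2 _ h1] at h01
    exact one_ne_zero (left_eq_add.mp h01)

/-! ### Runs as sequences of tiles -/

theorem fin3_add (d : Fin 3) : d + 1 + 1 = d + 2 ∧ d + 1 + 2 = d ∧ d + 2 + 1 = d ∧ d + 2 + 2 = d + 1 := by
  revert d; decide

theorem fin3_ne (d : Fin 3) : d + 1 ≠ d ∧ d + 2 ≠ d ∧ d + 1 ≠ d + 2 ∧ d + 2 ≠ d + 1 + 2 ∧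
    d ≠ d + 2 + 2 ∧ d ≠ d + 1 := by
  revert d; decide

theorem fin3_eq_or {d i : Fin 3} (h : i ≠ d) : i = d + 1 ∨ i = d + 2 := by
  revert d i; decide

theorem fin3_eq_or' {d i : Fin 3} (h : i ≠ d) : d = i + 1 ∨ d = i + 2 := by
  revert d i; decide

theorem fin3_eq {d i : Fin 3} (h : i ≠ d) (h' : i ≠ d + 1) : i = d + 2 := by
  revert d i; decide

theorem fin3_eq_of_ne {d d' e i : Fin 3} (h : d' ≠ d) (hd : i ≠ d) (hd' : i ≠ d') (he : e ≠ i)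
    (hed : e ≠ d) : d' = e := by
  omega

/-- `Y` is the tile after `X` in a run of direction `d`. -/
def Follows (T : Finset Lozenge) (d : Fin 3) (X Y : Lozenge) : Prop :=
  X ∈ T ∧ Y ∈ T ∧ X.type ≠ d ∧ Y.type ≠ d ∧ low d Y = low d X + step d X

/-- The height above the line of direction `d` through the origin. -/
def height (d : Fin 3) (X : Lozenge) : ℤ :=
  ![(low d X).2, (low d X).1, -(low d X).1 - (low d X).2] d

/-- The tiles do not overlap. -/
def NonOverlapping (T : Finset Lozenge) : Prop :=
  ∀ X ∈ T, ∀ Y ∈ T, X ≠ Y → Disjoint X.triangles Y.triangles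

variable {T : Finset Lozenge} {d : Fin 3} {X Y Z : Lozenge}

theorem Follows.height_eq (h : Follows T d X Y) : height d Y = height d X + 1 := by
  obtain ⟨-, -, h1, -, h3⟩ := h
  unfold height
  rw [h3, step]
  fin_cases d <;> split <;> simp [u] <;> ring

theorem Follows.ne (h : Follows T d X Y) : X ≠ Y := by
  rintro rfl
  have := h.height_eq
  omega

theorem Follows.adj (h : Follows T d X Y) : (stripGraph T d).Adj X Y := by
  obtain ⟨h1, h2, h3, h4, h5⟩ := id h
  refine ⟨h1, h2, h.ne, (seg d (low d Y)).1, ?_, ?_⟩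
  · exact (mem_sides_iff _ _ _).mpr ⟨h3, .inr h5⟩
  · exact (mem_sides_iff _ _ _).mpr ⟨h4, .inl rfl⟩

/-- A common side must be the upper side of one tile and the lower side of the other, since
otherwise both tiles lie at the same side of it and overlap. -/
theorem NonOverlapping.adj_iff (hT : NonOverlapping T) :
    (stripGraph T d).Adj X Y ↔ Follows T d X Y ∨ Follows T d Y X := by
  refine ⟨?_, fun h => h.elim Follows.adj fun h => h.adj.symm⟩
  rintro ⟨hX, hY, hne, q, h1, h2⟩
  obtain ⟨p, hp⟩ := seg_surjective (q, d)
  change (q, d) = seg d p at hp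
  rw [hp, mem_sides_iff] at h1 h2
  have hd := hT X hX Y hY hne
  obtain ⟨hx, h1⟩ := h1
  obtain ⟨hy, h2⟩ := h2
  have e1 := low_eq_of_overlap hx hy hd
  have e2 := high_eq_of_overlap hx hy hd
  rcases h1 with h1 | h1 <;> rcases h2 with h2 | h2
  · exact absurd (h1.symm.trans h2) e1
  · exact .inr ⟨hY, hX, hy, hx, h1.symm.trans h2⟩
  · exact .inl ⟨hX, hY, hx, hy, h2.symm.trans h1⟩
  · exact absurd (h1.symm.trans h2) e2

theorem NonOverlapping.follows_unique (hT : NonOverlapping T) (h : Follows T d X Y)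
    (h' : Follows T d X Z) : Y = Z := by
  by_contra hne
  exact low_eq_of_overlap h.2.2.2.1 h'.2.2.2.1 (hT Y h.2.1 Z h'.2.1 hne)
    (h.2.2.2.2.trans h'.2.2.2.2.symm)

theorem NonOverlapping.follows_unique' (hT : NonOverlapping T) (h : Follows T d Y X)
    (h' : Follows T d Z X) : Y = Z := by
  by_contra hne
  exact high_eq_of_overlap h.2.2.1 h'.2.2.1 (hT Y h.1 Z h'.1 hne)
    (h.2.2.2.2.symm.trans h'.2.2.2.2)

/-- The tile shares a side of direction `d` with another tile of `T`. -/
def Active (T : Finset Lozenge) (d : Fin 3) (X : Lozenge) : Prop := ∃ Y, (stripGraph T d).Adj X Y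

/-- The tiles connected with `X` through sides of direction `d`. -/
def runOf (T : Finset Lozenge) (d : Fin 3) (X : Lozenge) : Set Lozenge :=
  ((stripGraph T d).connectedComponentMk X).supp

theorem mem_runOf : Y ∈ runOf T d X ↔ (stripGraph T d).Reachable Y X := by
  simp [runOf, SimpleGraph.ConnectedComponent.mem_supp_iff]

theorem self_mem_runOf : X ∈ runOf T d X := mem_runOf.mpr (.refl _)

theorem runOf_eq (h : Y ∈ runOf T d X) : runOf T d Y = runOf T d X := by
  rw [runOf, runOf, SimpleGraph.ConnectedComponent.sound (mem_runOf.mp h)]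

theorem mem_runOf_iff_eq : Y ∈ runOf T d X ↔ runOf T d Y = runOf T d X :=
  ⟨runOf_eq, fun h => h ▸ self_mem_runOf⟩

theorem Active.mem (h : Active T d X) : X ∈ T := h.choose_spec.1

theorem Active.type_ne (hT : NonOverlapping T) (h : Active T d X) : X.type ≠ d := by
  obtain ⟨Y, h⟩ := h
  rcases hT.adj_iff.mp h with h | h
  exacts [h.2.2.1, h.2.2.2.1]

theorem active_of_mem_runOf (hX : Active T d X) (h : Y ∈ runOf T d X) : Active T d Y := by
  obtain ⟨p⟩ := mem_runOf.mp h
  cases p with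
  | nil => exact hX
  | cons h p => exact ⟨_, h⟩

/-- Successors and predecessors are unique and raise or lower the height by one, so iterating the
successor from the lowest tile exhausts the component. Nothing is said about `f i` for `i` beyond
the length of the run. -/
theorem NonOverlapping.exists_seq (hT : NonOverlapping T) (hX : Active T d X) :
    ∃ f : ℕ → Lozenge, (∀ i, i + 1 < (runOf T d X).ncard → Follows T d (f i) (f (i + 1))) ∧
      (∀ i < (runOf T d X).ncard, height d (f i) = height d (f 0) + i) ∧
      ∀ Y, Y ∈ runOf T d X ↔ ∃ i < (runOf T d X).ncard, Y = f i := by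
  set R := runOf T d X with hR
  have hRT : R ⊆ T := fun Y hY => (active_of_mem_runOf hX hY).mem
  have hfin : R.Finite := T.finite_toSet.subset hRT
  obtain ⟨X₀, hX₀, hmin⟩ := Set.exists_min_image R (height d) hfin ⟨X, self_mem_runOf⟩
  -- The sequence stays at the last tile once there is no successor; the set `N` below collects the
  -- indices before this happens.
  let g : ℕ → Lozenge := fun n => n.rec X₀ fun _ Y =>
    open Classical in if h : ∃ Z, Follows T d Y Z then h.choose else Y
  have hg : ∀ n Z, Follows T d (g n) Z → g (n + 1) = Z := by
    intro n Z h
    have hex : ∃ Z, Follows T d (g n) Z := ⟨Z, h⟩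
    have : g (n + 1) = hex.choose := dif_pos hex
    rw [this]
    exact hT.follows_unique hex.choose_spec h
  set N : Set ℕ := {n | ∀ i < n, Follows T d (g i) (g (i + 1))} with hN
  have hheight : ∀ n ∈ N, height d (g n) = height d X₀ + n := by
    intro n
    induction n with
    | zero => intro _; simp [g]
    | succ n ih =>
      intro h
      rw [(h n (by omega)).height_eq, ih fun i hi => h i (by omega)]
      push_cast; ring
  have hNR : ∀ n ∈ N, g n ∈ R := by
    intro n
    induction n with
    | zero => exact fun _ => hX₀
    | succ n ih =>
      intro h
      have h1 := ih fun i hi => h i (by omega)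
      exact mem_runOf.mpr ((h n (by omega)).adj.symm.reachable.trans (mem_runOf.mp h1))
  have hRN : ∀ Y ∈ R, ∃ n ∈ N, Y = g n := by
    have key : ∀ A B (p : (stripGraph T d).Walk A B), (∃ n ∈ N, B = g n) → ∃ n ∈ N, A = g n := by
      intro A B p
      induction p with
      | nil => exact id
      | cons h p ih =>
        intro hB
        obtain ⟨n, hn, rfl⟩ := ih hB
        rcases hT.adj_iff.mp h with h | h
        · cases n with
          | zero =>
            have h1 := h.height_eq
            have h2 := hmin _ (mem_runOf.mpr (h.adj.reachable.trans (mem_runOf.mp (hNR 0 hn))))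
            have h3 := hheight 0 hn
            push_cast at h3
            omega
          | succ n =>
            exact ⟨n, fun i hi => hn i (by omega), hT.follows_unique' h (hn n (by omega))⟩
        · refine ⟨n + 1, fun i hi => ?_, (hg n _ h).symm⟩
          rcases Nat.lt_succ_iff_lt_or_eq.mp hi with hi | rfl
          · exact hn i hi
          · rw [hg _ _ h]; exact h
    intro Y hY
    obtain ⟨p⟩ := mem_runOf.mp ((runOf_eq hX₀).symm ▸ hY : Y ∈ runOf T d X₀)
    exact key _ _ p ⟨0, by simp [hN], rfl⟩
  have hinj : Set.InjOn g N := by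
    intro a ha b hb hab
    have h1 := hheight a ha
    have h2 := hheight b hb
    rw [hab] at h1
    omega
  have himg : g '' N = R := by
    ext Y
    constructor
    · rintro ⟨n, hn, rfl⟩; exact hNR n hn
    · intro hY
      obtain ⟨n, hn, rfl⟩ := hRN Y hY
      exact ⟨n, hn, rfl⟩
  have hNfin : N.Finite := Set.Finite.of_finite_image (himg ▸ hfin) hinj
  have hcard : N.ncard = R.ncard := by rw [← himg, hinj.ncard_image]
  obtain ⟨m, hm⟩ : ∃ m, ∀ n, n ∈ N ↔ n < m := by
    obtain ⟨k, hk⟩ : ∃ k, k ∉ N := by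
      by_contra h
      push Not at h
      exact Set.infinite_univ (hNfin.subset fun x _ => h x)
    classical
    have hex : ∃ k, k ∉ N := ⟨k, hk⟩
    have hmem : ∀ n, n ∈ N ↔ n < Nat.find hex := by
      intro n
      constructor
      · intro h
        by_contra hlt
        exact Nat.find_spec hex fun i hi => h i (by omega)
      · intro h
        exact not_not.mp (Nat.find_min hex h)
    exact ⟨_, hmem⟩
  obtain rfl : m = R.ncard := by
    have : N = Set.Iio m := Set.ext hm
    rw [← hcard, this, ← Finset.coe_Iio, Set.ncard_coe_finset, Nat.card_Iio]
  refine ⟨g, fun i hi => (hm _).mpr hi i (by omega), fun i hi => hheight i ((hm i).mpr hi), ?_⟩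
  intro Y
  constructor
  · intro hY
    obtain ⟨n, hn, rfl⟩ := hRN Y hY
    exact ⟨n, (hm n).mp hn, rfl⟩
  · rintro ⟨n, hn, rfl⟩
    exact hNR n ((hm n).mpr hn)

theorem NonOverlapping.height_injOn (hT : NonOverlapping T) (hX : Active T d X)
    (hY : Y ∈ runOf T d X) (hZ : Z ∈ runOf T d X) (h : height d Y = height d Z) : Y = Z := by
  obtain ⟨f, -, hh, hf⟩ := hT.exists_seq hX
  obtain ⟨i, hi, rfl⟩ := (hf Y).mp hY
  obtain ⟨j, hj, rfl⟩ := (hf Z).mp hZ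
  rw [hh i hi, hh j hj] at h
  rw [show i = j by omega]

open Classical in
/-- The tiles of the run of `X` from height `a` to below height `b`. -/
noncomputable def segment (T : Finset Lozenge) (d : Fin 3) (X : Lozenge) (a b : ℤ) : Finset Lozenge :=
  T.filter fun Z => Z ∈ runOf T d X ∧ a ≤ height d Z ∧ height d Z < b

theorem sum_step (S : Finset Lozenge) (d : Fin 3) :
    ∑ Z ∈ S, step d Z = ((S.filter (·.type ≠ d + 2)).card : ℤ) • u (d + 2)
      - ((S.filter (·.type = d + 2)).card : ℤ) • u (d + 1) := by
  unfold step
  rw [Finset.sum_ite, Finset.sum_const, Finset.sum_const, natCast_zsmul, natCast_zsmul, smul_neg]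
  abel

/-- Telescoping: each tile of type `d + 2` that is passed contributes `-u (d + 1)`, each other one
`u (d + 2)`. The starting tile counts, the final one does not. All of the geometry of runs is drawn
from this formula. -/
theorem NonOverlapping.low_eq (hT : NonOverlapping T) (hX : Active T d X)
    (hY : Y ∈ runOf T d X) (hXY : height d X ≤ height d Y) :
    low d Y = low d X
      - (((segment T d X (height d X) (height d Y)).filter (·.type = d + 2)).card : ℤ) • u (d + 1)
      + (((segment T d X (height d X) (height d Y)).filter (·.type ≠ d + 2)).card : ℤ) • u (d + 2) := by
  obtain ⟨f, hfol, hh, hf⟩ := hT.exists_seq hX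
  obtain ⟨i, hi, hXi⟩ := (hf X).mp self_mem_runOf
  obtain ⟨j, hj, rfl⟩ := (hf Y).mp hY
  have hsum : ∀ n, i + n < (runOf T d X).ncard → low d (f (i + n)) = low d X +
      ∑ k ∈ Finset.range n, step d (f (i + k)) := by
    intro n
    induction n with
    | zero => simp [hXi]
    | succ n ih =>
      intro h
      rw [Finset.sum_range_succ, ← add_assoc (low d X), ← ih (by omega)]
      exact (hfol (i + n) h).2.2.2.2
  have hhX : height d X = height d (f 0) + i := hXi ▸ hh i hi
  have hij : i ≤ j := by
    rw [hh j hj] at hXY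
    omega
  obtain ⟨n, rfl⟩ := Nat.exists_eq_add_of_le hij
  have hseg : segment T d X (height d X) (height d (f (i + n))) =
      (Finset.range n).image fun k => f (i + k) := by
    ext Z
    simp only [segment, Finset.mem_filter, Finset.mem_image, Finset.mem_range]
    constructor
    · rintro ⟨-, hZ, h1, h2⟩
      obtain ⟨k, hk, rfl⟩ := (hf Z).mp hZ
      rw [hh k hk] at h1 h2
      rw [hh _ hj] at h2
      exact ⟨k - i, by omega, by congr 1; omega⟩
    · rintro ⟨k, hk, rfl⟩
      have hm : f (i + k) ∈ runOf T d X := (hf _).mpr ⟨i + k, by omega, rfl⟩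
      refine ⟨(active_of_mem_runOf hX hm).mem, hm, ?_, ?_⟩
      · rw [hh (i + k) (by omega)]; push_cast; omega
      · rw [hh (i + k) (by omega), hh _ hj]; push_cast; omega
  have hinj : Set.InjOn (fun k => f (i + k)) (Finset.range n : Set ℕ) := by
    intro a ha b hb hab
    simp only [Finset.coe_range, Set.mem_Iio] at ha hb
    have := congrArg (height d) hab
    simp only at this
    rw [hh (i + a) (by omega), hh (i + b) (by omega)] at this
    omega
  rw [hsum n hj, hseg, ← Finset.sum_image (f := step d) hinj, sum_step]
  abel

theorem NonOverlapping.lt_or_lt (hT : NonOverlapping T) (hX : Active T d X)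
    (hY : Y ∈ runOf T d X) (hne : X ≠ Y) : height d X < height d Y ∨ height d Y < height d X :=
  lt_or_gt_of_ne fun h => hne (hT.height_injOn hX self_mem_runOf hY h)

/-- The displacement along a run, with what is needed about the signs. -/
theorem NonOverlapping.exists_displacement (hT : NonOverlapping T) (hX : Active T d X)
    (hY : Y ∈ runOf T d X) (hXY : height d X < height d Y) : ∃ a b : ℤ, 0 ≤ a ∧ 0 ≤ b ∧
      (X.type = d + 2 → 1 ≤ a) ∧ (X.type ≠ d + 2 → 1 ≤ b) ∧
      low d Y = low d X - a • u (d + 1) + b • u (d + 2) := by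
  refine ⟨_, _, by positivity, by positivity, fun h => ?_, fun h => ?_, hT.low_eq hX hY hXY.le⟩
  all_goals
    norm_cast
    refine Finset.card_pos.mpr ⟨X, ?_⟩
    simp [segment, hX.mem, self_mem_runOf, hXY, h]

/-- A tile of a run that is in no other run is at an end of the run. -/
theorem IsDokuTiling.extremal {κ : ℕ} (hT : IsDokuTiling κ T) (hX : Active T d X) {d' : Fin 3}
    (hdd : d ≠ d') (ht : X.type ≠ d') (hX' : ¬ Active T d' X) :
    (∀ Y ∈ runOf T d X, height d X ≤ height d Y) ∨ ∀ Y ∈ runOf T d X, height d Y ≤ height d X := by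
  have hN : NonOverlapping T := hT.nonoverlapping
  obtain ⟨f, hfol, hh, hf⟩ := hN.exists_seq hX
  obtain ⟨i, hi, hXi⟩ := (hf X).mp self_mem_runOf
  have hhX : height d X = height d (f 0) + i := hXi ▸ hh i hi
  by_contra hcon
  push Not at hcon
  obtain ⟨⟨Y, hY, hYX⟩, Z, hZ, hZX⟩ := hcon
  obtain ⟨j, hj, rfl⟩ := (hf Y).mp hY
  obtain ⟨k, hk, rfl⟩ := (hf Z).mp hZ
  rw [hh j hj] at hYX
  rw [hh k hk] at hZX
  have hA := hfol (i - 1) (by omega)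
  have hB := hfol i (by omega)
  rw [show i - 1 + 1 = i by omega, ← hXi] at hA
  rw [← hXi] at hB
  obtain ⟨W, hW, hWX, q, h1, h2⟩ := hT.not_free hX.mem hA.1 hB.2.1 hA.ne hB.ne.symm hA.2.2.2.1 ht hdd
    ((mem_sides_iff _ _ _).mpr ⟨hA.2.2.1, .inr hA.2.2.2.2⟩)
    ((mem_sides_iff _ _ _).mpr ⟨hB.2.2.2.1, .inl hB.2.2.2.2.symm⟩)
  exact hX' ⟨W, hX.mem, hW, hWX.symm, q, h1, h2⟩

/-! ### Crossings of runs -/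

theorem low_of_type_eq {d : Fin 3} {X : Lozenge} (h : X.type = d + 2) :
    low d X = X.corner + u (d + 1) := if_pos h

theorem low_of_type_ne {d : Fin 3} {X : Lozenge} (h : X.type ≠ d + 2) : low d X = X.corner :=
  if_neg h

section
variable {T : Finset Lozenge} {d : Fin 3} {X Y Z : Lozenge}

/-- The displacement between two tiles of a run, in terms of their order. -/
theorem NonOverlapping.exists_displacement' (hT : NonOverlapping T) (hX : Active T d X)
    (hY : Y ∈ runOf T d X) (hne : X ≠ Y) : ∃ a b : ℤ,
      low d Y = low d X - a • u (d + 1) + b • u (d + 2) ∧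
      (height d X < height d Y ∧ 0 ≤ a ∧ 0 ≤ b ∧
        (X.type = d + 2 → 1 ≤ a) ∧ (X.type ≠ d + 2 → 1 ≤ b) ∨
      height d Y < height d X ∧ a ≤ 0 ∧ b ≤ 0 ∧
        (Y.type = d + 2 → a ≤ -1) ∧ (Y.type ≠ d + 2 → b ≤ -1)) := by
  rcases hT.lt_or_lt hX hY hne with h | h
  · obtain ⟨a, b, h1, h2, h3, h4, h5⟩ := hT.exists_displacement hX hY h
    exact ⟨a, b, h5, .inl ⟨h, h1, h2, h3, h4⟩⟩
  · have hX' : X ∈ runOf T d Y := mem_runOf.mpr (mem_runOf.mp hY).symm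
    obtain ⟨a, b, h1, h2, h3, h4, h5⟩ := hT.exists_displacement (active_of_mem_runOf hX hY) hX' h
    refine ⟨-a, -b, ?_, .inr ⟨h, by omega, by omega, fun h => ?_, fun h => ?_⟩⟩
    · rw [h5, neg_smul, neg_smul]; abel
    · have := h3 h; omega
    · have := h4 h; omega

/-- The displacement along the first run is, up to sign, in the cone of `-u (d + 1)` and `u (d +
2)`, and along the second in the cone of `-u (d + 2)` and `u d = -u (d + 1) - u (d + 2)`. Passing a
tile of type `d + 2` makes the coefficients of `-u (d + 1)` nonzero; then those of `u (d + 2)` have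
incompatible signs. -/
theorem NonOverlapping.crossing_unique (hT : NonOverlapping T) (hX : Active T d X)
    (hX' : Active T (d + 1) X) (hXt : X.type = d + 2) (hYt : Y.type = d + 2)
    (hY : Y ∈ runOf T d X) (hY' : Y ∈ runOf T (d + 1) X) : X = Y := by
  by_contra hne
  obtain ⟨a, b, h1, h2⟩ := hT.exists_displacement' hX hY hne
  obtain ⟨a', b', h3, h4⟩ := hT.exists_displacement' hX' hY' hne
  rw [low_of_type_eq hXt, low_of_type_eq hYt] at h1
  have hd := (fin3_ne d).2.2.2.1
  rw [low_of_type_ne (hXt.trans_ne hd), low_of_type_ne (hYt.trans_ne hd)] at h3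
  simp only [hXt, hYt, hd, ne_eq, not_true_eq_false, not_false_eq_true, true_imp_iff, false_imp_iff] at h2 h4
  rw [Prod.ext_iff] at h1 h3
  fin_cases d <;> simp [u] at h1 h3 <;> omega

/-- The relation between the orders of the crossings of three runs of different directions. -/
theorem NonOverlapping.triangle_order (hT : NonOverlapping T) (hX : Active T d X)
    (hY : Active T (d + 2) Y) (hZ : Active T (d + 1) Z) (hXt : X.type = d + 2)
    (hYt : Y.type = d + 1) (hZt : Z.type = d) (hXY : Y ∈ runOf T d X)
    (hYZ : Z ∈ runOf T (d + 2) Y) (hZX : X ∈ runOf T (d + 1) Z) :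
    height d X < height d Y ↔ height (d + 1) Z < height (d + 1) X := by
  have hd1 := (fin3_ne d).2.2.1
  have hd2 := (fin3_add d).2.2.2.symm
  have hd3 := (fin3_add d).2.1.symm
  have hd4 := (fin3_ne d).2.2.2.2.1
  have hd5 := (fin3_ne d).2.2.2.1
  have hd6 := (fin3_ne d).2.2.2.2.2
  have hd7 := (fin3_ne d).2.1
  have hne1 : X ≠ Y := by rintro rfl; exact hd1 (hYt.symm.trans hXt)
  have hne2 : Y ≠ Z := by rintro rfl; exact hd6 (hZt.symm.trans hYt)
  have hne3 : Z ≠ X := by rintro rfl; exact hd7 (hXt.symm.trans hZt)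
  obtain ⟨a, b, h1, h2⟩ := hT.exists_displacement' hX hXY hne1
  obtain ⟨a', b', h3, h4⟩ := hT.exists_displacement' hY hYZ hne2
  obtain ⟨a'', b'', h5, h6⟩ := hT.exists_displacement' hZ hZX hne3
  rw [low_of_type_eq hXt, low_of_type_ne (hYt.trans_ne hd1)] at h1
  rw [low_of_type_eq (hYt.trans hd2), low_of_type_ne (hZt.trans_ne hd4)] at h3
  rw [low_of_type_eq (hZt.trans hd3), low_of_type_ne (hXt.trans_ne hd5)] at h5
  simp only [hXt, hYt, hZt, ne_eq, hd1, ← hd2, ← hd3, not_true_eq_false, not_false_eq_true,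
    true_imp_iff, false_imp_iff] at h2 h4 h6
  simp only [hd6, hd7, not_false_eq_true, true_imp_iff, false_imp_iff] at h4 h6
  rw [Prod.ext_iff] at h1 h3 h5
  clear hXY hYZ hZX hX hY hZ hXt hYt hZt
  -- The three displacements lead around a triangle of runs and add up to zero; this leaves only the
  -- consistent choices of signs.
  fin_cases d <;> simp [u] at h1 h3 h5 h2 h4 h6 ⊢ <;> omega

/-- If two runs of a direction cross two runs of another direction in different orders, then some two
of the crossings are far apart. -/
theorem NonOverlapping.parallel_order (hT : NonOverlapping T) {X₁ X₂ Y₁ Y₂ : Lozenge}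
    (hX₁ : Active T d X₁) (hY₂ : Active T d Y₂) (hX₁' : Active T (d + 1) X₁)
    (hX₂' : Active T (d + 1) X₂)
    (hX₁t : X₁.type = d + 2) (hX₂t : X₂.type = d + 2) (hY₁t : Y₁.type = d + 2) (hY₂t : Y₂.type = d + 2)
    (hX : X₂ ∈ runOf T d X₁) (hY : Y₁ ∈ runOf T d Y₂)
    (h₁ : Y₁ ∈ runOf T (d + 1) X₁) (h₂ : Y₂ ∈ runOf T (d + 1) X₂) (hne₁ : X₁ ≠ Y₁) (hne₂ : X₂ ≠ Y₂)
    (hlt : height d X₁ < height d X₂) (hlt' : height d Y₂ < height d Y₁) :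
    (∃ a b : ℤ, low (d + 1) Y₁ = low (d + 1) X₁ - a • u (d + 1 + 1) + b • u (d + 1 + 2) ∧
      height (d + 1) X₁ < height (d + 1) Y₁ ∧ 3 ≤ b) ∨
    ∃ a b : ℤ, low (d + 1) Y₂ = low (d + 1) X₂ - a • u (d + 1 + 1) + b • u (d + 1 + 2) ∧
      height (d + 1) Y₂ < height (d + 1) X₂ ∧ b ≤ -3 := by
  obtain ⟨a, b, ha, hb, ha', -, h1⟩ := hT.exists_displacement hX₁ hX hlt
  obtain ⟨a', b', hc, hd, hc', -, h2⟩ := hT.exists_displacement hY₂ hY hlt'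
  obtain ⟨a₁, b₁, h3, h4⟩ := hT.exists_displacement' hX₁' h₁ hne₁
  obtain ⟨a₂, b₂, h5, h6⟩ := hT.exists_displacement' hX₂' h₂ hne₂
  -- Around the quadrilateral of crossings, the coefficients of `u (d + 1)` give `b₁ - b₂ = a + a' ≥
  -- 2`, and those of `u (d + 2)` force `b₁` and `b₂` to have the same sign. Neither is zero, so `b₁
  -- ≥ 3` or `b₂ ≤ -3`.
  have key : (height (d + 1) X₁ < height (d + 1) Y₁ ∧ 3 ≤ b₁) ∨
      (height (d + 1) Y₂ < height (d + 1) X₂ ∧ b₂ ≤ -3) := by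
    have hd := (fin3_ne d).2.2.2.1
    rw [low_of_type_eq hX₁t, low_of_type_eq hX₂t] at h1
    rw [low_of_type_eq hY₁t, low_of_type_eq hY₂t] at h2
    rw [low_of_type_ne (hX₁t.trans_ne hd), low_of_type_ne (hY₁t.trans_ne hd)] at h3
    rw [low_of_type_ne (hX₂t.trans_ne hd), low_of_type_ne (hY₂t.trans_ne hd)] at h5
    have ha := ha' hX₁t
    have hc := hc' hY₂t
    simp only [hX₁t, hX₂t, hY₁t, hY₂t, hd, ne_eq, not_false_eq_true, true_imp_iff,
      false_imp_iff] at h4 h6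
    rw [Prod.ext_iff] at h1 h2 h3 h5
    clear hX₁ hY₂ hX₁' hX₂' hX₁t hX₂t hY₁t hY₂t hX hY h₁ h₂ ha' hc'
    fin_cases d <;> simp [u] at h1 h2 h3 h5 h4 h6 ⊢ <;> omega
  exact key.imp (fun h => ⟨_, _, h3, h⟩) fun h => ⟨_, _, h5, h⟩

/-- Tiles at consecutive parallel segments that share no other side. -/
theorem NonOverlapping.types_of_consecutive (hT : NonOverlapping T) (hX : X ∈ T) (hY : Y ∈ T)
    (hXt : X.type ≠ d) (hYt : Y.type ≠ d) (h : low d Y = low d X + u d)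
    (hX' : ∀ d', d' ≠ d → ¬ Active T d' X) : X.type = d + 1 ∧ Y.type = d + 2 := by
  obtain ⟨e1, e2, e3, e4⟩ := fin3_add d
  have hd1 := (fin3_ne d).2.2.1
  have hd2 := (fin3_ne d).2.1
  have hd3 := (fin3_ne d).1
  rcases fin3_eq_or hXt with hx | hx <;> rcases fin3_eq_or hYt with hy | hy
  · rw [low_of_type_ne (hx.trans_ne hd1), low_of_type_ne (hy.trans_ne hd1)] at h
    refine absurd ⟨Y, (Follows.adj (X := Y) (Y := X) ⟨hY, hX, hy.trans_ne hd1, hx.trans_ne hd1, ?_⟩).symm⟩ (hX' (d + 2) hd2)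
    rw [low_of_type_eq (hx.trans e4.symm), low_of_type_eq (hy.trans e4.symm), step, if_pos (hy.trans e4.symm), h, e3]
    abel
  · exact ⟨hx, hy⟩
  · exfalso
    have hne : X ≠ Y := by rintro rfl; exact hd1 (hy.symm.trans hx)
    rw [low_of_type_eq hx, low_of_type_ne (hy.trans_ne hd1)] at h
    have hdis := hT X hX Y hY hne
    have h1 : ∀ t, t ∈ X.triangles → t ∉ Y.triangles := fun _ ht => Set.disjoint_left.mp hdis ht
    simp only [mem_triangles_iff] at h1
    have h2 := h1 (upTriangle X.diagonal)
    have h3 := h1 (downTriangle X.diagonal)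
    obtain ⟨⟨x, y⟩, i⟩ := X
    obtain ⟨⟨p, q⟩, j⟩ := Y
    simp only at hx hy
    subst hx hy
    clear h1 hdis hne hX hY hXt hYt hX' e1 e2 e3 e4 hd1 hd2 hd3
    fin_cases d <;>
      simp [Lozenge.corner, u, upTriangle, downTriangle, Lozenge.diagonal] at h h2 h3 <;> omega
  · rw [low_of_type_eq hx, low_of_type_eq hy] at h
    refine absurd ⟨Y, Follows.adj (X := X) (Y := Y) ⟨hX, hY, hx.trans_ne hd1.symm, hy.trans_ne hd1.symm, ?_⟩⟩ (hX' (d + 1) hd3)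
    have hd4 := (fin3_ne d).2.2.2.1
    rw [low_of_type_ne (hx.trans_ne hd4), low_of_type_ne (hy.trans_ne hd4), step, if_neg (hx.trans_ne hd4), e2]
    exact add_right_cancel (h.trans (add_right_comm _ _ _))

end

/-! ### Counting runs -/

open Classical in
/-- The runs of direction `d`. -/
noncomputable def runsIn (T : Finset Lozenge) (d : Fin 3) : Finset (Set Lozenge) :=
  (T.filter (Active T d)).image (runOf T d)

theorem mem_runsIn {T : Finset Lozenge} {d : Fin 3} {R : Set Lozenge} :
    R ∈ runsIn T d ↔ ∃ X, Active T d X ∧ runOf T d X = R := by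
  simp only [runsIn, Finset.mem_image, Finset.mem_filter]
  exact ⟨fun ⟨X, h, h'⟩ => ⟨X, h.2, h'⟩, fun ⟨X, h, h'⟩ => ⟨X, ⟨h.mem, h⟩, h'⟩⟩

theorem mem_runs_iff {T : Finset Lozenge} {R : Set Lozenge} :
    R ∈ runs T ↔ ∃ d, R ∈ runsIn T d := by
  simp only [mem_runsIn]
  constructor
  · rintro ⟨hR, d, c, rfl⟩
    obtain ⟨X, rfl⟩ := c.exists_rep
    obtain ⟨Y, hY, hne⟩ := hR.exists_ne X
    obtain ⟨p⟩ := (mem_runOf.mp hY).symm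
    cases p with
    | nil => exact absurd rfl hne
    | cons h p => exact ⟨d, X, ⟨_, h⟩, rfl⟩
  · rintro ⟨d, X, ⟨Y, h⟩, rfl⟩
    exact ⟨⟨X, self_mem_runOf, Y, mem_runOf.mpr h.symm.reachable, h.ne⟩, d, _, rfl⟩

section
open Classical
variable {T : Finset Lozenge} {κ : ℕ}

theorem IsDokuTiling.ncard_run (hT : IsDokuTiling κ T) {d : Fin 3} {R : Set Lozenge}
    (hR : R ∈ runsIn T d) : R.ncard = κ :=
  hT.run_length R (mem_runs_iff.mpr ⟨d, hR⟩)

theorem run_eq_filter {d : Fin 3} {R : Set Lozenge} (hR : R ∈ runsIn T d) :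
    R = ((T.filter (Active T d)).filter (runOf T d · = R) : Finset Lozenge) := by
  obtain ⟨X, hX, rfl⟩ := mem_runsIn.mp hR
  ext Y
  simp only [Finset.coe_filter, Finset.mem_filter, Set.mem_ofPred_eq]
  exact ⟨fun h => ⟨⟨(active_of_mem_runOf hX h).mem, active_of_mem_runOf hX h⟩, runOf_eq h⟩,
    fun h => mem_runOf_iff_eq.mpr h.2⟩

theorem IsDokuTiling.card_active (hT : IsDokuTiling κ T) (d : Fin 3) :
    (T.filter (Active T d)).card = (runsIn T d).card * κ := by
  rw [runsIn, Finset.card_eq_sum_card_image (runOf T d), ← smul_eq_mul, ← Finset.sum_const]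
  refine Finset.sum_congr rfl fun R hR => ?_
  rw [← hT.ncard_run hR, ← Set.ncard_coe_finset, ← run_eq_filter hR]

/-- The tiles of type `t` that are in two runs. -/
noncomputable def crossings (T : Finset Lozenge) (t : Fin 3) : Finset Lozenge :=
  T.filter fun X => X.type = t ∧ Active T (t + 1) X ∧ Active T (t + 2) X

theorem NonOverlapping.crossing_injOn (hT : NonOverlapping T) (t : Fin 3) :
    Set.InjOn (fun X => (runOf T (t + 1) X, runOf T (t + 2) X)) (crossings T t : Set Lozenge) := by
  intro X hX Y hY h
  simp only [crossings, Finset.coe_filter, Set.mem_ofPred_eq, Prod.mk.injEq] at hX hY h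
  obtain ⟨e1, e2, e3, e4⟩ := fin3_add t
  obtain ⟨e5, e6, e7, e8⟩ := fin3_add (t + 1)
  refine hT.crossing_unique (d := t + 1) hX.2.2.1 ?_ ?_ ?_ (mem_runOf_iff_eq.mpr h.1.symm) ?_
  · rw [e1]; exact hX.2.2.2
  · rw [e2]; exact hX.2.1
  · rw [e2]; exact hY.2.1
  · rw [e1]; exact mem_runOf_iff_eq.mpr h.2.symm

theorem crossing_mapsTo (T : Finset Lozenge) (t : Fin 3) :
    Set.MapsTo (fun X => (runOf T (t + 1) X, runOf T (t + 2) X)) (crossings T t : Set Lozenge)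
      (runsIn T (t + 1) ×ˢ runsIn T (t + 2) : Finset _) := by
  intro X hX
  simp only [crossings, Finset.coe_filter, Set.mem_ofPred_eq] at hX
  simp only [Finset.coe_product, Set.mem_prod, Finset.mem_coe, mem_runsIn]
  exact ⟨⟨X, hX.2.2.1, rfl⟩, ⟨X, hX.2.2.2, rfl⟩⟩

theorem NonOverlapping.card_crossings_le (hT : NonOverlapping T) (t : Fin 3) :
    (crossings T t).card ≤ (runsIn T (t + 1)).card * (runsIn T (t + 2)).card := by
  rw [← Finset.card_product]
  exact Finset.card_le_card_of_injOn _ (crossing_mapsTo T t) (hT.crossing_injOn t)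

/-- In the case of equality the injection of crossings into pairs of runs is onto. -/
theorem NonOverlapping.exists_crossing (hT : NonOverlapping T) {t : Fin 3}
    (h : (runsIn T (t + 1)).card * (runsIn T (t + 2)).card ≤ (crossings T t).card)
    {R R' : Set Lozenge} (hR : R ∈ runsIn T (t + 1)) (hR' : R' ∈ runsIn T (t + 2)) :
    ∃ X ∈ T, X.type = t ∧ Active T (t + 1) X ∧ Active T (t + 2) X ∧ runOf T (t + 1) X = R ∧
      runOf T (t + 2) X = R' := by
  have hs := Finset.surjOn_of_injOn_of_card_le _ (crossing_mapsTo T t) (hT.crossing_injOn t)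
    (by rwa [Finset.card_product])
  obtain ⟨X, hX, he⟩ := hs (show (R, R') ∈ _ from Finset.mem_coe.mpr (Finset.mem_product.mpr ⟨hR, hR'⟩))
  simp only [crossings, Finset.coe_filter, Set.mem_ofPred_eq, Prod.mk.injEq] at hX he
  exact ⟨X, hX.1, hX.2.1, hX.2.2.1, hX.2.2.2, he.1, he.2⟩

/-- A run is just a set of tiles, so it has to be excluded that one set is a run of two directions
and is counted only once. Such a set would have two tiles lying in two common runs. -/
theorem NonOverlapping.runsIn_disjoint (hT : NonOverlapping T) (d : Fin 3) :
    Disjoint (runsIn T d) (runsIn T (d + 1)) := by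
  rw [Finset.disjoint_left]
  intro R hR hR'
  obtain ⟨X, ⟨Y, hXY⟩, rfl⟩ := mem_runsIn.mp hR
  obtain ⟨Z, hZ, hZR⟩ := mem_runsIn.mp hR'
  have hX : Active T d X := ⟨Y, hXY⟩
  have hY : Y ∈ runOf T d X := mem_runOf.mpr hXY.symm.reachable
  have hXZ : X ∈ runOf T (d + 1) Z := hZR ▸ self_mem_runOf
  have hYZ : Y ∈ runOf T (d + 1) Z := hZR ▸ hY
  refine hXY.ne (hT.crossing_unique hX (active_of_mem_runOf hZ hXZ) ?_ ?_ hY ?_)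
  · exact fin3_eq (hX.type_ne hT) ((active_of_mem_runOf hZ hXZ).type_ne hT)
  · exact fin3_eq ((active_of_mem_runOf hX hY).type_ne hT) ((active_of_mem_runOf hZ hYZ).type_ne hT)
  · rwa [runOf_eq hXZ]

theorem NonOverlapping.ncard_runs (hT : NonOverlapping T) :
    (runs T).ncard = (runsIn T 0).card + (runsIn T 1).card + (runsIn T 2).card := by
  have h01 := hT.runsIn_disjoint 0
  have h12 := hT.runsIn_disjoint 1
  have h20 := hT.runsIn_disjoint 2
  have : runs T = ((runsIn T 0 ∪ runsIn T 1) ∪ runsIn T 2 : Finset _) := by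
    ext R
    simp [mem_runs_iff, Fin.exists_fin_succ]
  rw [this, Set.ncard_coe_finset, Finset.card_union_of_disjoint, Finset.card_union_of_disjoint (by simpa using h01)]
  exact Finset.disjoint_union_left.mpr ⟨h20.symm, h12⟩

theorem IsDokuTiling.exists_active (hT : IsDokuTiling κ T) (h2 : 2 ≤ T.card) {X : Lozenge}
    (hX : X ∈ T) : ∃ d, Active T d X := by
  have : Nontrivial T := Set.nontrivial_coe_sort.mpr (Finset.one_lt_card_iff_nontrivial.mp h2)
  obtain ⟨Y, hY⟩ := hT.connected.preconnected.exists_adj_of_nontrivial ⟨X, hX⟩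
  obtain ⟨⟨q, d⟩, hq⟩ := hY.2
  rw [Finset.mem_inter] at hq
  exact ⟨d, Y, hX, Y.2, fun h => hY.1 (Subtype.ext h), q, hq.1, hq.2⟩

/-- Double counting of the pairs of a tile and a run containing it: crossings are counted twice, all
other tiles once. -/
theorem IsDokuTiling.card_crossings (hT : IsDokuTiling κ T) (h2 : 2 ≤ T.card) :
    T.card + ((crossings T 0).card + (crossings T 1).card + (crossings T 2).card) =
      (runs T).ncard * κ := by
  have hN : NonOverlapping T := hT.nonoverlapping
  have hact : ∀ d : Fin 3, (T.filter (Active T d)).card =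
      (T.filter fun X => X.type = d + 1 ∧ Active T d X).card +
      (T.filter fun X => X.type = d + 2 ∧ Active T d X).card := by
    intro d
    rw [← Finset.card_union_of_disjoint]
    · congr 1
      ext X
      simp only [Finset.mem_filter, Finset.mem_union]
      constructor
      · rintro ⟨h, h'⟩
        rcases fin3_eq_or (h'.type_ne hN) with h3 | h3
        exacts [.inl ⟨h, h3, h'⟩, .inr ⟨h, h3, h'⟩]
      · tauto
    · rw [Finset.disjoint_filter]
      rintro X - ⟨h, -⟩ ⟨h', -⟩
      exact (fin3_ne d).2.2.1 (h.symm.trans h')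
  have htype : ∀ t : Fin 3, (T.filter fun X => X.type = t).card + (crossings T t).card =
      (T.filter fun X => X.type = t ∧ Active T (t + 1) X).card +
      (T.filter fun X => X.type = t ∧ Active T (t + 2) X).card := by
    intro t
    refine Eq.trans ?_ (Finset.card_union_add_card_inter _ _)
    congr 2
    · ext X
      simp only [Finset.mem_filter, Finset.mem_union]
      constructor
      · rintro ⟨h, rfl⟩
        obtain ⟨d, hd⟩ := hT.exists_active h2 h
        rcases fin3_eq_or' (hd.type_ne hN) with e | e <;> rw [e] at hd
        exacts [.inl ⟨h, rfl, hd⟩, .inr ⟨h, rfl, hd⟩]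
      · tauto
    · ext X
      simp only [crossings, Finset.mem_filter, Finset.mem_inter]
      tauto
  have hsum : T.card = (T.filter fun X => X.type = 0).card + (T.filter fun X => X.type = 1).card +
      (T.filter fun X => X.type = 2).card := by
    rw [Finset.card_eq_sum_card_fiberwise (f := Lozenge.type) (t := Finset.univ) (by simp),
      Fin.sum_univ_three]
  have a0 := hact 0
  have a1 := hact 1
  have a2 := hact 2
  have b0 := htype 0
  have b1 := htype 1
  have b2 := htype 2
  rw [hN.ncard_runs, add_mul, add_mul, ← hT.card_active, ← hT.card_active, ← hT.card_active]
  simp only [Fin.isValue, zero_add, Fin.reduceAdd] at a0 a1 a2 b0 b1 b2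
  omega

end

/-! ### There is no 6-doku tiling with 26 tiles and 7 runs -/

theorem exists_sorted_triple {α : Type*} [DecidableEq α] {S : Finset α} (hS : S.card = 3) {f : α → ℤ}
    (hf : Set.InjOn f S) : ∃ p q r, S = {p, q, r} ∧ f p < f q ∧ f q < f r := by
  obtain ⟨a, b, c, hab, hac, hbc, rfl⟩ := Finset.card_eq_three.mp hS
  have h1 : f a ≠ f b := fun h => hab (hf (by simp) (by simp) h)
  have h2 : f a ≠ f c := fun h => hac (hf (by simp) (by simp) h)
  have h3 : f b ≠ f c := fun h => hbc (hf (by simp) (by simp) h)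
  rcases lt_or_gt_of_ne h1 with h1 | h1 <;> rcases lt_or_gt_of_ne h2 with h2 | h2 <;>
    rcases lt_or_gt_of_ne h3 with h3 | h3
  · exact ⟨a, b, c, rfl, h1, h3⟩
  · exact ⟨a, c, b, by ext; simp; tauto, h2, h3⟩
  · omega
  · exact ⟨c, a, b, by ext; simp; tauto, h2, h1⟩
  · exact ⟨b, a, c, by ext; simp; tauto, h1, h2⟩
  · omega
  · exact ⟨b, c, a, by ext; simp; tauto, h3, h2⟩
  · exact ⟨c, b, a, by ext; simp; tauto, h3, h1⟩

section
open Classical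
variable {T : Finset Lozenge} {κ : ℕ} {d : Fin 3}

/-- The tile is in two runs. -/
def IsCrossing (T : Finset Lozenge) (X : Lozenge) : Prop := ∀ d, d ≠ X.type → Active T d X

/-- A tile in only one run is first or last. Here it cannot be last, as `W` is higher, and if it is
first it equals `X`. So the tiles on such a stretch can be counted by the runs they belong to. -/
theorem IsDokuTiling.isCrossing_of_mem_segment (hT : IsDokuTiling κ T) {X Y W : Lozenge}
    (hX : IsCrossing T X) (hXa : Active T d X) (hW : W ∈ runOf T d X)
    (hY : Y ∈ segment T d X (height d X) (height d W)) : IsCrossing T Y := by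
  have hN : NonOverlapping T := hT.nonoverlapping
  simp only [segment, Finset.mem_filter] at hY
  obtain ⟨-, hYX, h1, h2⟩ := hY
  have hYa := active_of_mem_runOf hXa hYX
  intro d' hd'
  by_contra hact
  have hdd : d ≠ d' := by rintro rfl; exact hact hYa
  rcases hT.extremal hYa hdd hd'.symm hact with h | h
  · have h3 := h X (runOf_eq hYX ▸ self_mem_runOf)
    have : Y = X := hN.height_injOn hXa hYX self_mem_runOf (le_antisymm h3 h1)
    exact hact (this ▸ hX d' (this ▸ hd'))
  · have h3 := h W (runOf_eq hYX ▸ hW)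
    omega

/-- A system of crossing tiles: `cr d R R'` is the tile in the runs `R`, `R'` of directions `d` and
`d + 1`. -/
structure IsCrossingSystem (T : Finset Lozenge) (cr : Fin 3 → Set Lozenge → Set Lozenge → Lozenge) :
    Prop where
  type_eq : ∀ d, ∀ R ∈ runsIn T d, ∀ R' ∈ runsIn T (d + 1), (cr d R R').type = d + 2
  active : ∀ d, ∀ R ∈ runsIn T d, ∀ R' ∈ runsIn T (d + 1), Active T d (cr d R R')
  active' : ∀ d, ∀ R ∈ runsIn T d, ∀ R' ∈ runsIn T (d + 1), Active T (d + 1) (cr d R R')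
  runOf_eq : ∀ d, ∀ R ∈ runsIn T d, ∀ R' ∈ runsIn T (d + 1), runOf T d (cr d R R') = R
  runOf_eq' : ∀ d, ∀ R ∈ runsIn T d, ∀ R' ∈ runsIn T (d + 1), runOf T (d + 1) (cr d R R') = R'

variable {cr : Fin 3 → Set Lozenge → Set Lozenge → Lozenge}

theorem IsCrossingSystem.isCrossing (hcr : IsCrossingSystem T cr) {R R' : Set Lozenge}
    (hR : R ∈ runsIn T d) (hR' : R' ∈ runsIn T (d + 1)) : IsCrossing T (cr d R R') := by
  intro d' hd'
  rw [hcr.type_eq d R hR R' hR'] at hd'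
  by_cases h : d' = d
  · exact h ▸ hcr.active d R hR R' hR'
  · by_cases h' : d' = d + 1
    · exact h' ▸ hcr.active' d R hR R' hR'
    · exact absurd (fin3_eq h h') hd'

theorem IsCrossingSystem.eq_cr (hcr : IsCrossingSystem T cr) (hN : NonOverlapping T) {X : Lozenge}
    (hX : Active T d X) (hX' : Active T (d + 1) X) : X = cr d (runOf T d X) (runOf T (d + 1) X) := by
  have hR : runOf T d X ∈ runsIn T d := mem_runsIn.mpr ⟨X, hX, rfl⟩
  have hR' : runOf T (d + 1) X ∈ runsIn T (d + 1) := mem_runsIn.mpr ⟨X, hX', rfl⟩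
  exact hN.crossing_unique hX hX' (fin3_eq (hX.type_ne hN) (hX'.type_ne hN))
    (hcr.type_eq d _ hR _ hR') (mem_runOf_iff_eq.mpr (hcr.runOf_eq d _ hR _ hR'))
    (mem_runOf_iff_eq.mpr (hcr.runOf_eq' d _ hR _ hR'))

/-- The crossings on a stretch of a run with the runs of the next direction. -/
theorem IsDokuTiling.card_segment (hT : IsDokuTiling κ T) (hcr : IsCrossingSystem T cr) {X W : Lozenge}
    (hX : IsCrossing T X) (hXa : Active T d X) (hW : W ∈ runOf T d X) :
    ((segment T d X (height d X) (height d W)).filter (·.type = d + 2)).card =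
      ((runsIn T (d + 1)).filter fun a => height d X ≤ height d (cr d (runOf T d X) a) ∧
        height d (cr d (runOf T d X) a) < height d W).card := by
  have hN : NonOverlapping T := hT.nonoverlapping
  have hR : runOf T d X ∈ runsIn T d := mem_runsIn.mpr ⟨X, hXa, rfl⟩
  have hmem : ∀ a ∈ runsIn T (d + 1), cr d (runOf T d X) a ∈ runOf T d X := fun a ha =>
    mem_runOf_iff_eq.mpr (hcr.runOf_eq d _ hR a ha)
  symm
  refine Finset.card_bij (fun a _ => cr d (runOf T d X) a) ?_ ?_ ?_
  · intro a ha
    rw [Finset.mem_filter] at ha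
    simp only [segment, Finset.mem_filter]
    exact ⟨⟨(hcr.active d _ hR a ha.1).mem, hmem a ha.1, ha.2⟩, hcr.type_eq d _ hR a ha.1⟩
  · intro a ha b hb h
    rw [Finset.mem_filter] at ha hb
    rw [← hcr.runOf_eq' d _ hR a ha.1, h, hcr.runOf_eq' d _ hR b hb.1]
  · intro Y hY
    rw [Finset.mem_filter] at hY
    obtain ⟨hY, hYt⟩ := hY
    have hYc := hT.isCrossing_of_mem_segment hX hXa hW hY
    simp only [segment, Finset.mem_filter] at hY
    have hYa := active_of_mem_runOf hXa hY.2.1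
    have hYa' := hYc (d + 1) (hYt ▸ (fin3_ne d).2.2.1)
    have he := hcr.eq_cr hN hYa hYa'
    rw [runOf_eq hY.2.1] at he
    refine ⟨runOf T (d + 1) Y, Finset.mem_filter.mpr ⟨mem_runsIn.mpr ⟨Y, hYa', rfl⟩, ?_⟩, he.symm⟩
    rw [← he]
    exact hY.2.2

/-- The crossings on a stretch of a run with the runs of the previous direction. -/
theorem IsDokuTiling.card_segment' (hT : IsDokuTiling κ T) (hcr : IsCrossingSystem T cr)
    {d e : Fin 3} (hd : d = e + 1) {X W : Lozenge}
    (hX : IsCrossing T X) (hXa : Active T d X) (hW : W ∈ runOf T d X) :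
    ((segment T d X (height d X) (height d W)).filter (·.type ≠ d + 2)).card =
      ((runsIn T e).filter fun a => height d X ≤ height d (cr e a (runOf T d X)) ∧
        height d (cr e a (runOf T d X)) < height d W).card := by
  subst hd
  have hN : NonOverlapping T := hT.nonoverlapping
  have hR : runOf T (e + 1) X ∈ runsIn T (e + 1) := mem_runsIn.mpr ⟨X, hXa, rfl⟩
  have hmem : ∀ a ∈ runsIn T e, cr e a (runOf T (e + 1) X) ∈ runOf T (e + 1) X := fun a ha =>
    mem_runOf_iff_eq.mpr (hcr.runOf_eq' e a ha _ hR)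
  symm
  refine Finset.card_bij (fun a _ => cr e a (runOf T (e + 1) X)) ?_ ?_ ?_
  · intro a ha
    rw [Finset.mem_filter] at ha
    simp only [segment, Finset.mem_filter]
    exact ⟨⟨(hcr.active e a ha.1 _ hR).mem, hmem a ha.1, ha.2⟩,
      (hcr.type_eq e a ha.1 _ hR).trans_ne (fin3_ne e).2.2.2.1⟩
  · intro a ha b hb h
    rw [Finset.mem_filter] at ha hb
    rw [← hcr.runOf_eq e a ha.1 _ hR, h, hcr.runOf_eq e b hb.1 _ hR]
  · intro Y hY
    rw [Finset.mem_filter] at hY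
    obtain ⟨hY, hYt⟩ := hY
    have hYc := hT.isCrossing_of_mem_segment hX hXa hW hY
    simp only [segment, Finset.mem_filter] at hY
    have hYa := active_of_mem_runOf hXa hY.2.1
    have hYa' := hYc e (by rw [(fin3_add e).2.1] at hYt; exact hYt.symm)
    have he := hcr.eq_cr hN hYa' hYa
    rw [runOf_eq hY.2.1] at he
    refine ⟨runOf T e Y, Finset.mem_filter.mpr ⟨mem_runsIn.mpr ⟨Y, hYa', rfl⟩, ?_⟩, he.symm⟩
    rw [← he]
    exact hY.2.2

/-- All runs of one direction cross two runs of the next direction in the same order, if there are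
at most three of them. -/
theorem IsDokuTiling.order_preserved (hT : IsDokuTiling κ T) (hcr : IsCrossingSystem T cr)
    (h3 : (runsIn T d).card ≤ 3) {c c' a a' : Set Lozenge} (hc : c ∈ runsIn T d) (hc' : c' ∈ runsIn T d)
    (ha : a ∈ runsIn T (d + 1)) (ha' : a' ∈ runsIn T (d + 1))
    (h : height d (cr d c a) < height d (cr d c a')) :
    height d (cr d c' a) < height d (cr d c' a') := by
  have hN : NonOverlapping T := hT.nonoverlapping
  by_contra hcon
  have hne : ∀ a₁ ∈ runsIn T (d + 1), ∀ c₁ ∈ runsIn T d, ∀ c₂ ∈ runsIn T d, c₁ ≠ c₂ →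
      cr d c₁ a₁ ≠ cr d c₂ a₁ := by
    intro a₁ h₁ c₁ h₂ c₂ h₃ hne h
    exact hne (by rw [← hcr.runOf_eq d c₁ h₂ a₁ h₁, h, hcr.runOf_eq d c₂ h₃ a₁ h₁])
  have haa : a ≠ a' := by rintro rfl; omega
  have hcc : c ≠ c' := by rintro rfl; omega
  have hX : ∀ {c}, c ∈ runsIn T d → ∀ {a a'}, a ∈ runsIn T (d + 1) → a' ∈ runsIn T (d + 1) →
      cr d c a ∈ runOf T d (cr d c a') := fun hc _ _ ha ha' => mem_runOf_iff_eq.mpr (by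
    rw [hcr.runOf_eq d _ hc _ ha, hcr.runOf_eq d _ hc _ ha'])
  have hX' : ∀ {c c'}, c ∈ runsIn T d → c' ∈ runsIn T d → ∀ {a}, a ∈ runsIn T (d + 1) →
      cr d c a ∈ runOf T (d + 1) (cr d c' a) := fun hc hc' _ ha => mem_runOf_iff_eq.mpr (by
    rw [hcr.runOf_eq' d _ hc _ ha, hcr.runOf_eq' d _ hc' _ ha])
  have hlt : height d (cr d c' a') < height d (cr d c' a) := by
    have hne' : cr d c' a ≠ cr d c' a' := by
      intro h
      exact haa (by rw [← hcr.runOf_eq' d c' hc' a ha, h, hcr.runOf_eq' d c' hc' a' ha'])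
    have := hN.lt_or_lt (hcr.active d _ hc' _ ha) (hX hc' ha' ha) hne'
    omega
  -- two crossings of a run of direction `d + 1` are less than three crossings apart
  have hclose : ∀ a₁ ∈ runsIn T (d + 1), ∀ c₁ ∈ runsIn T d, ∀ c₂ ∈ runsIn T d,
      height (d + 1) (cr d c₁ a₁) < height (d + 1) (cr d c₂ a₁) → ∀ x y : ℤ,
      low (d + 1) (cr d c₂ a₁) = low (d + 1) (cr d c₁ a₁) - x • u (d + 1 + 1) + y • u (d + 1 + 2) →
      y ≤ 2 := by
    intro a₁ h₁ c₁ h₂ c₂ h₃ hlt x y hxy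
    have hact := hcr.active' d c₁ h₂ a₁ h₁
    have hlow := hN.low_eq hact (hX' h₃ h₂ h₁) hlt.le
    rw [hT.card_segment' hcr rfl (hcr.isCrossing h₂ h₁) hact (hX' h₃ h₂ h₁),
      hcr.runOf_eq' d c₁ h₂ a₁ h₁] at hlow
    -- The run `c₂` is not counted, since its crossing is the excluded upper end of the stretch; so
    -- at most two of the three runs remain.
    have hcard : ((runsIn T d).filter fun a => height (d + 1) (cr d c₁ a₁) ≤ height (d + 1) (cr d a a₁) ∧
        height (d + 1) (cr d a a₁) < height (d + 1) (cr d c₂ a₁)).card ≤ 2 := by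
      have : ((runsIn T d).filter fun a => height (d + 1) (cr d c₁ a₁) ≤ height (d + 1) (cr d a a₁) ∧
        height (d + 1) (cr d a a₁) < height (d + 1) (cr d c₂ a₁)) ⊆ (runsIn T d).erase c₂ := by
        intro x hx
        rw [Finset.mem_filter] at hx
        refine Finset.mem_erase.mpr ⟨?_, hx.1⟩
        rintro rfl
        omega
      have h4 := Finset.card_le_card this
      rw [Finset.card_erase_of_mem h₃] at h4
      omega
    rw [hxy] at hlow
    rw [Prod.ext_iff] at hlow
    fin_cases d <;> simp [u] at hlow hcard <;> omega
  rcases hN.parallel_order (X₁ := cr d c a) (X₂ := cr d c a') (Y₁ := cr d c' a) (Y₂ := cr d c' a')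
    (hcr.active d _ hc _ ha) (hcr.active d _ hc' _ ha') (hcr.active' d _ hc _ ha)
    (hcr.active' d _ hc _ ha') (hcr.type_eq d _ hc _ ha) (hcr.type_eq d _ hc _ ha')
    (hcr.type_eq d _ hc' _ ha) (hcr.type_eq d _ hc' _ ha') (hX hc ha' ha) (hX hc' ha ha')
    (hX' hc' hc ha) (hX' hc' hc ha') (hne a ha c hc c' hc' hcc) (hne a' ha' c hc c' hc' hcc) h hlt with
    ⟨x, y, h1, h2, h3⟩ | ⟨x, y, h1, h2, h3⟩
  · have := hclose a ha c hc c' hc' h2 x y h1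
    omega
  · have := hclose a' ha' c' hc' c hc h2 (-x) (-y) (by rw [h1, neg_smul, neg_smul]; abel)
    omega

/-- In a run with at least two tiles that are in no other run, one of these is the last tile. -/
theorem IsDokuTiling.exists_last (hT : IsDokuTiling κ T) {R : Set Lozenge} (hR : R ∈ runsIn T d)
    (hκ : (runsIn T (d + 1)).card + (runsIn T (d + 2)).card + 2 ≤ κ) :
    ∃ W ∈ R, ¬ IsCrossing T W ∧ ∀ Y ∈ R, height d Y ≤ height d W := by
  have hN : NonOverlapping T := hT.nonoverlapping
  obtain ⟨X, hX, rfl⟩ := mem_runsIn.mp hR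
  obtain ⟨e1, e2, e3, e4⟩ := fin3_add d
  have hRF := run_eq_filter hR
  set F := (T.filter (Active T d)).filter (runOf T d · = runOf T d X) with hF
  have hFR : ∀ Y, Y ∈ F ↔ Y ∈ runOf T d X := fun Y => by
    rw [← Finset.mem_coe, ← hRF]
  have hcard : F.card = κ := by
    rw [← hT.ncard_run hR, hRF, Set.ncard_coe_finset]
  have h1 : ((F.filter (IsCrossing T)).filter (·.type = d + 2)).card ≤ (runsIn T (d + 1)).card := by
    refine Finset.card_le_card_of_injOn (runOf T (d + 1)) ?_ ?_
    · intro Y hY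
      simp only [Finset.coe_filter, Finset.mem_filter, Set.mem_ofPred_eq] at hY
      exact mem_runsIn.mpr ⟨Y, hY.1.2 _ (hY.2 ▸ (fin3_ne d).2.2.1), rfl⟩
    · intro Y hY Z hZ h
      simp only [Finset.coe_filter, Finset.mem_filter, Set.mem_ofPred_eq, hFR] at hY hZ
      have hYd := active_of_mem_runOf hX hY.1.1
      refine hN.crossing_unique hYd (hY.1.2 _ (hY.2 ▸ (fin3_ne d).2.2.1)) hY.2 hZ.2 ?_
        (mem_runOf_iff_eq.mpr h.symm)
      rw [runOf_eq hY.1.1]; exact hZ.1.1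
  have h2 : ((F.filter (IsCrossing T)).filter (¬ ·.type = d + 2)).card ≤ (runsIn T (d + 2)).card := by
    have ht : ∀ Y ∈ F, ¬ Y.type = d + 2 → Y.type = d + 1 := by
      intro Y hY h
      exact (fin3_eq_or ((active_of_mem_runOf hX ((hFR Y).mp hY)).type_ne hN)).resolve_right h
    have hact : ∀ Y ∈ F, IsCrossing T Y → Y.type = d + 1 → Active T (d + 2) Y := by
      intro Y hY h h'
      exact h _ (h' ▸ (fin3_ne d).2.2.1.symm)
    refine Finset.card_le_card_of_injOn (runOf T (d + 2)) ?_ ?_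
    · intro Y hY
      simp only [Finset.coe_filter, Finset.mem_filter, Set.mem_ofPred_eq] at hY
      exact mem_runsIn.mpr ⟨Y, hact Y hY.1.1 hY.1.2 (ht Y hY.1.1 hY.2), rfl⟩
    · intro Y hY Z hZ h
      simp only [Finset.coe_filter, Finset.mem_filter, Set.mem_ofPred_eq] at hY hZ
      have hYt := ht Y hY.1.1 hY.2
      have hZt := ht Z hZ.1.1 hZ.2
      have hYR := (hFR Y).mp hY.1.1
      have hYd := active_of_mem_runOf hX hYR
      refine hN.crossing_unique (d := d + 2) (hact Y hY.1.1 hY.1.2 hYt) (e3.symm ▸ hYd)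
        (hYt.trans e4.symm) (hZt.trans e4.symm) (mem_runOf_iff_eq.mpr h.symm) ?_
      rw [e3, runOf_eq hYR]
      exact (hFR Z).mp hZ.1.1
  have h3 := Finset.card_filter_add_card_filter_not (s := F) (IsCrossing T)
  have h4 := Finset.card_filter_add_card_filter_not (s := F.filter (IsCrossing T)) (·.type = d + 2)
  -- Two tiles that are no crossings cannot both be the first tile of the run, so one of them is the
  -- last.
  have h5 : 1 < (F.filter (¬ IsCrossing T ·)).card := by omega
  obtain ⟨Y, hY, Z, hZ, hne⟩ := Finset.one_lt_card.mp h5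
  rw [Finset.mem_filter, hFR] at hY hZ
  have key : ∀ Y, Y ∈ runOf T d X → ¬ IsCrossing T Y → (∀ Z ∈ runOf T d X, height d Y ≤ height d Z) ∨
      ∀ Z ∈ runOf T d X, height d Z ≤ height d Y := by
    intro Y hY h
    unfold IsCrossing at h
    push Not at h
    obtain ⟨d', h, h'⟩ := h
    have hYa := active_of_mem_runOf hX hY
    have := hT.extremal hYa (by rintro rfl; exact h' hYa) h.symm h'
    rwa [runOf_eq hY] at this
  rcases key Y hY.1 hY.2 with hy | hy
  · rcases key Z hZ.1 hZ.2 with hz | hz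
    · exact absurd (hN.height_injOn hX hY.1 hZ.1 (le_antisymm (hy Z hZ.1) (hz Y hY.1))) hne
    · exact ⟨Z, hZ.1, hZ.2, hz⟩
  · exact ⟨Y, hY.1, hY.2, hy⟩

/-- The last tile of `c` is reached from the crossing with `a` by passing the runs of direction `d +
1` from `a` on and those of direction `d + 2` that come later. The first number is the same for `c`
and `c'`, as the orders agree; the change of the second is compensated by the way from `c` to `c'`
along `a`. What remains is the one step `u d` for crossing `c`. -/
theorem IsDokuTiling.last_consecutive (hT : IsDokuTiling κ T) (hcr : IsCrossingSystem T cr)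
    (h3 : (runsIn T d).card ≤ 3) {a c c' : Set Lozenge} (ha : a ∈ runsIn T (d + 1))
    (hc : c ∈ runsIn T d) (hc' : c' ∈ runsIn T d) {W W' : Lozenge} (hW : W ∈ c) (hW' : W' ∈ c')
    (hWc : ¬ IsCrossing T W) (hWc' : ¬ IsCrossing T W')
    (hmax : ∀ Y ∈ c, height d Y ≤ height d W) (hmax' : ∀ Y ∈ c', height d Y ≤ height d W')
    (hlt : height (d + 1) (cr d c a) < height (d + 1) (cr d c' a))
    (hbetween : ∀ x ∈ runsIn T d, height (d + 1) (cr d c a) ≤ height (d + 1) (cr d x a) →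
      height (d + 1) (cr d x a) < height (d + 1) (cr d c' a) → x = c) :
    low d W' = low d W + u d := by
  have hN : NonOverlapping T := hT.nonoverlapping
  obtain ⟨e1, e2, e3, e4⟩ := fin3_add d
  have hd' : d = d + 2 + 1 := e3.symm
  -- the part of the run after the crossing with `a`
  have hlast : ∀ c ∈ runsIn T d, ∀ W ∈ c, ¬ IsCrossing T W → (∀ Y ∈ c, height d Y ≤ height d W) →
      low d W = (cr d c a).corner + u (d + 1)
        - (((runsIn T (d + 1)).filter fun x => height d (cr d c a) ≤ height d (cr d c x)).card : ℤ) • u (d + 1)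
        + (((runsIn T (d + 2)).filter fun b =>
          height (d + 1) (cr (d + 1) a b) < height (d + 1) (cr d c a)).card : ℤ) • u (d + 2) := by
    intro c hc W hW hWc hmax
    have hact := hcr.active d c hc a ha
    have hrun := hcr.runOf_eq d c hc a ha
    have hWr : W ∈ runOf T d (cr d c a) := by rw [hrun]; exact hW
    have hself : cr d c a ∈ c := by
      have h := self_mem_runOf (T := T) (d := d) (X := cr d c a)
      rwa [hrun] at h
    have hlow := hN.low_eq hact hWr (hmax _ hself)
    rw [hT.card_segment hcr (hcr.isCrossing hc ha) hact hWr,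
      hT.card_segment' hcr hd' (hcr.isCrossing hc ha) hact hWr, hrun,
      low_of_type_eq (hcr.type_eq d c hc a ha)] at hlow
    have hltW : ∀ Y ∈ c, IsCrossing T Y → height d Y < height d W := by
      intro Y hY hYc
      refine lt_of_le_of_ne (hmax Y hY) fun h => hWc ?_
      rw [← hN.height_injOn hact (hrun.symm ▸ hY) hWr h]
      exact hYc
    have hα : ((runsIn T (d + 1)).filter fun x => height d (cr d c a) ≤ height d (cr d c x) ∧
        height d (cr d c x) < height d W) =
        (runsIn T (d + 1)).filter fun x => height d (cr d c a) ≤ height d (cr d c x) := by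
      refine Finset.filter_congr fun x hx => ?_
      refine and_iff_left (hltW _ ?_ (hcr.isCrossing hc hx))
      have h := self_mem_runOf (T := T) (d := d) (X := cr d c x)
      rwa [hcr.runOf_eq d c hc x hx] at h
    -- By `triangle_order`, `b` comes after `a` on the run `c` exactly when `b` comes before `c` on
    -- the run `a`. The count is thus expressed on the run `a`, which is common to `c` and `c'`.
    have hβ : ((runsIn T (d + 2)).filter fun b => height d (cr d c a) ≤ height d (cr (d + 2) b c) ∧
        height d (cr (d + 2) b c) < height d W) =
        (runsIn T (d + 2)).filter fun b =>
          height (d + 1) (cr (d + 1) a b) < height (d + 1) (cr d c a) := by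
      refine Finset.filter_congr fun b hb => ?_
      have hc₃ : c ∈ runsIn T (d + 2 + 1) := e3.symm ▸ hc
      have hb₃ : b ∈ runsIn T (d + 1 + 1) := e1.symm ▸ hb
      have hY := hcr.runOf_eq' (d + 2) b hb c hc₃
      have hYt := hcr.type_eq (d + 2) b hb c hc₃
      have hZ := hcr.runOf_eq' (d + 1) a ha b hb₃
      have hZt := hcr.type_eq (d + 1) a ha b hb₃
      rw [e3] at hY
      rw [e4] at hYt
      rw [e1] at hZ
      rw [e2] at hZt
      have hYc : cr (d + 2) b c ∈ c := by
        have h := self_mem_runOf (T := T) (d := d) (X := cr (d + 2) b c)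
        rwa [hY] at h
      rw [and_iff_left (hltW _ hYc (hcr.isCrossing hb hc₃)),
        ← hN.triangle_order hact (hcr.active (d + 2) b hb c hc₃) (hcr.active (d + 1) a ha b hb₃)
          (hcr.type_eq d c hc a ha) hYt hZt (by rwa [hrun])
          (mem_runOf_iff_eq.mpr (by rw [hZ, hcr.runOf_eq (d + 2) b hb c hc₃]))
          (mem_runOf_iff_eq.mpr (by rw [hcr.runOf_eq' d c hc a ha, hcr.runOf_eq (d + 1) a ha b hb₃]))]
      refine ⟨fun h => lt_of_le_of_ne h fun h' => ?_, le_of_lt⟩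
      have := hN.height_injOn hact self_mem_runOf (hrun.symm ▸ hYc) h'
      exact (fin3_ne d).2.2.1 (hYt.symm.trans (this ▸ hcr.type_eq d c hc a ha))
    rw [hlow, hα, hβ]
  have hα : ((runsIn T (d + 1)).filter fun x => height d (cr d c a) ≤ height d (cr d c x)) =
      (runsIn T (d + 1)).filter fun x => height d (cr d c' a) ≤ height d (cr d c' x) := by
    refine Finset.filter_congr fun x hx => ?_
    rw [← not_lt, ← not_lt]
    exact not_congr ⟨hT.order_preserved hcr h3 hc hc' hx ha, hT.order_preserved hcr h3 hc' hc hx ha⟩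
  have hact := hcr.active' d c hc a ha
  have hrun := hcr.runOf_eq' d c hc a ha
  have hrun' := hcr.runOf_eq' d c' hc' a ha
  have hmem : cr d c' a ∈ runOf T (d + 1) (cr d c a) := mem_runOf_iff_eq.mpr (hrun'.trans hrun.symm)
  have hstep := hN.low_eq hact hmem hlt.le
  rw [hT.card_segment hcr (hcr.isCrossing hc ha) hact hmem,
    hT.card_segment' hcr rfl (hcr.isCrossing hc ha) hact hmem, hrun,
    low_of_type_ne ((hcr.type_eq d c hc a ha).trans_ne (fin3_ne d).2.2.2.1),
    low_of_type_ne ((hcr.type_eq d c' hc' a ha).trans_ne (fin3_ne d).2.2.2.1), e1, e2] at hstep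
  have hone : ((runsIn T d).filter fun x => height (d + 1) (cr d c a) ≤ height (d + 1) (cr d x a) ∧
      height (d + 1) (cr d x a) < height (d + 1) (cr d c' a)) = {c} := by
    ext x
    rw [Finset.mem_filter, Finset.mem_singleton]
    exact ⟨fun h => hbetween x h.1 h.2.1 h.2.2, by rintro rfl; exact ⟨hc, le_rfl, hlt⟩⟩
  rw [hone, Finset.card_singleton] at hstep
  -- The runs of direction `d + 2` met by `a` before `c'` are those met before `c` and those met
  -- between `c` and `c'`. The latter are also the coefficient of `-u (d + 2)` in `hstep`, so they
  -- cancel.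
  have hβ : ((runsIn T (d + 2)).filter fun b =>
        height (d + 1) (cr (d + 1) a b) < height (d + 1) (cr d c' a)).card =
      ((runsIn T (d + 2)).filter fun b =>
        height (d + 1) (cr (d + 1) a b) < height (d + 1) (cr d c a)).card +
      ((runsIn T (d + 2)).filter fun b =>
        height (d + 1) (cr d c a) ≤ height (d + 1) (cr (d + 1) a b) ∧
        height (d + 1) (cr (d + 1) a b) < height (d + 1) (cr d c' a)).card := by
    rw [← Finset.card_union_of_disjoint]
    · congr 1
      ext b
      simp only [Finset.mem_filter, Finset.mem_union]
      constructor
      · rintro ⟨h, h'⟩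
        rcases lt_or_ge (height (d + 1) (cr (d + 1) a b)) (height (d + 1) (cr d c a)) with h'' | h''
        exacts [.inl ⟨h, h''⟩, .inr ⟨h, h'', h'⟩]
      · rintro (⟨h, h'⟩ | ⟨h, h', h''⟩)
        exacts [⟨h, h'.trans hlt⟩, ⟨h, h''⟩]
    · rw [Finset.disjoint_filter]
      intro b _ h h'
      omega
  rw [hlast c hc W hW hWc hmax, hlast c' hc' W' hW' hWc' hmax', hα, hβ, hstep]
  push_cast
  module

/-- There is no doku tiling whose runs form three classes of `2`, `2` and `3` runs, pairwise
crossing, with runs of length `6`. -/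
theorem IsDokuTiling.not_two_two_three (hT : IsDokuTiling 6 T) (hcr : IsCrossingSystem T cr)
    (h0 : (runsIn T d).card = 3) (h1 : (runsIn T (d + 1)).card = 2)
    (h2 : (runsIn T (d + 2)).card = 2) : False := by
  have hN : NonOverlapping T := hT.nonoverlapping
  obtain ⟨a, ha⟩ : (runsIn T (d + 1)).Nonempty := Finset.card_pos.mp (by omega)
  obtain ⟨p, q, r, hpqr, hpq, hqr⟩ := exists_sorted_triple h0 (f := fun c => height (d + 1) (cr d c a)) (by
    intro c hc c' hc' h
    have hrun := hcr.runOf_eq' d c hc a ha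
    have hrun' := hcr.runOf_eq' d c' hc' a ha
    rw [← hcr.runOf_eq d c hc a ha, hN.height_injOn (hcr.active' d c hc a ha) self_mem_runOf
      (mem_runOf_iff_eq.mpr (hrun'.trans hrun.symm)) h, hcr.runOf_eq d c' hc' a ha])
  have hp : p ∈ runsIn T d := by simp [hpqr]
  have hq : q ∈ runsIn T d := by simp [hpqr]
  have hr : r ∈ runsIn T d := by simp [hpqr]
  have hall : ∀ x ∈ runsIn T d, x = p ∨ x = q ∨ x = r := by simp [hpqr]
  -- Of the six tiles at most 2 + 2 are crossings, which leaves the two tiles required.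
  obtain ⟨P, hP, hPc, hPm⟩ := hT.exists_last hp (by omega)
  obtain ⟨Q, hQ, hQc, hQm⟩ := hT.exists_last hq (by omega)
  obtain ⟨R, hR, hRc, hRm⟩ := hT.exists_last hr (by omega)
  have hPQ := hT.last_consecutive hcr h0.le ha hp hq hP hQ hPc hQc hPm hQm hpq (by
    intro x hx h h'
    rcases hall x hx with rfl | rfl | rfl
    · rfl
    · omega
    · omega)
  have hQR := hT.last_consecutive hcr h0.le ha hq hr hQ hR hQc hRc hQm hRm hqr (by
    intro x hx h h'
    rcases hall x hx with rfl | rfl | rfl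
    · omega
    · rfl
    · omega)
  have hact : ∀ R ∈ runsIn T d, ∀ X ∈ R, Active T d X := by
    intro R hR X hX
    obtain ⟨Y, hY, rfl⟩ := mem_runsIn.mp hR
    exact active_of_mem_runOf hY hX
  have hend : ∀ R ∈ runsIn T d, ∀ X ∈ R, ¬ IsCrossing T X → ∀ d', d' ≠ d → ¬ Active T d' X := by
    intro R hR X hX h d' hd' h'
    refine h fun e he => ?_
    have hX' := hact R hR X hX
    have ht := hX'.type_ne hN
    have ht' := h'.type_ne hN
    by_cases hed : e = d
    · exact hed ▸ hX'
    · exact fin3_eq_of_ne hd' ht ht' he hed ▸ h'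
  have hP' := hact p hp P hP
  have hQ' := hact q hq Q hQ
  have hR' := hact r hr R hR
  have t1 := hN.types_of_consecutive hP'.mem hQ'.mem (hP'.type_ne hN) (hQ'.type_ne hN) hPQ
    (hend p hp P hP hPc)
  have t2 := hN.types_of_consecutive hQ'.mem hR'.mem (hQ'.type_ne hN) (hR'.type_ne hN) hQR
    (hend q hq Q hQ hQc)
  -- The middle tile `Q` has type `d + 2` as the second of the pair `P`, `Q` and type `d + 1` as the
  -- first of the pair `Q`, `R`.
  exact (fin3_ne d).2.2.1 (t2.1.symm.trans t1.2)

theorem not_exists_dokuTiling_26_7_6 :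
    ¬ ∃ T : Finset Lozenge, IsDokuTiling 6 T ∧ T.card = 26 ∧ (runs T).ncard = 7 := by
  rintro ⟨T, hT, hcard, hruns⟩
  have hN : NonOverlapping T := hT.nonoverlapping
  have h1 := hT.card_crossings (by omega)
  have hn := hN.ncard_runs
  rw [hcard, hruns] at h1
  rw [hruns] at hn
  have c0 := hN.card_crossings_le 0
  have c1 := hN.card_crossings_le 1
  have c2 := hN.card_crossings_le 2
  simp only [Fin.isValue, zero_add, Fin.reduceAdd] at c0 c1 c2
  -- There are 42 - 26 = 16 crossings, which is the maximum of `n₀n₁ + n₁n₂ + n₂n₀` for `n₀ + n₁ +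
  -- n₂ = 7`, attained only for 3, 2, 2 in some order. So every single bound is an equality too.
  have key : ((runsIn T 0).card = 3 ∧ (runsIn T 1).card = 2 ∧ (runsIn T 2).card = 2 ∨
      (runsIn T 0).card = 2 ∧ (runsIn T 1).card = 3 ∧ (runsIn T 2).card = 2 ∨
      (runsIn T 0).card = 2 ∧ (runsIn T 1).card = 2 ∧ (runsIn T 2).card = 3) ∧
      ((runsIn T 1).card * (runsIn T 2).card ≤ (crossings T 0).card ∧
      (runsIn T 2).card * (runsIn T 0).card ≤ (crossings T 1).card ∧
      (runsIn T 0).card * (runsIn T 1).card ≤ (crossings T 2).card) := by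
    generalize (crossings T 0).card = k0 at *
    generalize (crossings T 1).card = k1 at *
    generalize (crossings T 2).card = k2 at *
    generalize (runsIn T 0).card = n0 at *
    generalize (runsIn T 1).card = n1 at *
    have : n0 ≤ 7 := by omega
    have : n1 ≤ 7 := by omega
    have h2 : (runsIn T 2).card = 7 - n0 - n1 := by omega
    rw [h2] at c0 c1 hn ⊢
    clear h2
    interval_cases n0 <;> interval_cases n1 <;> omega
  have hcross : ∀ d, (runsIn T d).card * (runsIn T (d + 1)).card ≤ (crossings T (d + 2)).card := by
    obtain ⟨-, h0, h1, h2⟩ := key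
    intro d
    fin_cases d
    exacts [h2, h0, h1]
  -- Stated for arbitrary sets, with an irrelevant tile when they are no runs, so that `choose`
  -- gives a total function.
  have hex : ∀ d, ∀ R R', ∃ X, R ∈ runsIn T d → R' ∈ runsIn T (d + 1) → X.type = d + 2 ∧
      Active T d X ∧ Active T (d + 1) X ∧ runOf T d X = R ∧ runOf T (d + 1) X = R' := by
    intro d R R'
    by_cases hR : R ∈ runsIn T d
    · by_cases hR' : R' ∈ runsIn T (d + 1)
      · obtain ⟨e1, e2, e3, e4⟩ := fin3_add d
        obtain ⟨X, -, hX⟩ := hN.exists_crossing (t := d + 2) (by rw [e3, e4]; exact hcross d)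
          (e3.symm ▸ hR) (e4.symm ▸ hR')
        rw [e3, e4] at hX
        exact ⟨X, fun _ _ => hX⟩
      · exact ⟨⟨0, 0⟩, fun _ h => absurd h hR'⟩
    · exact ⟨⟨0, 0⟩, fun h => absurd h hR⟩
  choose cr hcr using hex
  have hsys : IsCrossingSystem T cr :=
    ⟨fun d R h R' h' => (hcr d R R' h h').1, fun d R h R' h' => (hcr d R R' h h').2.1,
      fun d R h R' h' => (hcr d R R' h h').2.2.1, fun d R h R' h' => (hcr d R R' h h').2.2.2.1,
      fun d R h R' h' => (hcr d R R' h h').2.2.2.2⟩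
  rcases key.1 with ⟨h0, h1, h2⟩ | ⟨h0, h1, h2⟩ | ⟨h0, h1, h2⟩
  · exact hT.not_two_two_three hsys (d := 0) h0 h1 h2
  · exact hT.not_two_two_three hsys (d := 1) h1 h2 h0
  · exact hT.not_two_two_three hsys (d := 2) h2 h0 h1

end

/-! ### Criteria for doku tilings -/

theorem triangles_disjoint {X Y : Lozenge}
    (h : upTriangle X.diagonal ≠ upTriangle Y.diagonal ∧
      downTriangle X.diagonal ≠ downTriangle Y.diagonal) : Disjoint X.triangles Y.triangles := by
  rw [Set.disjoint_left]
  intro t ht ht'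
  rw [mem_triangles_iff] at ht ht'
  rcases ht with rfl | rfl <;> rcases ht' with h' | h'
  · exact h.1 h'
  · simp [upTriangle, downTriangle] at h'
  · simp [upTriangle, downTriangle] at h'
  · exact h.2 h'

theorem dualGraph_preconnected_of_rank {T : Finset Lozenge} (r : Lozenge → ℕ)
    (h : ∀ X ∈ T, r X ≠ 0 → ∃ Y ∈ T, r Y < r X ∧ (X.sides ∩ Y.sides).Nonempty)
    (h0 : ∀ X ∈ T, ∀ Y ∈ T, r X = 0 → r Y = 0 → X ≠ Y → (X.sides ∩ Y.sides).Nonempty) :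
    (dualGraph T).Preconnected := by
  refine preconnected_of_rank (fun X : T => r X) (fun X hX => ?_) fun X Y hX hY => ?_
  · obtain ⟨Y, hY, hlt, hs⟩ := h X X.2 hX
    exact ⟨⟨Y, hY⟩, ⟨by rintro rfl; exact lt_irrefl _ hlt, hs⟩, hlt⟩
  · by_cases hne : X = Y
    · exact hne ▸ .refl _
    · exact SimpleGraph.Adj.reachable ⟨hne, h0 X X.2 Y Y.2 hX hY fun h => hne (Subtype.ext h)⟩

/-- When `W` is removed, at least one of the two lower tiles survives, so the descent to rank zero
is still possible. -/
theorem neighbourGraph_preconnected_of_rank {T : Finset Lozenge} (r : Lozenge → ℕ)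
    (h : ∀ X ∈ T, r X ≠ 0 → ∃ Y ∈ T, ∃ Z ∈ T, Y ≠ Z ∧ r Y < r X ∧ r Z < r X ∧
      (X.vertices ∩ Y.vertices).Nonempty ∧ (X.vertices ∩ Z.vertices).Nonempty)
    (h0 : ∀ X ∈ T, ∀ Y ∈ T, r X = 0 → r Y = 0 → (X.vertices ∩ Y.vertices).Nonempty) (W : T) :
    ((neighbourGraph T).induce {W}ᶜ).Preconnected := by
  refine preconnected_of_rank (fun X : ({W}ᶜ : Set T) => r X.1) (fun X hX => ?_) fun X Y hX hY => ?_
  · obtain ⟨Y, hY, hYW, hlt, hv⟩ : ∃ Y ∈ T, Y ≠ W.1 ∧ r Y < r X.1 ∧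
        (X.1.1.vertices ∩ Y.vertices).Nonempty := by
      obtain ⟨Y, hY, Z, hZ, hne, h1, h2, h3, h4⟩ := h X.1 X.1.2 hX
      by_cases hYW : Y = W.1
      · exact ⟨Z, hZ, fun h => hne (hYW.trans h.symm), h2, h4⟩
      · exact ⟨Y, hY, hYW, h1, h3⟩
    refine ⟨⟨⟨Y, hY⟩, fun h => hYW (congrArg Subtype.val h)⟩, ?_, hlt⟩
    refine SimpleGraph.comap_adj.mpr ⟨?_, hv⟩
    intro h
    have : X.1.1 = Y := congrArg Subtype.val h
    exact lt_irrefl _ (this ▸ hlt)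
  · by_cases hne : X = Y
    · exact hne ▸ .refl _
    · exact SimpleGraph.Adj.reachable (SimpleGraph.comap_adj.mpr
        ⟨fun h => hne (Subtype.ext h), h0 X.1 X.1.2 Y.1 Y.1.2 hX hY⟩)

/-- Two triangles are joined by a path in `U`. -/
def Joined (U : Set UnitTriangle) (s t : UnitTriangle) : Prop :=
  ∃ (hs : s ∈ U) (ht : t ∈ U), (triangleGraph.induce U).Reachable ⟨s, hs⟩ ⟨t, ht⟩

section
variable {U : Set UnitTriangle} {r s t : UnitTriangle}

theorem Joined.refl (h : s ∈ U) : Joined U s s := ⟨h, h, .refl _⟩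

theorem Joined.symm (h : Joined U s t) : Joined U t s := by
  obtain ⟨hs, ht, h⟩ := h
  exact ⟨ht, hs, h.symm⟩

theorem Joined.trans (h : Joined U r s) (h' : Joined U s t) : Joined U r t := by
  obtain ⟨hr, _, h⟩ := h
  obtain ⟨_, ht, h'⟩ := h'
  exact ⟨hr, ht, h.trans h'⟩

theorem joined_of_seg {e : (ℤ × ℤ) × Fin 3} (h : upTriangle e ∈ U) (h' : downTriangle e ∈ U) :
    Joined U (upTriangle e) (downTriangle e) :=
  ⟨h, h', SimpleGraph.Adj.reachable (SimpleGraph.comap_adj.mpr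
    ((triangleGraph_adj_iff _ _).mpr ⟨e, .inl ⟨rfl, rfl⟩⟩))⟩

theorem preconnected_of_joined (b : UnitTriangle) (h : ∀ s ∈ U, Joined U s b) :
    (triangleGraph.induce U).Preconnected := by
  rintro ⟨s, hs⟩ ⟨t, ht⟩
  obtain ⟨_, _, h⟩ := (h s hs).trans (h t ht).symm
  exact h

theorem joined_of_mem {X : Lozenge} (hX : X.triangles ⊆ U) (hs : s ∈ X.triangles)
    (ht : t ∈ X.triangles) : Joined U s t := by
  have h1 := hX hs
  have h2 := hX ht
  rw [mem_triangles_iff] at hs ht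
  rcases hs with rfl | rfl <;> rcases ht with rfl | rfl
  · exact .refl h1
  · exact joined_of_seg h1 h2
  · exact (joined_of_seg h2 h1).symm
  · exact .refl h1

theorem joined_of_side {X Y : Lozenge} (hX : X.triangles ⊆ U) (hY : Y.triangles ⊆ U)
    {e : (ℤ × ℤ) × Fin 3} (hXe : e ∈ X.sides) (hYe : e ∈ Y.sides) (hs : s ∈ X.triangles)
    (ht : t ∈ Y.triangles) : Joined U s t := by
  rcases triangle_of_mem_sides hXe with ⟨h1, -⟩ | ⟨-, h1⟩ <;>
    rcases triangle_of_mem_sides hYe with ⟨h2, -⟩ | ⟨-, h2⟩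
  · exact (joined_of_mem hX hs h1).trans (joined_of_mem hY h2 ht)
  · exact (joined_of_mem hX hs h1).trans ((joined_of_seg (hX h1) (hY h2)).trans (joined_of_mem hY h2 ht))
  · exact (joined_of_mem hX hs h1).trans
      ((joined_of_seg (hY h2) (hX h1)).symm.trans (joined_of_mem hY h2 ht))
  · exact (joined_of_mem hX hs h1).trans (joined_of_mem hY h2 ht)

/-- Moving along a strip of free tiles. -/
theorem joined_of_strip {f : ℤ → Lozenge} (hf : ∀ k, ((f k).sides ∩ (f (k + 1)).sides).Nonempty)
    {a b : ℤ} (hab : a ≤ b) (hU : ∀ k, a ≤ k → k ≤ b → (f k).triangles ⊆ U)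
    (hs : s ∈ (f a).triangles) (ht : t ∈ (f b).triangles) : Joined U s t := by
  induction b, hab using Int.leInduction generalizing t with
  | base => exact joined_of_mem (hU a le_rfl le_rfl) hs ht
  | succ b hab ih =>
    obtain ⟨e, he⟩ := hf b
    rw [Finset.mem_inter] at he
    have hm : upTriangle (f b).diagonal ∈ (f b).triangles := (mem_triangles_iff _ _).mpr (.inl rfl)
    exact (ih (fun k h h' => hU k h (by omega)) hm).trans
      (joined_of_side (hU b hab (by omega)) (hU _ (by omega) le_rfl) he.1 he.2 hm ht)

theorem joined_of_strip' {f : ℤ → Lozenge} (hf : ∀ k, ((f k).sides ∩ (f (k + 1)).sides).Nonempty)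
    (a b : ℤ)
    (hU : ∀ k, min a b ≤ k → k ≤ max a b → (f k).triangles ⊆ U)
    (hs : s ∈ (f a).triangles) (ht : t ∈ (f b).triangles) : Joined U s t := by
  rcases le_total a b with h | h
  · exact joined_of_strip hf h (by simpa [h] using hU) hs ht
  · exact (joined_of_strip hf h (by simpa [h] using hU) ht hs).symm

end

/-- The runs of one direction, when the pairs of tiles sharing a side of this direction are the
consecutive pairs of some sequences. -/
theorem runsIn_of_sequences {T : Finset Lozenge} {d : Fin 3} {κ : ℕ} (hκ : 2 ≤ κ) {ι : Type*}
    (I : Finset ι) (f : ι → ℕ → Lozenge)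
    (hadj : ∀ r ∈ I, ∀ k, k + 1 < κ → (stripGraph T d).Adj (f r k) (f r (k + 1)))
    (hadj' : ∀ X Y, (stripGraph T d).Adj X Y → ∃ r ∈ I, ∃ k, k + 1 < κ ∧
      (X = f r k ∧ Y = f r (k + 1) ∨ X = f r (k + 1) ∧ Y = f r k))
    (hinj : ∀ r ∈ I, ∀ r' ∈ I, ∀ k < κ, ∀ k' < κ, f r k = f r' k' → r = r' ∧ k = k') :
    (runsIn T d).card = I.card ∧ ∀ R ∈ runsIn T d, R.ncard = κ := by
  classical
  have hreach : ∀ r ∈ I, ∀ k < κ, (stripGraph T d).Reachable (f r k) (f r 0) := by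
    intro r hr k
    induction k with
    | zero => exact fun _ => .refl _
    | succ k ih => exact fun h => (hadj r hr k h).symm.reachable.trans (ih (by omega))
  have hrun : ∀ r ∈ I, runOf T d (f r 0) = f r '' Set.Iio κ := by
    intro r hr
    ext X
    rw [mem_runOf]
    constructor
    · rintro ⟨p⟩
      have key : ∀ A B (p : (stripGraph T d).Walk A B), B ∈ f r '' Set.Iio κ → A ∈ f r '' Set.Iio κ := by
        intro A B p
        induction p with
        | nil => exact id
        | cons h p ih =>
          intro hB
          obtain ⟨k, hk, rfl⟩ := ih hB
          obtain ⟨r', hr', k', hk', ⟨rfl, h'⟩ | ⟨rfl, h'⟩⟩ := hadj' _ _ h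
          · obtain ⟨rfl, rfl⟩ := hinj r hr r' hr' k hk _ hk' h'
            exact ⟨k', by simp; omega, rfl⟩
          · obtain ⟨rfl, rfl⟩ := hinj r hr r' hr' k hk _ (by omega) h'
            exact ⟨k + 1, hk', rfl⟩
      exact key _ _ p ⟨0, by simp; omega, rfl⟩
    · rintro ⟨k, hk, rfl⟩
      exact hreach r hr k hk
  have hmem : ∀ R, R ∈ runsIn T d ↔ ∃ r ∈ I, runOf T d (f r 0) = R := by
    intro R
    rw [mem_runsIn]
    constructor
    · rintro ⟨X, ⟨Y, hXY⟩, rfl⟩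
      obtain ⟨r, hr, k, hk, h⟩ := hadj' X Y hXY
      refine ⟨r, hr, (runOf_eq (mem_runOf.mpr ?_)).symm⟩
      rcases h with ⟨rfl, -⟩ | ⟨rfl, -⟩
      · exact hreach r hr k (by omega)
      · exact hreach r hr _ hk
    · rintro ⟨r, hr, rfl⟩
      exact ⟨f r 0, ⟨_, hadj r hr 0 (by omega)⟩, rfl⟩
  constructor
  · have : runsIn T d = I.image fun r => runOf T d (f r 0) := by
      ext R
      rw [hmem, Finset.mem_image]
    rw [this, Finset.card_image_of_injOn]
    intro r hr r' hr' h
    have h1 : f r 0 ∈ runOf T d (f r' 0) := by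
      have : f r 0 ∈ runOf T d (f r 0) := self_mem_runOf
      rwa [show runOf T d (f r 0) = runOf T d (f r' 0) from h] at this
    rw [hrun r' hr'] at h1
    obtain ⟨k, hk, h2⟩ := h1
    exact (hinj r hr r' hr' 0 (by omega) k hk h2.symm).1
  · intro R hR
    obtain ⟨r, hr, rfl⟩ := (hmem R).mp hR
    rw [hrun r hr, Set.InjOn.ncard_image, ← Finset.coe_Iio, Set.ncard_coe_finset, Nat.card_Iio]
    intro k hk k' hk' h
    exact (hinj r hr r hr k hk k' hk' h).2

/-! ### The tiling of the plane by three sectors -/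

/-- The tile with coordinates `i`, `j` of the sector spanned by `u (q + 1)` and `u (q + 2)`. -/
def cell (q : Fin 3) (i j : ℕ) : Lozenge := tileAt q ((i : ℤ) • u (q + 1) + (j : ℤ) • u (q + 2))

/-- The strip of direction `d` that crosses the ray spanned by `u d` at distance `n`. -/
def strip (d : Fin 3) (n : ℕ) : ℤ → Lozenge
  | .ofNat t => cell (d + 2) n t
  | .negSucc t => cell (d + 1) t n

/-- The position of the side between the tiles `t - 1` and `t` of a strip. -/
def stripSide (d : Fin 3) (n : ℕ) (t : ℤ) : ℤ × ℤ :=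
  (n : ℤ) • u d + (max t 0) • u (d + 1) + (max (-t) 0) • u (d + 2)

theorem stripSide_injective {d : Fin 3} {n n' : ℕ} {t t' : ℤ}
    (h : stripSide d n t = stripSide d n' t') : n = n' ∧ t = t' := by
  rw [Prod.ext_iff] at h
  fin_cases d <;> simp [stripSide, u] at h <;> omega

theorem cell_injective {q q' : Fin 3} {i j i' j' : ℕ} (h : cell q i j = cell q' i' j') :
    q = q' ∧ i = i' ∧ j = j' := by
  have hq : q = q' := congrArg Lozenge.type h
  subst hq
  have hc := congrArg Lozenge.corner h
  simp only [cell, tileAt_corner] at hc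
  rw [Prod.ext_iff] at hc
  fin_cases q <;> simp [u] at hc ⊢ <;> omega

theorem strip_natCast (d : Fin 3) (n t : ℕ) : strip d n t = cell (d + 2) n t := rfl

theorem strip_neg (d : Fin 3) (n t : ℕ) : strip d n (-t - 1) = cell (d + 1) t n := by
  rw [show (-t - 1 : ℤ) = Int.negSucc t by omega]; rfl

theorem strip_type_ne (d : Fin 3) (n : ℕ) (t : ℤ) : (strip d n t).type ≠ d := by
  cases t
  exacts [(fin3_ne d).2.1, (fin3_ne d).1]

theorem strip_injective {d : Fin 3} {n n' : ℕ} {t t' : ℤ} (h : strip d n t = strip d n' t') :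
    n = n' ∧ t = t' := by
  cases t <;> cases t' <;> obtain ⟨h1, h2, h3⟩ := cell_injective h
  · exact ⟨h2, congrArg _ h3⟩
  · exact absurd h1.symm (fin3_ne d).2.2.1
  · exact absurd h1 (fin3_ne d).2.2.1
  · exact ⟨h3, congrArg _ h2⟩

theorem mem_sides_strip {d : Fin 3} {n : ℕ} {t : ℤ} {p : ℤ × ℤ} :
    seg d p ∈ (strip d n t).sides ↔ p = stripSide d n t ∨ p = stripSide d n (t + 1) := by
  rw [mem_sides_iff]
  simp only [ne_eq, strip_type_ne d n t, not_false_eq_true, true_and]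
  obtain ⟨e1, e2, e3, e4⟩ := fin3_add d
  cases t with
  | ofNat t =>
    have h1 : low d (strip d n (Int.ofNat t)) = stripSide d n (t + 1) := by
      change low d (cell (d + 2) n t) = _
      rw [low_of_type_eq (by rfl), cell, tileAt_corner, stripSide, e3, e4,
        max_eq_left (by omega), max_eq_right (by omega)]
      module
    have h2 : low d (strip d n (Int.ofNat t)) + step d (strip d n (Int.ofNat t)) = stripSide d n t := by
      rw [h1, step, if_pos (show (strip d n (Int.ofNat t)).type = d + 2 from rfl), stripSide,
        stripSide, max_eq_left (by omega), max_eq_right (by omega), max_eq_left (by omega),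
        max_eq_right (by omega)]
      module
    rw [h2, h1, or_comm]
    rfl
  | negSucc t =>
    have hne : (strip d n (Int.negSucc t)).type ≠ d + 2 := (fin3_ne d).2.2.1
    have h1 : low d (strip d n (Int.negSucc t)) = stripSide d n (Int.negSucc t + 1) := by
      rw [low_of_type_ne hne]
      change (cell (d + 1) t n).corner = _
      rw [cell, tileAt_corner, stripSide, e1, e2,
        max_eq_right (by omega), max_eq_left (by omega), show -(Int.negSucc t + 1) = t by omega]
      module
    have h2 : low d (strip d n (Int.negSucc t)) + step d (strip d n (Int.negSucc t)) =
        stripSide d n (Int.negSucc t) := by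
      rw [h1, step, if_neg hne, stripSide,
        stripSide, max_eq_right (by omega), max_eq_left (by omega), max_eq_right (by omega),
        max_eq_left (by omega), show -(Int.negSucc t + 1) = t by omega,
        show -(Int.negSucc t) = t + 1 by omega]
      module
    rw [h2, h1, or_comm]

theorem cell_eq_strip (q : Fin 3) (i j : ℕ) {d : Fin 3} (h : q ≠ d) :
    ∃ n t, cell q i j = strip d n t := by
  rcases fin3_eq_or h with rfl | rfl
  · exact ⟨j, -i - 1, (strip_neg d j i).symm⟩
  · exact ⟨i, j, rfl⟩

theorem strip_sides_inter (d : Fin 3) (n : ℕ) (t : ℤ) :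
    ((strip d n t).sides ∩ (strip d n (t + 1)).sides).Nonempty :=
  ⟨seg d (stripSide d n (t + 1)), Finset.mem_inter.mpr
    ⟨mem_sides_strip.mpr (.inr rfl), mem_sides_strip.mpr (.inl rfl)⟩⟩

/-- Cells that share a side of direction `d` are consecutive on a strip. -/
theorem exists_strip_of_common_side {q q' : Fin 3} {i j i' j' : ℕ} {d : Fin 3} {p : ℤ × ℤ}
    (hne : cell q i j ≠ cell q' i' j')
    (h : (p, d) ∈ (cell q i j).sides) (h' : (p, d) ∈ (cell q' i' j').sides) :
    ∃ n t, cell q i j = strip d n t ∧ cell q' i' j' = strip d n (t + 1) ∨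
      cell q i j = strip d n (t + 1) ∧ cell q' i' j' = strip d n t := by
  obtain ⟨p', hp⟩ := seg_surjective (p, d)
  change (p, d) = seg d p' at hp
  rw [hp] at h h'
  obtain ⟨n, t, ht⟩ := cell_eq_strip q i j (d := d) ((mem_sides_iff _ _ _).mp h).1
  obtain ⟨n', t', ht'⟩ := cell_eq_strip q' i' j' (d := d) ((mem_sides_iff _ _ _).mp h').1
  rw [ht, mem_sides_strip] at h
  rw [ht', mem_sides_strip] at h'
  rcases h with h | h <;> rcases h' with h' | h' <;> rw [h] at h' <;>
    obtain ⟨rfl, hh⟩ := stripSide_injective h'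
  · exact absurd (by rw [ht, ht', hh]) hne
  · exact ⟨n, t', .inr ⟨by rw [ht, hh], ht'⟩⟩
  · exact ⟨n, t, .inl ⟨ht, by rw [ht', hh]⟩⟩
  · exact absurd (by rw [ht, ht', show t = t' by omega]) hne

/-- Together with `exists_cell`: the three sectors tile the whole plane. The holes question thereby
becomes one about cells outside the region. -/
theorem cell_disjoint {q q' : Fin 3} {i j i' j' : ℕ} (h : cell q i j ≠ cell q' i' j') :
    Disjoint (cell q i j).triangles (cell q' i' j').triangles := by
  apply triangles_disjoint
  constructor
  all_goals
    intro h'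
    apply h
    fin_cases q <;> fin_cases q' <;>
      simp [cell, tileAt, upTriangle, downTriangle, Lozenge.diagonal, u] at h' ⊢ <;> omega

theorem exists_cell (t : UnitTriangle) : ∃ q i j, t ∈ (cell q i j).triangles := by
  simp only [mem_triangles_iff]
  obtain ⟨⟨x, y⟩, _ | _⟩ := t
  · by_cases h1 : 0 ≤ x ∧ y < 0
    · refine ⟨2, x.toNat, (-y - 1).toNat, .inr ?_⟩
      simp [cell, tileAt, downTriangle, Lozenge.diagonal, u]; omega
    by_cases h2 : 0 ≤ y ∧ 0 ≤ x + y + 1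
    · refine ⟨1, y.toNat, (x + y + 1).toNat, .inr ?_⟩
      simp [cell, tileAt, downTriangle, Lozenge.diagonal, u]; omega
    · refine ⟨0, (-x - 2 - y).toNat, (-x - 1).toNat, .inr ?_⟩
      simp [cell, tileAt, downTriangle, Lozenge.diagonal, u]; omega
  · by_cases h1 : 0 ≤ x ∧ y < 0
    · refine ⟨2, x.toNat, (-y - 1).toNat, .inl ?_⟩
      simp [cell, tileAt, upTriangle, Lozenge.diagonal, u]; omega
    by_cases h2 : 0 ≤ y ∧ 0 ≤ x + y
    · refine ⟨1, y.toNat, (x + y).toNat, .inl ?_⟩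
      simp [cell, tileAt, upTriangle, Lozenge.diagonal, u]; omega
    · refine ⟨0, (-x - 1 - y).toNat, (-x - 1).toNat, .inl ?_⟩
      simp [cell, tileAt, upTriangle, Lozenge.diagonal, u]; omega

/-- The tile `cell q i j` has the vertices with coordinates `i` or `i + 1` and `j` or `j + 1`. -/
theorem mem_vertices_cell {q : Fin 3} {i j a b : ℕ} (ha : a = i ∨ a = i + 1) (hb : b = j ∨ b = j + 1) :
    (a : ℤ) • u (q + 1) + (b : ℤ) • u (q + 2) ∈ (cell q i j).vertices := by
  rw [mem_vertices_iff]
  simp only [cell, tileAt_corner, tileAt_type]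
  rcases ha with rfl | rfl <;> rcases hb with rfl | rfl
  · exact .inl rfl
  · right; right; left; push_cast; module
  · right; left; push_cast; module
  · right; right; right; push_cast; module

/-- The distance of a tile from the centre. -/
def rank (X : Lozenge) : ℕ :=
  (![-2 * X.corner.1 - X.corner.2, X.corner.1 + 2 * X.corner.2, X.corner.1 - X.corner.2] X.type).toNat

theorem rank_cell (q : Fin 3) (i j : ℕ) : rank (cell q i j) = i + j := by
  unfold rank
  simp only [cell, tileAt_corner, tileAt_type]
  fin_cases q <;> simp [u] <;> omega

/-! ### A hexagon with additional tiles at its boundary -/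

/-- A hexagon, and at the strips of direction `d` with `e d = true` one additional tile, alternately
at the two ends. -/
def InRegion (s : Fin 3 → ℕ) (e : Fin 3 → Bool) (q : Fin 3) (i j : ℕ) : Prop :=
  i < s (q + 1) ∧ j < s (q + 2) ∨ i < s (q + 1) ∧ j = s (q + 2) ∧ e (q + 1) = true ∧ i % 2 = 0 ∨
    j < s (q + 2) ∧ i = s (q + 1) ∧ e (q + 2) = true ∧ j % 2 = 1

/-- The additional tile at a strip. -/
def extra (s : Fin 3 → ℕ) (d : Fin 3) (n : ℕ) : Lozenge :=
  if n % 2 = 0 then cell (d + 2) n (s (d + 1)) else cell (d + 1) (s (d + 2)) n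

/-- The hexagon without the additional tiles. -/
def hexagon (s : Fin 3 → ℕ) : Finset Lozenge :=
  ((Finset.univ : Finset (Fin 3)).sigma fun q => Finset.range (s (q + 1)) ×ˢ Finset.range (s (q + 2))).image
    fun x => cell x.1 x.2.1 x.2.2

/-- The additional tiles. -/
def extras (s : Fin 3 → ℕ) (e : Fin 3 → Bool) : Finset Lozenge :=
  ((Finset.univ : Finset (Fin 3)).sigma fun d => Finset.range (if e d then s d else 0)).image
    fun x => extra s x.1 x.2

/-- The hexagon with the additional tiles. -/
def region (s : Fin 3 → ℕ) (e : Fin 3 → Bool) : Finset Lozenge := hexagon s ∪ extras s e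

variable {s : Fin 3 → ℕ} {e : Fin 3 → Bool}

theorem mem_hexagon {X : Lozenge} :
    X ∈ hexagon s ↔ ∃ q i j, X = cell q i j ∧ i < s (q + 1) ∧ j < s (q + 2) := by
  simp only [hexagon, Finset.mem_image, Finset.mem_sigma, Finset.mem_univ, true_and,
    Finset.mem_product, Finset.mem_range]
  constructor
  · rintro ⟨⟨q, i, j⟩, h, rfl⟩; exact ⟨q, i, j, rfl, h⟩
  · rintro ⟨q, i, j, rfl, h⟩; exact ⟨⟨q, i, j⟩, h, rfl⟩

theorem mem_extras {X : Lozenge} :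
    X ∈ extras s e ↔ ∃ d n, X = extra s d n ∧ e d = true ∧ n < s d := by
  simp only [extras, Finset.mem_image, Finset.mem_sigma, Finset.mem_univ, true_and, Finset.mem_range]
  constructor
  · rintro ⟨⟨d, n⟩, h, rfl⟩
    by_cases he : e d = true
    · exact ⟨d, n, rfl, he, by simpa [he] using h⟩
    · simp [he] at h
  · rintro ⟨d, n, rfl, he, h⟩
    exact ⟨⟨d, n⟩, by simpa [he] using h, rfl⟩

theorem mem_region {X : Lozenge} :
    X ∈ region s e ↔ ∃ q i j, X = cell q i j ∧ InRegion s e q i j := by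
  rw [region, Finset.mem_union, mem_hexagon, mem_extras]
  constructor
  · rintro (⟨q, i, j, rfl, h⟩ | ⟨d, n, rfl, he, h⟩)
    · exact ⟨q, i, j, rfl, .inl h⟩
    · obtain ⟨e1, e2, e3, e4⟩ := fin3_add d
      unfold extra
      split
      · exact ⟨_, _, _, rfl, .inr (.inl ⟨by rwa [e3], by rw [e4], by rwa [e3], by assumption⟩)⟩
      · exact ⟨_, _, _, rfl, .inr (.inr ⟨by rwa [e2], by rw [e1], by rwa [e2], by omega⟩)⟩
  · rintro ⟨q, i, j, rfl, h | ⟨h1, h2, h3, h4⟩ | ⟨h1, h2, h3, h4⟩⟩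
    · exact .inl ⟨q, i, j, rfl, h⟩
    · obtain ⟨e1, e2, e3, e4⟩ := fin3_add q
      exact .inr ⟨q + 1, i, by rw [extra, if_pos h4, e1, e2, h2], h3, h1⟩
    · obtain ⟨e1, e2, e3, e4⟩ := fin3_add q
      exact .inr ⟨q + 2, j, by rw [extra, if_neg (by omega), e3, e4, h2], h3, h1⟩

theorem cell_mem_region {q : Fin 3} {i j : ℕ} : cell q i j ∈ region s e ↔ InRegion s e q i j := by
  rw [mem_region]
  constructor
  · rintro ⟨q', i', j', h, h'⟩
    obtain ⟨rfl, rfl, rfl⟩ := cell_injective h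
    exact h'
  · exact fun h => ⟨q, i, j, rfl, h⟩

theorem card_region : (region s e).card = s 0 * s 1 + s 1 * s 2 + s 2 * s 0 +
    ((if e 0 then s 0 else 0) + (if e 1 then s 1 else 0) + (if e 2 then s 2 else 0)) := by
  rw [region, Finset.card_union_of_disjoint]
  · congr 1
    · rw [hexagon, Finset.card_image_of_injective, Finset.card_sigma, Fin.sum_univ_three]
      · simp only [Finset.card_product, Finset.card_range, Fin.isValue, zero_add, Fin.reduceAdd]
        ring
      · rintro ⟨q, i, j⟩ ⟨q', i', j'⟩ h
        obtain ⟨h1, h2, h3⟩ := cell_injective h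
        simp only at h1 h2 h3
        subst h1 h2 h3
        rfl
    · rw [extras, Finset.card_image_of_injOn, Finset.card_sigma, Fin.sum_univ_three]
      · simp
      · rintro ⟨d, n⟩ hd ⟨d', n'⟩ hd' h
        simp only [Finset.coe_sigma, Set.mem_sigma_iff, Finset.coe_range, Set.mem_Iio] at hd hd'
        have hn : n < s d := by have := hd.2; split at this <;> omega
        have hn' : n' < s d' := by have := hd'.2; split at this <;> omega
        simp only [extra] at h
        split at h <;> split at h <;> obtain ⟨h1, h2, h3⟩ := cell_injective h
        · obtain rfl : d = d' := by omega
          rw [h2]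
        · obtain rfl : d' = d + 1 := by omega
          rw [(fin3_add d).2.1] at h2
          omega
        · obtain rfl : d = d' + 1 := by omega
          rw [(fin3_add d').2.1] at h2
          omega
        · obtain rfl : d = d' := by omega
          rw [h3]
  · rw [Finset.disjoint_left]
    intro X h h'
    obtain ⟨q, i, j, rfl, h1, h2⟩ := mem_hexagon.mp h
    obtain ⟨d, n, h3, h4, h5⟩ := mem_extras.mp h'
    obtain ⟨e1, e2, e3, e4⟩ := fin3_add d
    unfold extra at h3
    split at h3 <;> obtain ⟨rfl, rfl, rfl⟩ := cell_injective h3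
    · rw [e4] at h2; omega
    · rw [e1] at h1; omega

theorem region_nonOverlapping : NonOverlapping (region s e) := by
  intro X hX Y hY hne
  obtain ⟨q, i, j, rfl, -⟩ := mem_region.mp hX
  obtain ⟨q', i', j', rfl, -⟩ := mem_region.mp hY
  exact cell_disjoint hne

theorem cell_sides_inter_left (q : Fin 3) (i j : ℕ) :
    ((cell q (i + 1) j).sides ∩ (cell q i j).sides).Nonempty := by
  have h := strip_sides_inter (q + 2) j (-((i + 1 : ℕ) : ℤ) - 1)
  rw [strip_neg, show -((i + 1 : ℕ) : ℤ) - 1 + 1 = -i - 1 by push_cast; ring, strip_neg,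
    (fin3_add q).2.2.1] at h
  exact h

theorem cell_sides_inter_right (q : Fin 3) (i j : ℕ) :
    ((cell q i (j + 1)).sides ∩ (cell q i j).sides).Nonempty := by
  have h := strip_sides_inter (q + 1) i j
  rw [strip_natCast, show (j : ℤ) + 1 = (j + 1 : ℕ) by push_cast; ring, strip_natCast,
    (fin3_add q).2.1] at h
  rwa [Finset.inter_comm]

theorem centre_sides_inter (d : Fin 3) :
    ((cell (d + 1) 0 0).sides ∩ (cell (d + 2) 0 0).sides).Nonempty := by
  have h := strip_sides_inter d 0 (-1)
  have h1 : strip d 0 (-1) = cell (d + 1) 0 0 := rfl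
  have h2 : strip d 0 (-1 + 1) = cell (d + 2) 0 0 := rfl
  rwa [h1, h2] at h

theorem region_dualGraph_preconnected (hs : ∀ d, 0 < s d) :
    (dualGraph (region s e)).Preconnected := by
  refine dualGraph_preconnected_of_rank rank ?_ ?_
  · intro X hX hr
    obtain ⟨q, i, j, rfl, h⟩ := mem_region.mp hX
    rw [rank_cell] at hr
    have h1 := hs (q + 1)
    have h2 := hs (q + 2)
    unfold InRegion at h
    -- The step towards the centre has to end in the hexagon, so an additional tile at the end of
    -- the first coordinate must decrease `i` and one at the end of the second must decrease `j`.
    by_cases hi : i = 0 ∨ j ≠ 0 ∧ i < s (q + 1)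
    · obtain ⟨j, rfl⟩ := Nat.exists_eq_succ_of_ne_zero (show j ≠ 0 by omega)
      refine ⟨cell q i j, cell_mem_region.mpr ?_, ?_, cell_sides_inter_right q i j⟩
      · left; omega
      · rw [rank_cell, rank_cell]; omega
    · obtain ⟨i, rfl⟩ := Nat.exists_eq_succ_of_ne_zero (show i ≠ 0 by omega)
      refine ⟨cell q i j, cell_mem_region.mpr ?_, ?_, cell_sides_inter_left q i j⟩
      · left; omega
      · rw [rank_cell, rank_cell]; omega
  · intro X hX Y hY hrX hrY hne
    obtain ⟨q, i, j, rfl, -⟩ := mem_region.mp hX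
    obtain ⟨q', i', j', rfl, -⟩ := mem_region.mp hY
    rw [rank_cell] at hrX hrY
    obtain ⟨rfl, rfl⟩ : i = 0 ∧ j = 0 := by omega
    obtain ⟨rfl, rfl⟩ : i' = 0 ∧ j' = 0 := by omega
    have hq : q ≠ q' := by rintro rfl; exact hne rfl
    have h1 := centre_sides_inter (q + 2)
    have h2 := centre_sides_inter (q + 1)
    rw [(fin3_add q).2.2.1, (fin3_add q).2.2.2] at h1
    rw [(fin3_add q).1, (fin3_add q).2.1, Finset.inter_comm] at h2
    rcases fin3_eq_or hq.symm with rfl | rfl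
    exacts [h1, h2]

/-- The corner of a tile away from the centre is also a vertex of two hexagon tiles of smaller rank:
in the same sector if it is inside the sector, in two neighbouring sectors if it is on a ray. All
tiles of rank zero meet at the centre. -/
theorem region_neighbourGraph_preconnected (hs : ∀ d, 0 < s d) (W : region s e) :
    ((neighbourGraph (region s e)).induce {W}ᶜ).Preconnected := by
  refine neighbourGraph_preconnected_of_rank rank ?_ ?_ W
  · intro X hX hr
    obtain ⟨q, i, j, rfl, h⟩ := mem_region.mp hX
    rw [rank_cell] at hr
    obtain ⟨e1, e2, e3, e4⟩ := fin3_add q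
    have h0 := hs q
    have h1 := hs (q + 1)
    have h2 := hs (q + 2)
    unfold InRegion at h
    have hv : ∀ Y : Lozenge, (i : ℤ) • u (q + 1) + (j : ℤ) • u (q + 2) ∈ Y.vertices →
        ((cell q i j).vertices ∩ Y.vertices).Nonempty := fun Y hY =>
      ⟨_, Finset.mem_inter.mpr ⟨mem_vertices_cell (.inl rfl) (.inl rfl), hY⟩⟩
    suffices hsuff : ∃ q₁ i₁ j₁ q₂ i₂ j₂, InRegion s e q₁ i₁ j₁ ∧ InRegion s e q₂ i₂ j₂ ∧
        ¬ (q₁ = q₂ ∧ i₁ = i₂ ∧ j₁ = j₂) ∧ i₁ + j₁ < i + j ∧ i₂ + j₂ < i + j ∧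
        (i : ℤ) • u (q + 1) + (j : ℤ) • u (q + 2) ∈ (cell q₁ i₁ j₁).vertices ∧
        (i : ℤ) • u (q + 1) + (j : ℤ) • u (q + 2) ∈ (cell q₂ i₂ j₂).vertices by
      obtain ⟨q₁, i₁, j₁, q₂, i₂, j₂, a1, a2, a3, a4, a5, a6, a7⟩ := hsuff
      refine ⟨_, cell_mem_region.mpr a1, _, cell_mem_region.mpr a2, fun h => a3 (cell_injective h),
        ?_, ?_, hv _ a6, hv _ a7⟩
      · rw [rank_cell, rank_cell]; exact a4
      · rw [rank_cell, rank_cell]; exact a5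
    rcases Nat.eq_zero_or_eq_succ_pred i with rfl | hi
    · obtain ⟨j, rfl⟩ := Nat.exists_eq_succ_of_ne_zero (show j ≠ 0 by omega)
      refine ⟨q, 0, j, q + 1, j, 0, .inl (by omega), .inl (by rw [e1, e2]; omega), fun h => ?_,
        by omega, by omega, mem_vertices_cell (.inl rfl) (.inr rfl), ?_⟩
      · exact (fin3_ne q).1 h.1.symm
      · have := mem_vertices_cell (q := q + 1) (i := j) (j := 0) (a := j + 1) (b := 0) (.inr rfl) (.inl rfl)
        rw [e1] at this
        simpa using this
    · generalize i.pred = i' at hi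
      subst hi
      rcases Nat.eq_zero_or_eq_succ_pred j with rfl | hj
      · refine ⟨q, i', 0, q + 2, 0, i', .inl (by omega), .inl (by rw [e3, e4]; omega), fun h => ?_,
          by omega, by omega, mem_vertices_cell (.inr rfl) (.inl rfl), ?_⟩
        · exact (fin3_ne q).2.1 h.1.symm
        · have := mem_vertices_cell (q := q + 2) (i := 0) (j := i') (a := 0) (b := i' + 1) (.inl rfl) (.inr rfl)
          rw [e4] at this
          simpa using this
      · generalize j.pred = j' at hj
        subst hj
        by_cases hi : i' + 1 < s (q + 1)
        · refine ⟨q, i', j', q, i' + 1, j', .inl (by omega), .inl (by omega), by omega, by omega,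
            by omega, mem_vertices_cell (.inr rfl) (.inr rfl), mem_vertices_cell (.inl rfl) (.inr rfl)⟩
        · refine ⟨q, i', j', q, i', j' + 1, .inl (by omega), .inl (by omega), by omega, by omega,
            by omega, mem_vertices_cell (.inr rfl) (.inr rfl), mem_vertices_cell (.inr rfl) (.inl rfl)⟩
  · intro X hX Y hY hrX hrY
    obtain ⟨q, i, j, rfl, -⟩ := mem_region.mp hX
    obtain ⟨q', i', j', rfl, -⟩ := mem_region.mp hY
    rw [rank_cell] at hrX hrY
    obtain ⟨rfl, rfl⟩ : i = 0 ∧ j = 0 := by omega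
    obtain ⟨rfl, rfl⟩ : i' = 0 ∧ j' = 0 := by omega
    refine ⟨0, Finset.mem_inter.mpr ⟨?_, ?_⟩⟩
    · simpa using mem_vertices_cell (q := q) (i := 0) (j := 0) (.inl rfl) (.inl rfl)
    · simpa using mem_vertices_cell (q := q') (i := 0) (j := 0) (.inl rfl) (.inl rfl)

/-! ### The complement of the region -/

theorem cell_uncovered {q : Fin 3} {i j : ℕ} (h : ¬ InRegion s e q i j) :
    (cell q i j).triangles ⊆ uncovered (region s e) := by
  intro t ht X hX htX
  obtain ⟨q', i', j', rfl, h'⟩ := mem_region.mp hX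
  by_cases hne : cell q i j = cell q' i' j'
  · obtain ⟨rfl, rfl, rfl⟩ := cell_injective hne
    exact h h'
  · exact Set.disjoint_left.mp (cell_disjoint hne) ht htX

/-- All triangles of two tiles are joined. -/
def TilesJoined (U : Set UnitTriangle) (X Y : Lozenge) : Prop :=
  ∀ r ∈ X.triangles, ∀ t ∈ Y.triangles, Joined U r t

theorem TilesJoined.trans {U : Set UnitTriangle} {X Y Z : Lozenge} (h : TilesJoined U X Y)
    (h' : TilesJoined U Y Z) : TilesJoined U X Z := fun r hr t ht =>
  have hm : upTriangle Y.diagonal ∈ Y.triangles := (mem_triangles_iff _ _).mpr (.inl rfl)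
  (h r hr _ hm).trans (h' _ hm t ht)

/-- Moving along a sector in the direction of the first coordinate, and of the second one. -/
theorem tilesJoined_left {q : Fin 3} {i i' j : ℕ}
    (h : ∀ k, min i i' ≤ k → k ≤ max i i' → ¬ InRegion s e q k j) :
    TilesJoined (uncovered (region s e)) (cell q i j) (cell q i' j) := by
  intro r hr t ht
  have hc : ∀ k : ℕ, cell q k j = strip (q + 2) j (-k - 1) := fun k => by
    rw [strip_neg, (fin3_add q).2.2.1]
  rw [hc] at hr ht
  refine joined_of_strip' (strip_sides_inter (q + 2) j) _ _ (fun k h1 h2 => ?_) hr ht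
  obtain ⟨m, rfl⟩ : ∃ m : ℕ, k = -m - 1 := ⟨(-k - 1).toNat, by omega⟩
  rw [← hc]
  exact cell_uncovered (h m (by omega) (by omega))

theorem tilesJoined_right {q : Fin 3} {i j j' : ℕ}
    (h : ∀ k, min j j' ≤ k → k ≤ max j j' → ¬ InRegion s e q i k) :
    TilesJoined (uncovered (region s e)) (cell q i j) (cell q i j') := by
  intro r hr t ht
  have hc : ∀ k : ℕ, cell q i k = strip (q + 1) i k := fun k => by
    rw [strip_natCast, (fin3_add q).2.1]
  rw [hc] at hr ht
  refine joined_of_strip' (strip_sides_inter (q + 1) i) _ _ (fun k h1 h2 => ?_) hr ht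
  obtain ⟨m, rfl⟩ : ∃ m : ℕ, k = m := ⟨k.toNat, by omega⟩
  rw [← hc]
  exact cell_uncovered (h m (by omega) (by omega))

theorem tilesJoined_next {q : Fin 3} {n : ℕ} (h : s (q + 2) < n) :
    TilesJoined (uncovered (region s e)) (cell q 0 n) (cell (q + 1) n 0) := by
  intro r hr t ht
  obtain ⟨x, hx⟩ := strip_sides_inter (q + 2) n (-1)
  obtain ⟨e1, e2, e3, e4⟩ := fin3_add q
  have h1 : strip (q + 2) n (-1) = cell q 0 n := by
    change cell (q + 2 + 1) 0 n = _
    rw [e3]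
  have h2 : strip (q + 2) n (-1 + 1) = cell (q + 1) n 0 := by
    change cell (q + 2 + 2) n 0 = _
    rw [e4]
  rw [h1, h2, Finset.mem_inter] at hx
  refine joined_of_side (cell_uncovered ?_) (cell_uncovered ?_) hx.1 hx.2 hr ht
  · unfold InRegion; omega
  · unfold InRegion; rw [e1, e2]; omega

/-- From an uncovered cell one can move straight outwards: beyond the hexagon a row holds at most
one additional tile, next to the hexagon, and this is not ahead. At distance `N` all cells are free
and one can go around through the three sectors. -/
theorem region_no_holes : (triangleGraph.induce (uncovered (region s e))).Preconnected := by
  obtain ⟨N, hN⟩ : ∃ N, ∀ d, s d < N := ⟨s 0 + s 1 + s 2 + 1, fun d => by fin_cases d <;> simp <;> omega⟩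
  have hout : ∀ q i j, N ≤ i ∨ N ≤ j → ¬ InRegion s e q i j := by
    intro q i j h h'
    have h1 := hN (q + 1)
    have h2 := hN (q + 2)
    unfold InRegion at h'
    omega
  have hstep : ∀ q, TilesJoined (uncovered (region s e)) (cell q N 0) (cell (q + 1) N 0) := fun q =>
    ((tilesJoined_right (j' := N) fun k _ _ => hout _ _ _ (.inl le_rfl)).trans
      (tilesJoined_left (i' := 0) fun k _ _ => hout _ _ _ (.inr le_rfl))).trans (tilesJoined_next (hN _))
  have hhub : ∀ q, TilesJoined (uncovered (region s e)) (cell q N 0) (cell 0 N 0) := by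
    intro q
    fin_cases q
    · exact (hstep 0).trans ((hstep 1).trans (hstep 2))
    · exact (hstep 1).trans (hstep 2)
    · exact hstep 2
  refine preconnected_of_joined (upTriangle (cell 0 N 0).diagonal) fun t ht => ?_
  obtain ⟨q, i, j, htc⟩ := exists_cell t
  have hnot : ¬ InRegion s e q i j := fun h => ht _ (cell_mem_region.mpr h) htc
  suffices h : TilesJoined (uncovered (region s e)) (cell q i j) (cell 0 N 0) from
    h t htc _ ((mem_triangles_iff _ _).mpr (.inl rfl))
  have h1 := hN (q + 1)
  have h2 := hN (q + 2)
  by_cases hi : s (q + 1) ≤ i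
  · have ha : ∀ k, min i N ≤ k → k ≤ max i N → ¬ InRegion s e q k j := by
      intro k hk hk'
      by_cases hki : k = i
      · exact hki ▸ hnot
      · unfold InRegion; omega
    exact ((tilesJoined_left ha).trans
      (tilesJoined_right (j' := 0) fun k _ _ => hout _ _ _ (.inl le_rfl))).trans (hhub q)
  · have hj : s (q + 2) ≤ j := by unfold InRegion at hnot; omega
    have ha : ∀ k, min j N ≤ k → k ≤ max j N → ¬ InRegion s e q i k := by
      intro k hk hk'
      by_cases hki : k = j
      · exact hki ▸ hnot
      · unfold InRegion; omega
    exact (((tilesJoined_right ha).trans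
      (tilesJoined_left (i' := 0) fun k _ _ => hout _ _ _ (.inr le_rfl))).trans
        (tilesJoined_next (hN _))).trans (hhub (q + 1))

/-! ### The runs of the region -/

/-- Where the run on a strip begins. -/
def runStart (s : Fin 3 → ℕ) (e : Fin 3 → Bool) (d : Fin 3) (n : ℕ) : ℤ :=
  -s (d + 2) - if e d = true ∧ n % 2 = 1 then 1 else 0

theorem strip_mem_region {d : Fin 3} {n : ℕ} (hn : n < s d) (t : ℤ) :
    strip d n t ∈ region s e ↔ runStart s e d n ≤ t ∧
      t < runStart s e d n + (s (d + 1) + s (d + 2) + if e d then 1 else 0 : ℕ) := by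
  obtain ⟨e1, e2, e3, e4⟩ := fin3_add d
  cases t with
  | ofNat t =>
    change cell (d + 2) n t ∈ _ ↔ _
    rw [cell_mem_region, InRegion, e3, e4, runStart]
    cases he : e d <;> simp <;> (try split) <;> omega
  | negSucc t =>
    change cell (d + 1) t n ∈ _ ↔ _
    rw [cell_mem_region, InRegion, e1, e2, runStart]
    cases he : e d <;> simp <;> (try split) <;> omega

/-- This is what the alternation is for. Outside the hexagon such a strip meets only additional
tiles of other directions, in one sector at odd and in the other at even coordinates; so no two are
consecutive, even across the ray between the sectors, where both coordinates are 0. Hence no further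
runs arise. -/
theorem strip_not_both_mem_region {d : Fin 3} {n : ℕ} (hn : s d ≤ n) (t : ℤ)
    (h : strip d n t ∈ region s e) (h' : strip d n (t + 1) ∈ region s e) : False := by
  obtain ⟨e1, e2, e3, e4⟩ := fin3_add d
  rcases lt_or_ge t (-1) with ht | ht
  · obtain ⟨m, rfl⟩ : ∃ m : ℕ, t = -((m + 1 : ℕ) : ℤ) - 1 := ⟨(-t - 2).toNat, by omega⟩
    rw [show -((m + 1 : ℕ) : ℤ) - 1 + 1 = -m - 1 by push_cast; ring, strip_neg, cell_mem_region] at h'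
    rw [strip_neg, cell_mem_region] at h
    unfold InRegion at h h'
    rw [e1, e2] at h h'
    omega
  · obtain rfl | ⟨m, rfl⟩ : t = -1 ∨ ∃ m : ℕ, t = m := by
      by_cases h1 : t = -1
      · exact .inl h1
      · exact .inr ⟨t.toNat, by omega⟩
    · rw [show (-1 + 1 : ℤ) = (0 : ℕ) by norm_num, strip_natCast, cell_mem_region] at h'
      unfold InRegion at h'
      rw [e3, e4] at h'
      omega
    · rw [show (m : ℤ) + 1 = (m + 1 : ℕ) by push_cast; ring, strip_natCast, cell_mem_region] at h'
      rw [strip_natCast, cell_mem_region] at h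
      unfold InRegion at h h'
      rw [e3, e4] at h h'
      omega

/-- The strips at distance less than `s d` meet the region in intervals of equal length, and the
other strips contain no two consecutive tiles of it. -/
theorem region_runsIn {κ : ℕ} (hκ : 2 ≤ κ) (d : Fin 3)
    (hd : κ = s (d + 1) + s (d + 2) + if e d then 1 else 0) :
    (runsIn (region s e) d).card = s d ∧ ∀ R ∈ runsIn (region s e) d, R.ncard = κ := by
  rw [← Finset.card_range (s d)]
  refine runsIn_of_sequences hκ (Finset.range (s d)) (fun n k => strip d n (runStart s e d n + k)) ?_ ?_ ?_
  · intro n hn k hk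
    rw [Finset.mem_range] at hn
    have h1 := (strip_mem_region (e := e) hn (runStart s e d n + k)).mpr (by rw [← hd]; omega)
    have h2 := (strip_mem_region (e := e) hn (runStart s e d n + (k + 1 : ℕ))).mpr (by rw [← hd]; omega)
    refine ⟨h1, h2, fun h => ?_, (seg d (stripSide d n (runStart s e d n + k + 1))).1, ?_, ?_⟩
    · have := (strip_injective h).2
      push_cast at this
      omega
    · exact mem_sides_strip.mpr (.inr rfl)
    · exact mem_sides_strip.mpr (.inl (by push_cast; rw [add_assoc]))
  · rintro X Y ⟨hX, hY, hne, p, h1, h2⟩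
    obtain ⟨q, i, j, rfl, -⟩ := mem_region.mp hX
    obtain ⟨q', i', j', rfl, -⟩ := mem_region.mp hY
    obtain ⟨n, t, h⟩ := exists_strip_of_common_side hne h1 h2
    have hm : strip d n t ∈ region s e ∧ strip d n (t + 1) ∈ region s e := by
      rcases h with ⟨h, h'⟩ | ⟨h, h'⟩ <;> rw [← h, ← h']
      exacts [⟨hX, hY⟩, ⟨hY, hX⟩]
    have hn : n < s d := by
      by_contra hn
      exact strip_not_both_mem_region (by omega) t hm.1 hm.2
    rw [strip_mem_region hn, strip_mem_region hn, ← hd] at hm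
    refine ⟨n, Finset.mem_range.mpr hn, (t - runStart s e d n).toNat, by omega, ?_⟩
    rwa [show runStart s e d n + ((t - runStart s e d n).toNat : ℤ) = t by omega,
      show runStart s e d n + (((t - runStart s e d n).toNat + 1 : ℕ) : ℤ) = t + 1 by omega]
  · intro n _ n' _ k _ k' _ h
    obtain ⟨rfl, h⟩ := strip_injective h
    exact ⟨rfl, by omega⟩

theorem region_isDokuTiling {κ : ℕ} (hκ : 2 ≤ κ) (hs : ∀ d, 0 < s d)
    (hd : ∀ d, κ = s (d + 1) + s (d + 2) + if e d then 1 else 0) :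
    IsDokuTiling κ (region s e) ∧ (runs (region s e)).ncard = s 0 + s 1 + s 2 := by
  constructor
  · refine ⟨region_nonOverlapping, ?_, region_neighbourGraph_preconnected hs, region_no_holes, ?_⟩
    · have : Nonempty (region s e) :=
        ⟨⟨cell 0 0 0, cell_mem_region.mpr (.inl ⟨hs _, hs _⟩)⟩⟩
      exact ⟨region_dualGraph_preconnected hs⟩
    · intro R hR
      obtain ⟨d, hR⟩ := mem_runs_iff.mp hR
      exact (region_runsIn hκ d (hd d)).2 R hR
  · rw [region_nonOverlapping.ncard_runs, (region_runsIn hκ 0 (hd 0)).1,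
      (region_runsIn hκ 1 (hd 1)).1, (region_runsIn hκ 2 (hd 2)).1]

/-! ### Sporadic tilings -/

/-- The triangle on the other side of the side of direction `d`. -/
def across (t : UnitTriangle) (d : Fin 3) : UnitTriangle :=
  if t.up then ⟨(t.pos.1 - ![0, 1, 0] d, t.pos.2 - ![1, 0, 0] d), false⟩
  else ⟨(t.pos.1 + ![0, 1, 0] d, t.pos.2 + ![1, 0, 0] d), true⟩

theorem triangleGraph_adj_across (t : UnitTriangle) (d : Fin 3) :
    triangleGraph.Adj t (across t d) := by
  obtain ⟨⟨x, y⟩, i⟩ := t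
  rw [triangleGraph_adj_iff]
  cases i
  · refine ⟨((x + ![0, 1, 1] d, y + ![1, 0, 0] d), d), .inr ?_⟩
    fin_cases d <;> simp [across, upTriangle, downTriangle]
  · refine ⟨((x + ![0, 0, 1] d, y), d), .inl ?_⟩
    fin_cases d <;> simp [across, upTriangle, downTriangle]

/-- The triangles with a coordinate of absolute value at least four. -/
def IsOuter (t : UnitTriangle) : Prop :=
  (t.pos.1 ≤ -4 ∨ 4 ≤ t.pos.1) ∨ t.pos.2 ≤ -4 ∨ 4 ≤ t.pos.2

instance : DecidablePred IsOuter := fun t =>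
  inferInstanceAs (Decidable ((t.pos.1 ≤ -4 ∨ 4 ≤ t.pos.1) ∨ t.pos.2 ≤ -4 ∨ 4 ≤ t.pos.2))

theorem joined_of_isOuter {U : Set UnitTriangle} (hU : ∀ t, IsOuter t → t ∈ U) {t : UnitTriangle}
    (ht : IsOuter t) : Joined U t ⟨(4, 4), true⟩ := by
  have hsub : ∀ x y : ℤ, (x ≤ -4 ∨ 4 ≤ x) ∨ y ≤ -4 ∨ 4 ≤ y →
      (⟨(x, y), 2⟩ : Lozenge).triangles ⊆ U := by
    intro x y h s hs
    rw [mem_triangles_two] at hs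
    rcases hs with rfl | rfl <;> exact hU _ h
  -- The tiles of type 2 are the cells of a square grid in the coordinates. Outside the box one goes
  -- along a free column or row and then along the row or column at 4.
  have hcol : ∀ x y : ℤ, ((⟨(x, y), 2⟩ : Lozenge).sides ∩ (⟨(x, y + 1), 2⟩ : Lozenge).sides).Nonempty :=
    fun x y => ⟨((x, y + 1), 0), by simp [Lozenge.sides, dir]⟩
  have hrow : ∀ x y : ℤ, ((⟨(x, y), 2⟩ : Lozenge).sides ∩ (⟨(x + 1, y), 2⟩ : Lozenge).sides).Nonempty :=
    fun x y => ⟨((x + 1, y), 1), by simp [Lozenge.sides, dir]⟩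
  have hmem : ∀ x y : ℤ, (⟨(x, y), true⟩ : UnitTriangle) ∈ (⟨(x, y), 2⟩ : Lozenge).triangles :=
    fun x y => (mem_triangles_two _ _ _).mpr (.inr rfl)
  obtain ⟨⟨x, y⟩, i⟩ := t
  have ht' : (⟨(x, y), i⟩ : UnitTriangle) ∈ (⟨(x, y), 2⟩ : Lozenge).triangles := by
    rw [mem_triangles_two]
    cases i <;> simp
  rcases ht with h | h
  · exact (joined_of_strip' (f := fun k => ⟨(x, k), 2⟩) (hcol x) y 4
      (fun k _ _ => hsub _ _ (.inl h)) ht' (hmem x 4)).trans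
      (joined_of_strip' (f := fun k => ⟨(k, 4), 2⟩) (fun k => hrow k 4) x 4
        (fun k _ _ => hsub _ _ (.inr (.inr le_rfl))) (hmem x 4) (hmem 4 4))
  · exact (joined_of_strip' (f := fun k => ⟨(k, y), 2⟩) (fun k => hrow k y) x 4
      (fun k _ _ => hsub _ _ (.inr h)) ht' (hmem 4 y)).trans
      (joined_of_strip' (f := fun k => ⟨(4, k), 2⟩) (hcol 4) y 4
        (fun k _ _ => hsub _ _ (.inl (.inr le_rfl))) (hmem 4 y) (hmem 4 4))

/-- A triangle is not covered by the tiles of a list. -/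
def IsFree (L : List Lozenge) (t : UnitTriangle) : Prop :=
  ∀ X ∈ L, t ≠ upTriangle X.diagonal ∧ t ≠ downTriangle X.diagonal

instance (L : List Lozenge) : DecidablePred (IsFree L) := fun t =>
  inferInstanceAs (Decidable (∀ X ∈ L, t ≠ upTriangle X.diagonal ∧ t ≠ downTriangle X.diagonal))

/-- Crossing sides of directions `a` and `b` alternately, one gets through uncovered triangles to an
outer triangle in at most `n` steps. -/
def Escapes (L : List Lozenge) : ℕ → Fin 3 → Fin 3 → UnitTriangle → Prop
  | 0, _, _, t => IsFree L t ∧ IsOuter t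
  | n + 1, a, b, t => IsFree L t ∧ (IsOuter t ∨ Escapes L n b a (across t a))

instance Escapes.decidable (L : List Lozenge) : ∀ n a b t, Decidable (Escapes L n a b t)
  | 0, _, _, t => inferInstanceAs (Decidable (IsFree L t ∧ IsOuter t))
  | n + 1, a, b, t =>
    have := Escapes.decidable L n b a (across t a)
    inferInstanceAs (Decidable (IsFree L t ∧ (IsOuter t ∨ Escapes L n b a (across t a))))

theorem mem_uncovered_iff {L : List Lozenge} {t : UnitTriangle} :
    t ∈ uncovered L.toFinset ↔ IsFree L t := by
  simp [uncovered, IsFree, mem_triangles_iff]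

theorem Escapes.joined {L : List Lozenge} {n : ℕ} {a b : Fin 3} {t : UnitTriangle}
    (hL : ∀ t, IsOuter t → IsFree L t) (h : Escapes L n a b t) :
    Joined (uncovered L.toFinset) t ⟨(4, 4), true⟩ := by
  have hout : ∀ t, IsOuter t → Joined (uncovered L.toFinset) t ⟨(4, 4), true⟩ := fun t =>
    joined_of_isOuter fun t ht => mem_uncovered_iff.mpr (hL t ht)
  induction n generalizing a b t with
  | zero => exact hout t h.2
  | succ n ih =>
    obtain ⟨hf, h | h⟩ := h
    · exact hout t h
    · have h1 := ih h
      have h2 := h1.1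
      have h3 : Joined (uncovered L.toFinset) t (across t a) :=
        ⟨mem_uncovered_iff.mpr hf, h2, SimpleGraph.Adj.reachable
          (SimpleGraph.comap_adj.mpr (triangleGraph_adj_across t a))⟩
      exact h3.trans h1

/-- Two tiles of a list share a side of direction `d`. -/
def ShareSide (L : List Lozenge) (d : Fin 3) (X Y : Lozenge) : Prop :=
  X ∈ L ∧ Y ∈ L ∧ X ≠ Y ∧ ∃ e ∈ X.sides, e.2 = d ∧ e ∈ Y.sides

instance (L : List Lozenge) (d : Fin 3) (X Y : Lozenge) : Decidable (ShareSide L d X Y) :=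
  inferInstanceAs (Decidable (X ∈ L ∧ Y ∈ L ∧ X ≠ Y ∧ ∃ e ∈ X.sides, e.2 = d ∧ e ∈ Y.sides))

theorem stripGraph_adj_iff {L : List Lozenge} {d : Fin 3} {X Y : Lozenge} :
    (stripGraph L.toFinset d).Adj X Y ↔ ShareSide L d X Y := by
  change (X ∈ L.toFinset ∧ Y ∈ L.toFinset ∧ X ≠ Y ∧ ∃ q, (q, d) ∈ X.sides ∧ (q, d) ∈ Y.sides) ↔ _
  rw [List.mem_toFinset, List.mem_toFinset, ShareSide]
  refine and_congr_right fun _ => and_congr_right fun _ => and_congr_right fun _ => ?_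
  constructor
  · rintro ⟨q, h, h'⟩
    exact ⟨_, h, rfl, h'⟩
  · rintro ⟨⟨q, _⟩, h, rfl, h'⟩
    exact ⟨q, h, h'⟩

/-- The conditions for a list of tiles to be a doku tiling, with given runs, that are verified by
computation. -/
structure Certificate (κ : ℕ) (L : List Lozenge) (runs : Fin 3 → List (List Lozenge)) : Prop where
  nonoverlapping : ∀ X ∈ L, ∀ Y ∈ L, X ≠ Y → upTriangle X.diagonal ≠ upTriangle Y.diagonal ∧
    downTriangle X.diagonal ≠ downTriangle Y.diagonal
  -- The position in the list serves as rank, so the tiles must be listed in a suitable order.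
  connected : ∀ X ∈ L, L.idxOf X ≠ 0 → ∃ Y ∈ L, L.idxOf Y < L.idxOf X ∧
    (X.sides ∩ Y.sides).Nonempty
  -- Truncated subtraction gives rank zero to the first two tiles of the list; every later tile must
  -- touch two tiles of smaller rank.
  two_connected : ∀ X ∈ L, L.idxOf X - 1 ≠ 0 → ∃ Y ∈ L, ∃ Z ∈ L, Y ≠ Z ∧
    L.idxOf Y - 1 < L.idxOf X - 1 ∧ L.idxOf Z - 1 < L.idxOf X - 1 ∧
    (X.vertices ∩ Y.vertices).Nonempty ∧ (X.vertices ∩ Z.vertices).Nonempty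
  two_connected' : ∀ X ∈ L, ∀ Y ∈ L, L.idxOf X - 1 = 0 → L.idxOf Y - 1 = 0 →
    (X.vertices ∩ Y.vertices).Nonempty
  bounded : ∀ X ∈ L, ¬ IsOuter (upTriangle X.diagonal) ∧ ¬ IsOuter (downTriangle X.diagonal)
  -- The inner triangles have coordinates from -3 to 3. Crossing two different directions
  -- alternately follows a straight strip and advances by one in two steps, so 16 steps suffice to
  -- leave the box.
  escapes : ∀ x < 7, ∀ y < 7, ∀ i, IsFree L ⟨((x : ℕ) - 3, (y : ℕ) - 3), i⟩ →
    ∃ a b, Escapes L 16 a b ⟨((x : ℕ) - 3, (y : ℕ) - 3), i⟩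
  runs_adj : ∀ d, ∀ r < (runs d).length, ∀ k < κ - 1,
    ShareSide L d (((runs d).getD r []).getD k ⟨0, 0⟩) (((runs d).getD r []).getD (k + 1) ⟨0, 0⟩)
  adj_runs : ∀ d, ∀ X ∈ L, ∀ Y ∈ L, ShareSide L d X Y → ∃ r < (runs d).length, ∃ k < κ - 1,
    X = ((runs d).getD r []).getD k ⟨0, 0⟩ ∧ Y = ((runs d).getD r []).getD (k + 1) ⟨0, 0⟩ ∨
    X = ((runs d).getD r []).getD (k + 1) ⟨0, 0⟩ ∧ Y = ((runs d).getD r []).getD k ⟨0, 0⟩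
  runs_inj : ∀ d, ∀ r < (runs d).length, ∀ r' < (runs d).length, ∀ k < κ, ∀ k' < κ,
    ((runs d).getD r []).getD k ⟨0, 0⟩ = ((runs d).getD r' []).getD k' ⟨0, 0⟩ → r = r' ∧ k = k'

theorem Certificate.isDokuTiling {κ : ℕ} {L : List Lozenge} {R : Fin 3 → List (List Lozenge)}
    (h : Certificate κ L R) (hκ : 2 ≤ κ) (hL : L ≠ []) :
    IsDokuTiling κ L.toFinset ∧
      (runs L.toFinset).ncard = (R 0).length + (R 1).length + (R 2).length := by
  have hdisj : ∀ X ∈ L.toFinset, ∀ Y ∈ L.toFinset, X ≠ Y → Disjoint X.triangles Y.triangles := by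
    intro X hX Y hY hne
    exact triangles_disjoint (h.nonoverlapping X (by simpa using hX) Y (by simpa using hY) hne)
  have hidx : ∀ X ∈ L, ∀ Y ∈ L, L.idxOf X = L.idxOf Y → X = Y := fun X hX Y _ he =>
    (List.idxOf_inj hX).mp he
  have hruns : ∀ d, (runsIn L.toFinset d).card = (R d).length ∧
      ∀ S ∈ runsIn L.toFinset d, S.ncard = κ := by
    intro d
    rw [← Finset.card_range (R d).length]
    refine runsIn_of_sequences hκ (Finset.range (R d).length)
      (fun r k => ((R d).getD r []).getD k ⟨0, 0⟩) ?_ ?_ ?_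
    · intro r hr k hk
      exact stripGraph_adj_iff.mpr (h.runs_adj d r (by simpa using hr) k (by omega))
    · intro X Y hXY
      rw [stripGraph_adj_iff] at hXY
      obtain ⟨r, hr, k, hk, h'⟩ := h.adj_runs d X hXY.1 Y hXY.2.1 hXY
      exact ⟨r, by simpa using hr, k, by omega, h'⟩
    · intro r hr r' hr' k hk k' hk'
      exact h.runs_inj d r (by simpa using hr) r' (by simpa using hr') k hk k' hk'
  have hfree : ∀ t, IsOuter t → IsFree L t := by
    intro t ht X hX
    refine ⟨?_, ?_⟩
    · rintro rfl; exact (h.bounded X hX).1 ht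
    · rintro rfl; exact (h.bounded X hX).2 ht
  refine ⟨⟨hdisj, ?_, fun W => ?_, ?_, fun S hS => ?_⟩, ?_⟩
  · obtain ⟨X, hX⟩ := List.exists_mem_of_ne_nil L hL
    have : Nonempty L.toFinset := ⟨⟨X, by simpa using hX⟩⟩
    refine ⟨dualGraph_preconnected_of_rank L.idxOf ?_ ?_⟩
    · simpa using h.connected
    · intro X hX Y hY h1 h2 hne
      exact absurd (hidx X (by simpa using hX) Y (by simpa using hY) (h1.trans h2.symm)) hne
  · exact neighbourGraph_preconnected_of_rank (fun X => L.idxOf X - 1)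
      (by simpa only [List.mem_toFinset] using h.two_connected)
      (by simpa only [List.mem_toFinset] using h.two_connected') W
  · refine preconnected_of_joined ⟨(4, 4), true⟩ fun s hs => ?_
    have hs' := mem_uncovered_iff.mp hs
    by_cases ho : IsOuter s
    · exact Escapes.joined (n := 0) (a := 0) (b := 0) hfree ⟨hs', ho⟩
    · obtain ⟨⟨x, y⟩, i⟩ := s
      simp only [IsOuter] at ho
      have hx : ((x + 3).toNat : ℤ) - 3 = x := by omega
      have hy : ((y + 3).toNat : ℤ) - 3 = y := by omega
      have := h.escapes (x + 3).toNat (by omega) (y + 3).toNat (by omega) i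
      rw [hx, hy] at this
      obtain ⟨a, b, hab⟩ := this hs'
      exact hab.joined hfree
  · obtain ⟨d, hd⟩ := mem_runs_iff.mp hS
    exact (hruns d).2 S hd
  · rw [NonOverlapping.ncard_runs hdisj, (hruns 0).1, (hruns 1).1, (hruns 2).1]

-- With two runs some direction has none, so no hexagon with positive sides is available. The same
-- holds for (5, 2, 3).
set_option synthInstance.maxSize 1000 in
set_option synthInstance.maxHeartbeats 200000 in
theorem exists_dokuTiling_3_2_2 :
    ∃ T, IsDokuTiling 2 T ∧ T.card = 3 ∧ (runs T).ncard = 2 := by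
  have h : Certificate 2 [⟨(0, 0), 2⟩, ⟨(1, -1), 1⟩, ⟨(0, 0), 0⟩]
      ![[[⟨(0, 0), 2⟩, ⟨(1, -1), 1⟩]], [[⟨(0, 0), 2⟩, ⟨(0, 0), 0⟩]], []] := by
    constructor <;> decide +kernel
  obtain ⟨h1, h2⟩ := h.isDokuTiling le_rfl (by simp)
  exact ⟨_, h1, by decide, h2⟩

set_option synthInstance.maxSize 1000 in
set_option synthInstance.maxHeartbeats 200000 in
theorem exists_dokuTiling_5_2_3 :
    ∃ T, IsDokuTiling 3 T ∧ T.card = 5 ∧ (runs T).ncard = 2 := by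
  have h : Certificate 3
      [⟨(0, 0), 2⟩, ⟨(0, 1), 1⟩, ⟨(2, -1), 0⟩, ⟨(0, -1), 2⟩, ⟨(-1, 0), 2⟩]
      ![[[⟨(0, 1), 1⟩, ⟨(0, 0), 2⟩, ⟨(0, -1), 2⟩]], [[⟨(2, -1), 0⟩, ⟨(0, 0), 2⟩, ⟨(-1, 0), 2⟩]], []] := by
    constructor <;> decide +kernel
  obtain ⟨h1, h2⟩ := h.isDokuTiling (by simp) (by simp)
  exact ⟨_, h1, by decide, h2⟩

set_option synthInstance.maxSize 1000 in
set_option synthInstance.maxHeartbeats 200000 in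
theorem exists_dokuTiling_9_3_4 :
    ∃ T, IsDokuTiling 4 T ∧ T.card = 9 ∧ (runs T).ncard = 3 := by
  have h : Certificate 4
      [⟨(0, -1), 2⟩, ⟨(0, -1), 0⟩, ⟨(0, 0), 1⟩, ⟨(1, -2), 1⟩, ⟨(1, -1), 2⟩, ⟨(0, -2), 0⟩,
        ⟨(-2, 0), 2⟩, ⟨(-1, 1), 1⟩, ⟨(1, 0), 0⟩]
      ![[[⟨(1, -2), 1⟩, ⟨(0, -1), 2⟩, ⟨(0, 0), 1⟩, ⟨(-1, 1), 1⟩]],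
        [[⟨(1, -1), 2⟩, ⟨(0, -1), 2⟩, ⟨(0, -1), 0⟩, ⟨(-2, 0), 2⟩]],
        [[⟨(0, -2), 0⟩, ⟨(0, -1), 0⟩, ⟨(0, 0), 1⟩, ⟨(1, 0), 0⟩]]] := by
    constructor <;> decide +kernel
  obtain ⟨h1, h2⟩ := h.isDokuTiling (by simp) (by simp)
  exact ⟨_, h1, by decide, h2⟩

-- As for (9, 3, 4), `κ` exceeds by one what a hexagon with at most one additional tile per run
-- gives. Not all crossings lie around a common centre here.
set_option synthInstance.maxSize 1000 in
set_option synthInstance.maxHeartbeats 200000 in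
theorem exists_dokuTiling_11_4_4 :
    ∃ T, IsDokuTiling 4 T ∧ T.card = 11 ∧ (runs T).ncard = 4 := by
  have h : Certificate 4
      [⟨(0, -1), 2⟩, ⟨(0, -1), 0⟩, ⟨(0, 0), 1⟩, ⟨(-1, 0), 0⟩, ⟨(-1, 1), 1⟩, ⟨(2, -2), 0⟩,
        ⟨(0, -2), 0⟩, ⟨(-2, 0), 1⟩, ⟨(1, 0), 1⟩, ⟨(-2, 2), 1⟩, ⟨(0, 1), 0⟩]
      ![[[⟨(0, -1), 2⟩, ⟨(0, 0), 1⟩, ⟨(-1, 1), 1⟩, ⟨(-2, 2), 1⟩]],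
        [[⟨(2, -2), 0⟩, ⟨(0, -1), 2⟩, ⟨(0, -1), 0⟩, ⟨(-1, 0), 0⟩]],
        [[⟨(0, -2), 0⟩, ⟨(0, -1), 0⟩, ⟨(0, 0), 1⟩, ⟨(1, 0), 1⟩],
          [⟨(-2, 0), 1⟩, ⟨(-1, 0), 0⟩, ⟨(-1, 1), 1⟩, ⟨(0, 1), 0⟩]]] := by
    constructor <;> decide +kernel
  obtain ⟨h1, h2⟩ := h.isDokuTiling (by simp) (by simp)
  exact ⟨_, h1, by decide, h2⟩

/-! ### Existence -/

theorem exists_of_region {κ a b c : ℕ} {e₀ e₁ e₂ : Bool} (hκ : 2 ≤ κ) (ha : 0 < a) (hb : 0 < b)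
    (hc : 0 < c) (h₀ : κ = b + c + if e₀ then 1 else 0) (h₁ : κ = c + a + if e₁ then 1 else 0)
    (h₂ : κ = a + b + if e₂ then 1 else 0) :
    ∃ T, IsDokuTiling κ T ∧ T.card = a * b + b * c + c * a +
      ((if e₀ then a else 0) + (if e₁ then b else 0) + (if e₂ then c else 0)) ∧
      (runs T).ncard = a + b + c := by
  obtain ⟨h, h'⟩ := region_isDokuTiling (κ := κ) (s := ![a, b, c]) (e := ![e₀, e₁, e₂]) hκ
    (by intro d; fin_cases d <;> assumption) (by intro d; fin_cases d <;> assumption)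
  exact ⟨_, h, card_region, h'⟩

/-- Regular hexagon of side `m`: without additional tiles for `κ = 2m`, with one for every run for
`κ = 2m + 1`. -/
theorem exists_dokuTiling_three_mul {τ m κ : ℕ} (hm : 1 ≤ m) (hτ : τ + 3 * m ^ 2 = κ * (3 * m))
    (hl : 2 * (3 * m ^ 2) ≤ κ * (3 * m)) (hu : κ * (3 * m) ≤ 3 * m + 2 * (3 * m ^ 2) + 3) :
    ∃ T, IsDokuTiling κ T ∧ T.card = τ ∧ (runs T).ncard = 3 * m := by
  have h1 : 2 * m ≤ κ := by nlinarith
  obtain ⟨j, rfl⟩ := Nat.exists_eq_add_of_le h1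
  -- The upper bound says `m * j ≤ m + 1`, so `j ≥ 2` is possible only for `m = 1`, `j = 2`.
  obtain rfl | rfl | hj : j = 0 ∨ j = 1 ∨ 2 ≤ j := by omega
  · obtain ⟨T, h, h', h''⟩ := exists_of_region (κ := 2 * m + 0) (a := m) (b := m) (c := m)
      (e₀ := false) (e₁ := false) (e₂ := false) (by omega) hm hm hm (by simp; omega) (by simp; omega)
      (by simp; omega)
    exact ⟨T, h, by simp at h'; nlinarith, by omega⟩
  · obtain ⟨T, h, h', h''⟩ := exists_of_region (κ := 2 * m + 1) (a := m) (b := m) (c := m)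
      (e₀ := true) (e₁ := true) (e₂ := true) (by omega) hm hm hm (by simp; omega) (by simp; omega)
      (by simp; omega)
    exact ⟨T, h, by simp at h'; nlinarith, by omega⟩
  · obtain rfl : m = 1 := by nlinarith
    obtain rfl : j = 2 := by omega
    obtain rfl : τ = 9 := by omega
    exact exists_dokuTiling_9_3_4

theorem exists_dokuTiling_three_mul_add_one {τ m κ : ℕ} (hm : 1 ≤ m)
    (hτ : τ + (3 * m ^ 2 + 2 * m) = κ * (3 * m + 1))
    (hl : 2 * (3 * m ^ 2 + 2 * m) ≤ κ * (3 * m + 1))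
    (hu : κ * (3 * m + 1) ≤ 3 * m + 1 + 2 * (3 * m ^ 2 + 2 * m) + 3)
    (hne : (τ, 3 * m + 1, κ) ≠ (26, 7, 6)) :
    ∃ T, IsDokuTiling κ T ∧ T.card = τ ∧ (runs T).ncard = 3 * m + 1 := by
  have h1 : 2 * m + 1 ≤ κ := by
    by_contra! h
    nlinarith
  obtain ⟨j, rfl⟩ := Nat.exists_eq_add_of_le h1
  obtain rfl | hj : j = 0 ∨ 1 ≤ j := by omega
  · obtain ⟨T, h, h', h''⟩ := exists_of_region (κ := 2 * m + 1 + 0) (a := m) (b := m) (c := m + 1)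
      (e₀ := false) (e₁ := false) (e₂ := true) (by omega) hm hm (by omega) (by simp; omega)
      (by simp; omega) (by simp; omega)
    exact ⟨T, h, by simp at h'; nlinarith, by omega⟩
  -- The upper bound says `j * (3m + 1) ≤ 2m + 3`. For `m = 1` this admits (11, 4, 4), and for `m =
  -- 2` exactly the exceptional triple.
  · have h2 : m ≤ 2 := by nlinarith
    obtain rfl | rfl : m = 1 ∨ m = 2 := by omega
    · obtain rfl : j = 1 := by omega
      obtain rfl : τ = 11 := by omega
      exact exists_dokuTiling_11_4_4
    · obtain rfl : j = 1 := by omega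
      obtain rfl : τ = 26 := by omega
      exact absurd rfl hne

theorem exists_dokuTiling_three_mul_add_two {τ m κ : ℕ} (hκ : 2 ≤ κ)
    (hτ : τ + (3 * m ^ 2 + 4 * m + 1) = κ * (3 * m + 2))
    (hl : 2 * (3 * m ^ 2 + 4 * m + 1) ≤ κ * (3 * m + 2))
    (hu : κ * (3 * m + 2) ≤ 3 * m + 2 + 2 * (3 * m ^ 2 + 4 * m + 1) + 3) :
    ∃ T, IsDokuTiling κ T ∧ T.card = τ ∧ (runs T).ncard = 3 * m + 2 := by
  obtain rfl | hm : m = 0 ∨ 1 ≤ m := by omega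
  · obtain rfl | rfl : κ = 2 ∨ κ = 3 := by omega
    · obtain rfl : τ = 3 := by omega
      exact exists_dokuTiling_3_2_2
    · obtain rfl : τ = 5 := by omega
      exact exists_dokuTiling_5_2_3
  -- For `m ≥ 1` the bounds leave only this value. With sides `m`, `m + 1`, `m + 1` the runs of
  -- direction 0 have this length already, and those of the other two directions lack one tile.
  · obtain rfl : κ = 2 * m + 2 := by
      apply le_antisymm
      · by_contra! h
        nlinarith
      · by_contra! h
        nlinarith
    obtain ⟨T, h, h', h''⟩ := exists_of_region (κ := 2 * m + 2) (a := m) (b := m + 1) (c := m + 1)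
      (e₀ := false) (e₁ := true) (e₂ := true) (by omega) hm (by omega) (by omega) (by simp; omega)
      (by simp; omega) (by simp; omega)
    exact ⟨T, h, by simp at h'; nlinarith, by omega⟩

theorem exists_dokuTiling {τ ρ κ : ℕ} (h : IsTuranTriple τ ρ κ) (hne : (τ, ρ, κ) ≠ (26, 7, 6)) :
    ∃ T, IsDokuTiling κ T ∧ T.card = τ ∧ (runs T).ncard = ρ := by
  obtain ⟨hκ, hρ, hτ, hl, hu⟩ := h
  obtain ⟨m, rfl | rfl | rfl⟩ : ∃ m, ρ = 3 * m ∨ ρ = 3 * m + 1 ∨ ρ = 3 * m + 2 :=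
    ⟨ρ / 3, by omega⟩
  · have : (3 * m) ^ 2 / 3 = 3 * m ^ 2 := by
      rw [show (3 * m) ^ 2 = 3 * (3 * m ^ 2) by ring]
      omega
    rw [this] at hτ hl hu
    exact exists_dokuTiling_three_mul (by omega) hτ hl hu
  · have : (3 * m + 1) ^ 2 / 3 = 3 * m ^ 2 + 2 * m := by
      rw [show (3 * m + 1) ^ 2 = 3 * (3 * m ^ 2 + 2 * m) + 1 by ring]
      omega
    rw [this] at hτ hl hu
    exact exists_dokuTiling_three_mul_add_one (by omega) hτ hl hu hne
  · have : (3 * m + 2) ^ 2 / 3 = 3 * m ^ 2 + 4 * m + 1 := by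
      rw [show (3 * m + 2) ^ 2 = 3 * (3 * m ^ 2 + 4 * m + 1) + 1 by ring]
      omega
    rw [this] at hτ hl hu
    exact exists_dokuTiling_three_mul_add_two hκ hτ hl hu

end Tredoku

theorem mainTheorem7 (τ ρ κ : ℕ) (h : Tredoku.IsTuranTriple τ ρ κ) :
    (∃ T : Finset Tredoku.Lozenge,
      Tredoku.IsDokuTiling κ T ∧ T.card = τ ∧ (Tredoku.runs T).ncard = ρ) ↔
    (τ, ρ, κ) ≠ (26, 7, 6) := by
  constructor
  · rintro hT h
    simp only [Prod.mk.injEq] at h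
    obtain ⟨rfl, rfl, rfl⟩ := h
    exact Tredoku.not_exists_dokuTiling_26_7_6 hT
  · intro hne
    exact Tredoku.exists_dokuTiling h hne
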